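/- **Theorem (Observability inequality).** Let $(M,g)$ be a smooth compact Riemannian manifold with boundary, of dimension $n\ge 1$, and let $\mu\in C^\infty(M)$ be strictly positive. Let $dV$ and $dS$ be the Riemannian volume and surface measures, $dm=\mu\,dV$, $\nu$ the exterior unit normal on $\partial M$, $D^2$ the Hessian with respect to the Levi-Civita connection, $(\cdot,\cdot)$ and $|\cdot|$ the inner product and norm of $g$, and $$\Delta_\mu f=\mu^{-1}\operatorname{div}(\mu\nabla f).$$ Let $\ell\in C^3(M)$ and $\rho,r>0$ satisfy $$D^2\ell(X,X)\ge\rho|X|^2,\qquad |\nabla\ell(x)|\ge r,\qquad \text{for all } x\in M,\ X\in T_xM,$$ and let $\Gamma\subset\partial M$ be a measurable set containing $\{x\in\partial M:\ (\nabla\ell,\nu)>0\}$. Let $C_F\ge1$ be a constant such that $$\int_M\phi^2\,dm\le C_F\int_M|\nabla\phi|^2\,dm\qquad\text{for all smooth $\phi$ compactly supported in the interior of $M$.}$$ Set $$C_1=\rho^2+\max_M|\nabla(\Delta_\mu\ell)|^2,\quad C_2=3\max_M|\nabla\ell|,\quad C_3=C_F\max_M|\nabla\ell|^2,\quad C_4=\max_M|\nabla\ell|+\tfrac12C_F\max_M|\Delta_\mu\ell-\rho|,$$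 $$B_\ell=2\max_M\ell,\qquad \beta_\ell=2\min_M\ell,\qquad \tau=\max\Big(\frac3\rho,\frac{C_1}{2\rho r^2}\Big),$$ and suppose that $$T>2(C_3\tau+C_4)\,e^{(B_\ell-\beta_\ell)\tau}\,\tau .$$ Then every real-valued $u\in C^2([0,T]\times M)$ with $\partial_t^2u-\Delta_\mu u=0$ in $(0,T)\times M$ and $u=0$ on $(0,T)\times\partial M$ satisfies $$E(0)\le C(T)\int_0^T\int_\Gamma(\partial_\nu u)^2\,\mu\,dS\,dt,\qquad C(T)=\frac{C_2\,e^{(B_\ell-\beta_\ell)\tau}\,\tau}{T-2(C_3\tau+C_4)\,e^{(B_\ell-\beta_\ell)\tau}\,\tau},$$ where $E(t)=\int_M\big((\partial_tu(t))^2+|\nabla u(t)|^2\big)\,dm$ and $\partial_\nu u=(\nabla u,\nu)$. -/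

import Mathlib

open scoped Manifold ContDiff

noncomputable section

namespace WeightedWave

variable {n : ℕ} [NeZero n] {M : Type*} [TopologicalSpace M]
  [ChartedSpace (EuclideanHalfSpace n) M] [IsManifold (𝓡∂ n) ∞ M]

/-- Smooth Riemannian metrics on the smooth `n`-manifold with boundary `M`. -/
abbrev SmoothMetric (n : ℕ) [NeZero n] (M : Type*) [TopologicalSpace M]
    [ChartedSpace (EuclideanHalfSpace n) M] [IsManifold (𝓡∂ n) ∞ M] :=
  Bundle.ContMDiffRiemannianMetric (𝓡∂ n) ∞ (EuclideanSpace ℝ (Fin n))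
    (fun x : M => TangentSpace (𝓡∂ n) x)

/-- The norm `|X|_g` of a tangent vector. -/
def gnorm (g : SmoothMetric n M) (x : M) (X : TangentSpace (𝓡∂ n) x) : ℝ :=
  Real.sqrt (g.inner x X X)

/-- The gradient `∇_g f`: the vector representing the differential of `f` with respect to `g`
(see `inner_gradient`). -/
def gradient (g : SmoothMetric n M) (f : M → ℝ) (x : M) : TangentSpace (𝓡∂ n) x :=
  (g.inner x).inverse (mvfderiv (𝓡∂ n) f x)

/-- `(∇f, X)_g = df(X)`; thus the inverse in the definition of the gradient is a true one. -/
theorem inner_gradient (g : SmoothMetric n M) (f : M → ℝ) (x : M) (X : TangentSpace (𝓡∂ n) x) :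
    g.inner x (gradient g f x) X = mvfderiv (𝓡∂ n) f x X := by
  let E := EuclideanSpace ℝ (Fin n)
  let B : E →L[ℝ] (E →L[ℝ] ℝ) := g.inner x
  have hinj : Function.Injective (B : E →ₗ[ℝ] (E →L[ℝ] ℝ)) := by
    rw [← LinearMap.ker_eq_bot, LinearMap.ker_eq_bot']
    intro v hv
    by_contra hne
    have hpos : 0 < B v v := g.pos x v hne
    have hzero : B v = 0 := hv
    simp [hzero] at hpos
  have hdim : Module.finrank ℝ E = Module.finrank ℝ (E →L[ℝ] ℝ) := by
    rw [← (LinearMap.toContinuousLinearMap (𝕜 := ℝ) (E := E) (F' := ℝ)).finrank_eq]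
    exact Subspace.dual_finrank_eq.symm
  let e : E ≃L[ℝ] (E →L[ℝ] ℝ) :=
    (LinearEquiv.ofInjectiveOfFinrankEq (B : E →ₗ[ℝ] (E →L[ℝ] ℝ)) hinj hdim).toContinuousLinearEquiv
  have he : (e : E →L[ℝ] (E →L[ℝ] ℝ)) = B := by
    ext v w
    rfl
  have hB : ∀ φ : E →L[ℝ] ℝ, B (B.inverse φ) = φ := by
    intro φ
    rw [← he, ContinuousLinearMap.inverse_equiv]
    exact e.apply_symm_apply φ
  exact congrArg (fun φ : E →L[ℝ] ℝ => φ X) (hB (mvfderiv (𝓡∂ n) f x))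

/-! ### Local coordinates

Coordinates are those of the preferred chart `extChartAt (𝓡∂ n) p` around a point `p`; its target
is a relatively open subset of the closed half-space `{y | 0 ≤ y 0} = Set.range (𝓡∂ n)`. -/

/-- The coordinate vector field `∂_i` of the chart at `p`, at the point with coordinates `y`. -/
def coordVec (p : M) (y : EuclideanSpace ℝ (Fin n)) (i : Fin n) :
    TangentSpace (𝓡∂ n) ((extChartAt (𝓡∂ n) p).symm y) :=
  mfderivWithin 𝓘(ℝ, EuclideanSpace ℝ (Fin n)) (𝓡∂ n) (extChartAt (𝓡∂ n) p).symm
    (Set.range (𝓡∂ n)) y (EuclideanSpace.single i (1 : ℝ) : EuclideanSpace ℝ (Fin n))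

/-- The coordinates `X^i` of a tangent vector at `x`, in the chart at `p`. -/
def vecCoord (p x : M) (X : TangentSpace (𝓡∂ n) x) (i : Fin n) : ℝ :=
  mvfderiv (𝓡∂ n) (extChartAt (𝓡∂ n) p) x X i

/-- The matrix `(g_ij(y))` of the metric in the chart at `p`. -/
def metricMatrix (g : SmoothMetric n M) (p : M) (y : EuclideanSpace ℝ (Fin n)) :
    Matrix (Fin n) (Fin n) ℝ :=
  Matrix.of fun i j => g.inner ((extChartAt (𝓡∂ n) p).symm y) (coordVec p y i) (coordVec p y j)

/-- The density `|g|^{1/2} = (det g_ij)^{1/2}` of the Riemannian volume in the chart at `p`. -/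
def volDensity (g : SmoothMetric n M) (p : M) (y : EuclideanSpace ℝ (Fin n)) : ℝ :=
  Real.sqrt (metricMatrix g p y).det

/-- The partial derivative `∂_i h (y)` of a function on the half-space (one-sided on its
boundary). -/
def partialDeriv (i : Fin n) (h : EuclideanSpace ℝ (Fin n) → ℝ)
    (y : EuclideanSpace ℝ (Fin n)) : ℝ :=
  fderivWithin ℝ h (Set.range (𝓡∂ n)) y (EuclideanSpace.single i (1 : ℝ))

/-- The component functions `y ↦ X^i(y)` of a vector field in the chart at `p`. -/
def fieldCoord (p : M) (X : (x : M) → TangentSpace (𝓡∂ n) x) (i : Fin n)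
    (y : EuclideanSpace ℝ (Fin n)) : ℝ :=
  vecCoord p ((extChartAt (𝓡∂ n) p).symm y) (X ((extChartAt (𝓡∂ n) p).symm y)) i

/-- The Christoffel symbols
`Γ^k_ij = (1/2) ∑_l g^{kl} (∂_i g_{jl} + ∂_j g_{il} - ∂_l g_{ij})` in the chart at `p`. -/
def christoffel (g : SmoothMetric n M) (p : M) (k i j : Fin n)
    (y : EuclideanSpace ℝ (Fin n)) : ℝ :=
  (1 / 2) * ∑ l, (metricMatrix g p y)⁻¹ k l *
    (partialDeriv i (fun z => metricMatrix g p z j l) y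
      + partialDeriv j (fun z => metricMatrix g p z i l) y
      - partialDeriv l (fun z => metricMatrix g p z i j) y)

/-! ### Differential operators -/

/-- The divergence `div_g X = |g|^{-1/2} ∑_i ∂_i (|g|^{1/2} X^i)`, at `x`, in the chart at `p`. -/
def divergenceIn (g : SmoothMetric n M) (p : M) (X : (x : M) → TangentSpace (𝓡∂ n) x)
    (x : M) : ℝ :=
  (volDensity g p (extChartAt (𝓡∂ n) p x))⁻¹ *
    ∑ i, partialDeriv i (fun y => volDensity g p y * fieldCoord p X i y) (extChartAt (𝓡∂ n) p x)

/-- The divergence `div_g X` at `x` (computed in the chart at `x`). -/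
def divergence (g : SmoothMetric n M) (X : (x : M) → TangentSpace (𝓡∂ n) x) (x : M) : ℝ :=
  divergenceIn g x X x

/-- The Levi-Civita covariant derivative `D_X Z` at `x`, in the chart at `p`:
`(D_X Z)^k = ∑_i X^i ∂_i Z^k + ∑_{i,j} Γ^k_ij X^i Z^j`. -/
def covDerivCoord (g : SmoothMetric n M) (p : M) (Z : (x : M) → TangentSpace (𝓡∂ n) x)
    (x : M) (X : TangentSpace (𝓡∂ n) x) (k : Fin n) : ℝ :=
  ∑ i, vecCoord p x X i * partialDeriv i (fieldCoord p Z k) (extChartAt (𝓡∂ n) p x)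
    + ∑ i, ∑ j, christoffel g p k i j (extChartAt (𝓡∂ n) p x)
        * vecCoord p x X i * vecCoord p x (Z x) j

/-- `(D_X Z, Y)_g` at `x`, with the covariant derivative computed in the chart at `p`. -/
def innerCovDerivIn (g : SmoothMetric n M) (p : M) (Z : (x : M) → TangentSpace (𝓡∂ n) x)
    (x : M) (X Y : TangentSpace (𝓡∂ n) x) : ℝ :=
  ∑ k, ∑ l, metricMatrix g p (extChartAt (𝓡∂ n) p x) k l
    * covDerivCoord g p Z x X k * vecCoord p x Y l

/-- The Hessian `D²f(X, Y) = (D_X ∇f, Y)_g` at `x` (computed in the chart at `x`). -/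
def hessian (g : SmoothMetric n M) (f : M → ℝ) (x : M) (X Y : TangentSpace (𝓡∂ n) x) : ℝ :=
  innerCovDerivIn g x (gradient g f) x X Y

/-- The weighted Laplace-Beltrami operator `Δ_{g,μ} f = μ⁻¹ div_g (μ ∇_g f)`. -/
def weightedLaplacian (g : SmoothMetric n M) (μ f : M → ℝ) (x : M) : ℝ :=
  (μ x)⁻¹ * divergence g (fun y => μ y • gradient g f y) x

/-! ### Boundary -/

/-- The exterior unit normal `ν_g` at a boundary point `x`. In the chart at `x` the manifold is
`{y | 0 ≤ y 0}`, so `ν = - ∇y⁰ / |∇y⁰|` for the coordinate function `y⁰`. -/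
def unitNormal (g : SmoothMetric n M) (x : M) : TangentSpace (𝓡∂ n) x :=
  -((gnorm g x (gradient g (fun q => extChartAt (𝓡∂ n) x q 0) x))⁻¹ •
    gradient g (fun q => extChartAt (𝓡∂ n) x q 0) x)

/-- The normal derivative `∂_ν f = (∇f, ν)`. -/
def normalDeriv (g : SmoothMetric n M) (f : M → ℝ) (x : M) : ℝ :=
  g.inner x (gradient g f x) (unitNormal g x)

/-- The embedding `y' ↦ (0, y')` of the boundary hyperplane `{y | y 0 = 0}`. -/
def bdryEmb (y' : {j : Fin n // j ≠ 0} → ℝ) : EuclideanSpace ℝ (Fin n) :=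
  WithLp.toLp 2 fun j => if h : j ≠ 0 then y' ⟨j, h⟩ else 0

/-- The density of the surface measure in the chart at `p`: the square root of the determinant of
the metric induced on the boundary, `(g_ij)_{i,j ≠ 0}`. -/
def surfDensity (g : SmoothMetric n M) (p : M) (y' : {j : Fin n // j ≠ 0} → ℝ) : ℝ :=
  Real.sqrt ((metricMatrix g p (bdryEmb y')).submatrix
    (fun i : {j : Fin n // j ≠ 0} => i.1) (fun i : {j : Fin n // j ≠ 0} => i.1)).det

/-! ### Measures -/

section Measures

variable [MeasurableSpace M]

/-- The Riemannian volume of the domain of the chart at `p`: the measure `|g|^{1/2} dy` carried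
over from the target of the chart. -/
def chartVolume (g : SmoothMetric n M) (p : M) : MeasureTheory.Measure M :=
  ((MeasureTheory.volume.restrict (extChartAt (𝓡∂ n) p).target).withDensity
    fun y => ENNReal.ofReal (volDensity g p y)).map (extChartAt (𝓡∂ n) p).symm

/-- The Riemannian volume measure `dV_g`: the least measure on `M` that dominates all the
`chartVolume g p`, hence the one that restricts to `chartVolume g p` on each chart domain. -/
def volumeMeasure (g : SmoothMetric n M) : MeasureTheory.Measure M :=
  ⨆ p : M, chartVolume g p

/-- The surface measure on the part of the boundary in the domain of the chart at `p`. -/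
def chartSurface (g : SmoothMetric n M) (p : M) : MeasureTheory.Measure M :=
  ((MeasureTheory.volume.restrict (bdryEmb ⁻¹' (extChartAt (𝓡∂ n) p).target)).withDensity
    fun y' => ENNReal.ofReal (surfDensity g p y')).map
      fun y' => (extChartAt (𝓡∂ n) p).symm (bdryEmb y')

/-- The surface measure `dS_g` on `∂M`, as a measure on `M`: the least measure that dominates all
the `chartSurface g p`, hence the one that restricts to `chartSurface g p` on each chart domain. -/
def surfaceMeasure (g : SmoothMetric n M) : MeasureTheory.Measure M :=
  ⨆ p : M, chartSurface g p

/-- The measure `dm = μ dV_g`. -/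
def weightedVolume (g : SmoothMetric n M) (μ : M → ℝ) : MeasureTheory.Measure M :=
  (volumeMeasure g).withDensity fun x => ENNReal.ofReal (μ x)

/-! ### Energy and solutions -/

/-- The energy `E(t) = ∫_M (∂_t u(t))² + |∇u(t)|² dm` of a function on `[0, T] × M`. -/
def energy (g : SmoothMetric n M) (μ : M → ℝ) (T : ℝ) (u : ℝ → M → ℝ) (t : ℝ) : ℝ :=
  ∫ x, (derivWithin (fun s => u s x) (Set.Icc 0 T) t ^ 2 + gnorm g x (gradient g (u t) x) ^ 2)
    ∂(weightedVolume g μ)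

/-- `C` is a constant in Friedrichs' inequality: `∫ φ² dm ≤ C ∫ |∇φ|² dm` for all smooth `φ`
with support in the interior of `M` (compact when `M` is). -/
def FriedrichsConst (g : SmoothMetric n M) (μ : M → ℝ) (C : ℝ) : Prop :=
  ∀ φ : M → ℝ, ContMDiff (𝓡∂ n) 𝓘(ℝ) ∞ φ → HasCompactSupport φ →
    tsupport φ ⊆ (𝓡∂ n).interior M →
    ∫ x, φ x ^ 2 ∂(weightedVolume g μ)
      ≤ C * ∫ x, gnorm g x (gradient g φ x) ^ 2 ∂(weightedVolume g μ)

end Measures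

/-- `u ∈ C²([0, T] × M)` (up to the boundary) solves `∂_t² u - Δ_{g,μ} u = 0` in `(0, T) × M`, and
`u = 0` on `(0, T) × ∂M`. -/
structure IsSolution (g : SmoothMetric n M) (μ : M → ℝ) (T : ℝ) (u : ℝ → M → ℝ) : Prop where
  regular : ContMDiffOn (𝓘(ℝ).prod (𝓡∂ n)) 𝓘(ℝ) 2 (fun q : ℝ × M => u q.1 q.2)
    (Set.Icc 0 T ×ˢ Set.univ)
  wave : ∀ t ∈ Set.Ioo 0 T, ∀ x : M,
    iteratedDerivWithin 2 (fun s => u s x) (Set.Icc 0 T) t - weightedLaplacian g μ (u t) x = 0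
  dirichlet : ∀ t ∈ Set.Ioo 0 T, ∀ x ∈ (𝓡∂ n).boundary M, u t x = 0

/-! ### The constants -/

/-- `C₁ = ρ² + max_M |∇(Δ_μ ℓ)|²`. -/
def const₁ (g : SmoothMetric n M) (μ ℓ : M → ℝ) (ρ : ℝ) : ℝ :=
  ρ ^ 2 + ⨆ x : M, gnorm g x (gradient g (weightedLaplacian g μ ℓ) x) ^ 2

/-- `C₂ = 3 max_M |∇ℓ|`. -/
def const₂ (g : SmoothMetric n M) (ℓ : M → ℝ) : ℝ :=
  3 * ⨆ x : M, gnorm g x (gradient g ℓ x)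

/-- `C₃ = C_F max_M |∇ℓ|²`. -/
def const₃ (g : SmoothMetric n M) (ℓ : M → ℝ) (CF : ℝ) : ℝ :=
  CF * ⨆ x : M, gnorm g x (gradient g ℓ x) ^ 2

/-- `C₄ = max_M |∇ℓ| + C_F max_M |Δ_μ ℓ - ρ| / 2`. -/
def const₄ (g : SmoothMetric n M) (μ ℓ : M → ℝ) (ρ CF : ℝ) : ℝ :=
  (⨆ x : M, gnorm g x (gradient g ℓ x)) + CF * (⨆ x : M, |weightedLaplacian g μ ℓ x - ρ|) / 2

/-- `B_ℓ = 2 max_M ℓ`. -/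
def constB (ℓ : M → ℝ) : ℝ := 2 * ⨆ x : M, ℓ x

/-- `β_ℓ = 2 min_M ℓ`. -/
def constβ (ℓ : M → ℝ) : ℝ := 2 * ⨅ x : M, ℓ x

/-- `τ = max (3 / ρ, C₁ / (2 ρ r²))`. -/
def constτ (g : SmoothMetric n M) (μ ℓ : M → ℝ) (ρ r : ℝ) : ℝ :=
  max (3 / ρ) (const₁ g μ ℓ ρ / (2 * ρ * r ^ 2))

/-- The lower bound `2 (C₃ τ + C₄) e^{(B_ℓ - β_ℓ) τ} τ` for the observation time. -/
def timeBound (g : SmoothMetric n M) (μ ℓ : M → ℝ) (ρ r CF : ℝ) : ℝ :=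
  2 * (const₃ g ℓ CF * constτ g μ ℓ ρ r + const₄ g μ ℓ ρ CF)
    * Real.exp ((constB ℓ - constβ ℓ) * constτ g μ ℓ ρ r) * constτ g μ ℓ ρ r

/-- `C(T) = C₂ e^{(B_ℓ - β_ℓ) τ} τ / (T - 2 (C₃ τ + C₄) e^{(B_ℓ - β_ℓ) τ} τ)`. -/
def obsConst (g : SmoothMetric n M) (μ ℓ : M → ℝ) (ρ r CF T : ℝ) : ℝ :=
  const₂ g ℓ * Real.exp ((constB ℓ - constβ ℓ) * constτ g μ ℓ ρ r) * constτ g μ ℓ ρ r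
    / (T - timeBound g μ ℓ ρ r CF)

end WeightedWave

end

noncomputable section

namespace WeightedWave

open Set Bundle MeasureTheory

variable {n : ℕ} [NeZero n] {M : Type*} [TopologicalSpace M]
  [ChartedSpace (EuclideanHalfSpace n) M] [IsManifold (𝓡∂ n) ∞ M]

local notation "𝔼" => EuclideanSpace ℝ (Fin n)
local notation "𝔼'" => {j : Fin n // j ≠ 0} → ℝ

section

/-! ### Functions and vectors in a chart -/

/-! The proof is the multiplier method with an exponential weight. Put w = e^{τℓ}u, y = e^{τℓ}∂_t u,
s = Δ_μ ℓ, and let m(w) = (∇ℓ,∇w) + (s-ρ)w/2 be `multiplier`. For a solution, F(t) = ∫ e^{τℓ} ∂_t u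
m(w) dm has derivative ∫ (e^{τℓ} m(w) Δ_μ u + y m(y)) dm. Green's formula, used once for the pair
e^{τℓ}m(w), u and once for the pair `auxDensity`, ℓ, turns this into a boundary flux minus the
integral of a density L.

By `multiplier_identity`, L is a quadratic form in y, ∇w and w whose coefficients are D²ℓ, |∇ℓ|² and
∇s; no second derivative of u survives. Convexity of ℓ controls y and ∇w, and the term
τ²w²(2D²ℓ(∇ℓ,∇ℓ) + ρ|∇ℓ|²) controls w because |∇ℓ| ≥ r. The two lower bounds built into τ are what
`multiplier_lower_bound` needs to give L ≥ e^{2τℓ}((∂_t u)² + |∇u|²)/(2τ). On the boundary u and ∂_t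
u vanish and ∇u is normal, so the flux is e^{2τℓ}(∂_ν u)² ∂_ν ℓ / 2 (`boundary_flux_eq`). It is
nonpositive where ∂_ν ℓ ≤ 0, so only Γ has to be observed.

Integrating F' over [0,T], with the conservation of energy, bounds T times the energy by the
observation plus |F(0)| + |F(T)|. By Friedrichs' inequality |F| is at most a constant multiple of
the energy (`abs_integral_multiplier_le`), and for large T this is absorbed on the left.

The rest is the calculus on which this argument stands. The measures are suprema of chart measures,
so their compatibility has to be proved (`volumeMeasure_restrict`, `surfaceMeasure_restrict`).
Green's formula comes from the divergence theorem in the half-space and a partition of unity. That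
the weighted Laplacian does not depend on the chart is deduced from Green's formula in charts, by
testing against bump functions (`lapIn_eq`). The Hessian enters only through `hessian_gradient`,
which expresses it by the scalar products `gradInner`. Friedrichs' inequality is assumed for smooth
functions supported in the interior; truncation and mollification extend it to C¹ functions
vanishing on the boundary (`friedrichs_of_boundary`). -/

/-- A function on `M` read in the chart at `p`. -/
def chartRep (p : M) (f : M → ℝ) (y : 𝔼) : ℝ := f ((extChartAt (𝓡∂ n) p).symm y)

omit [IsManifold (𝓡∂ n) ∞ M] in
theorem target_subset_range (p : M) : (extChartAt (𝓡∂ n) p).target ⊆ range (𝓡∂ n) :=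
  extChartAt_target_subset_range p

omit [IsManifold (𝓡∂ n) ∞ M] in
-- Near y the target of the chart and the half-space coincide. Representatives are smooth on the
-- target only, and this allows its differential calculus to be used.
theorem partialDeriv_eq_target {p : M} {y : 𝔼} (hy : y ∈ (extChartAt (𝓡∂ n) p).target)
    (i : Fin n) (F : 𝔼 → ℝ) :
    partialDeriv i F y
      = fderivWithin ℝ F (extChartAt (𝓡∂ n) p).target y (EuclideanSpace.single i 1) := by
  unfold partialDeriv
  have h : (extChartAt (𝓡∂ n) p).target =ᶠ[nhds y] range (𝓡∂ n) := by
    have h1 := extChartAt_target_mem_nhdsWithin_of_mem hy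
    rw [mem_nhdsWithin_iff_eventually] at h1
    filter_upwards [h1] with z hz
    exact propext ⟨fun h => target_subset_range p h, fun h => hz h⟩
  rw [fderivWithin_congr_set h]

theorem contDiffOn_chartRep {k : ℕ∞} (p : M) {f : M → ℝ}
    (hf : ContMDiff (𝓡∂ n) 𝓘(ℝ) k f) :
    ContDiffOn ℝ k (chartRep p f) (extChartAt (𝓡∂ n) p).target := by
  rw [← contMDiffOn_iff_contDiffOn]
  have h : ContMDiffOn 𝓘(ℝ, 𝔼) (𝓡∂ n) k (extChartAt (𝓡∂ n) p).symm
    (extChartAt (𝓡∂ n) p).target :=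
    (contMDiffOn_extChartAt_symm (n := ∞) p).of_le (by exact_mod_cast le_top)
  exact hf.comp_contMDiffOn h

theorem contMDiffOn_of_chart {k : ℕ∞} (p : M) {F : 𝔼 → ℝ}
    (hF : ContDiffOn ℝ k F (extChartAt (𝓡∂ n) p).target) :
    ContMDiffOn (𝓡∂ n) 𝓘(ℝ) k (fun x => F (extChartAt (𝓡∂ n) p x))
      (extChartAt (𝓡∂ n) p).source := by
  have h : ContMDiffOn (𝓡∂ n) 𝓘(ℝ, 𝔼) k (extChartAt (𝓡∂ n) p)
      (extChartAt (𝓡∂ n) p).source := by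
    rw [extChartAt_source]
    exact (contMDiffOn_extChartAt (n := ∞)).of_le (by exact_mod_cast le_top)
  exact (contMDiffOn_iff_contDiffOn.2 hF).comp h (fun x hx => (extChartAt (𝓡∂ n) p).map_source hx)

omit [IsManifold (𝓡∂ n) ∞ M] in
theorem contDiffOn_partialDeriv {k m : WithTop ℕ∞} {p : M} {F : 𝔼 → ℝ} (hkm : m + 1 ≤ k)
    (hF : ContDiffOn ℝ k F (extChartAt (𝓡∂ n) p).target) (i : Fin n) :
    ContDiffOn ℝ m (partialDeriv i F) (extChartAt (𝓡∂ n) p).target := by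
  have h1 := hF.fderivWithin (uniqueDiffOn_extChartAt_target p) hkm
  have h2 : ContDiffOn ℝ m (fun y => fderivWithin ℝ F (extChartAt (𝓡∂ n) p).target y
      (EuclideanSpace.single i 1)) (extChartAt (𝓡∂ n) p).target :=
    h1.clm_apply contDiffOn_const
  exact h2.congr fun y hy => partialDeriv_eq_target hy i F

/-- The differential of the inverse of the chart at `p`. -/
def coordMap (p : M) (y : 𝔼) : 𝔼 →L[ℝ] TangentSpace (𝓡∂ n) ((extChartAt (𝓡∂ n) p).symm y) :=
  mfderivWithin 𝓘(ℝ, 𝔼) (𝓡∂ n) (extChartAt (𝓡∂ n) p).symm (range (𝓡∂ n)) y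

omit [IsManifold (𝓡∂ n) ∞ M] in
theorem coordVec_eq (p : M) (y : 𝔼) (i : Fin n) :
    coordVec p y i = coordMap p y (EuclideanSpace.single i 1) := rfl

omit [IsManifold (𝓡∂ n) ∞ M] in
theorem vecCoord_eq (p x : M) (X : TangentSpace (𝓡∂ n) x) (i : Fin n) :
    vecCoord p x X i = (mvfderiv (𝓡∂ n) (extChartAt (𝓡∂ n) p) x X : 𝔼) i := rfl

theorem isManifold_one : IsManifold (𝓡∂ n) 1 M := IsManifold.of_le (n := ∞) (by norm_num)

theorem mvfderiv_extChartAt_coordMap {p : M} {y : 𝔼} (hy : y ∈ (extChartAt (𝓡∂ n) p).target)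
    (v : 𝔼) :
    mvfderiv (𝓡∂ n) (extChartAt (𝓡∂ n) p) ((extChartAt (𝓡∂ n) p).symm y) (coordMap p y v)
      = v := by
  have : IsManifold (𝓡∂ n) 1 M := isManifold_one
  exact DFunLike.congr_fun (mfderiv_extChartAt_comp_mfderivWithin_extChartAt_symm hy) v

theorem coordMap_mvfderiv_extChartAt {p : M} {y : 𝔼} (hy : y ∈ (extChartAt (𝓡∂ n) p).target)
    (X : TangentSpace (𝓡∂ n) ((extChartAt (𝓡∂ n) p).symm y)) :
    coordMap p y
      (mvfderiv (𝓡∂ n) (extChartAt (𝓡∂ n) p) ((extChartAt (𝓡∂ n) p).symm y) X) = X := by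
  have : IsManifold (𝓡∂ n) 1 M := isManifold_one
  exact DFunLike.congr_fun (mfderivWithin_extChartAt_symm_comp_mfderiv_extChartAt hy) X

theorem vecCoord_coordMap {p : M} {y : 𝔼} (hy : y ∈ (extChartAt (𝓡∂ n) p).target)
    (v : 𝔼) (i : Fin n) :
    vecCoord p ((extChartAt (𝓡∂ n) p).symm y) (coordMap p y v) i = v i := by
  rw [vecCoord_eq, mvfderiv_extChartAt_coordMap hy]

omit [IsManifold (𝓡∂ n) ∞ M] in
theorem coordMap_eq_sum (p : M) (y v : 𝔼) :
    coordMap p y v = ∑ i, v i • coordVec p y i := by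
  have h : v = ∑ i, v i • (EuclideanSpace.single i (1 : ℝ) : 𝔼) := by
    ext j
    simp [Finset.sum_apply, Pi.single_apply]
  conv_lhs => rw [h]
  rw [map_sum]
  simp_rw [map_smul]
  rfl

theorem eq_sum_vecCoord_smul {p : M} {y : 𝔼} (hy : y ∈ (extChartAt (𝓡∂ n) p).target)
    (X : TangentSpace (𝓡∂ n) ((extChartAt (𝓡∂ n) p).symm y)) :
    X = ∑ i, vecCoord p ((extChartAt (𝓡∂ n) p).symm y) X i • coordVec p y i := by
  conv_lhs => rw [← coordMap_mvfderiv_extChartAt hy X]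
  exact coordMap_eq_sum p y _

/-! ### The metric in a chart -/

theorem inner_eq_sum (g : SmoothMetric n M) {p : M} {y : 𝔼}
    (hy : y ∈ (extChartAt (𝓡∂ n) p).target)
    (X Y : TangentSpace (𝓡∂ n) ((extChartAt (𝓡∂ n) p).symm y)) :
    g.inner ((extChartAt (𝓡∂ n) p).symm y) X Y
      = ∑ i, ∑ j, metricMatrix g p y i j * vecCoord p _ X i * vecCoord p _ Y j := by
  conv_lhs => rw [eq_sum_vecCoord_smul hy X, eq_sum_vecCoord_smul hy Y]
  simp only [map_sum, map_smul, sum_apply, smul_apply, smul_eq_mul, Finset.mul_sum]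
  rw [Finset.sum_comm]
  refine Finset.sum_congr rfl fun i _ => ?_
  refine Finset.sum_congr rfl fun j _ => ?_
  simp only [metricMatrix, Matrix.of_apply]
  ring

theorem mvfderiv_coordMap {p : M} {y : 𝔼} (hy : y ∈ (extChartAt (𝓡∂ n) p).target)
    {f : M → ℝ} (hf : MDifferentiableAt (𝓡∂ n) 𝓘(ℝ) f ((extChartAt (𝓡∂ n) p).symm y)) (v : 𝔼) :
    mvfderiv (𝓡∂ n) f ((extChartAt (𝓡∂ n) p).symm y) (coordMap p y v)
      = fderivWithin ℝ (chartRep p f) (range (𝓡∂ n)) y v := by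
  have : IsManifold (𝓡∂ n) 1 M := isManifold_one
  have hu : UniqueMDiffWithinAt 𝓘(ℝ, 𝔼) (range (𝓡∂ n)) y :=
    (𝓡∂ n).uniqueMDiffOn _ (target_subset_range p hy)
  have h := mfderiv_comp_mfderivWithin y hf (mdifferentiableWithinAt_extChartAt_symm hy) hu
  have h2 := DFunLike.congr_fun h v
  rw [mfderivWithin_eq_fderivWithin] at h2
  exact h2.symm

theorem mvfderiv_coordVec {p : M} {y : 𝔼} (hy : y ∈ (extChartAt (𝓡∂ n) p).target)
    {f : M → ℝ} (hf : MDifferentiableAt (𝓡∂ n) 𝓘(ℝ) f ((extChartAt (𝓡∂ n) p).symm y))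
    (i : Fin n) :
    mvfderiv (𝓡∂ n) f ((extChartAt (𝓡∂ n) p).symm y) (coordVec p y i)
      = partialDeriv i (chartRep p f) y :=
  mvfderiv_coordMap hy hf _

theorem metricMatrix_symm (g : SmoothMetric n M) (p : M) (y : 𝔼) (i j : Fin n) :
    metricMatrix g p y i j = metricMatrix g p y j i := by
  simp only [metricMatrix, Matrix.of_apply]
  exact g.symm _ _ _

theorem metricMatrix_quadratic (g : SmoothMetric n M) (p : M) (y : 𝔼) (v w : 𝔼) :
    g.inner _ (coordMap p y v) (coordMap p y w)
      = ∑ i, ∑ j, metricMatrix g p y i j * v i * w j := by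
  rw [coordMap_eq_sum, coordMap_eq_sum]
  simp only [map_sum, map_smul, sum_apply, smul_apply, smul_eq_mul, Finset.mul_sum]
  rw [Finset.sum_comm]
  refine Finset.sum_congr rfl fun i _ => ?_
  refine Finset.sum_congr rfl fun j _ => ?_
  simp only [metricMatrix, Matrix.of_apply]
  ring

theorem metricMatrix_posDef (g : SmoothMetric n M) {p : M} {y : 𝔼}
    (hy : y ∈ (extChartAt (𝓡∂ n) p).target) : (metricMatrix g p y).PosDef := by
  refine Matrix.PosDef.of_dotProduct_mulVec_pos ?_ ?_
  · ext i j
    exact metricMatrix_symm g p y j i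
  · intro v hv
    have h := metricMatrix_quadratic g p y (WithLp.toLp 2 v) (WithLp.toLp 2 v)
    have hne : coordMap p y (WithLp.toLp 2 v) ≠ 0 := by
      intro h0
      apply hv
      have := mvfderiv_extChartAt_coordMap hy (WithLp.toLp 2 v)
      rw [h0, map_zero] at this
      exact (congrArg WithLp.ofLp this).symm
    have hpos := g.pos _ _ hne
    rw [h] at hpos
    refine hpos.trans_eq ?_
    simp only [dotProduct, Matrix.mulVec, Pi.star_apply, star_trivial, Finset.mul_sum]
    refine Finset.sum_congr rfl fun i _ => Finset.sum_congr rfl fun j _ => ?_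
    ring

theorem metricMatrix_det_pos (g : SmoothMetric n M) {p : M} {y : 𝔼}
    (hy : y ∈ (extChartAt (𝓡∂ n) p).target) : 0 < (metricMatrix g p y).det :=
  (metricMatrix_posDef g hy).det_pos

theorem volDensity_pos (g : SmoothMetric n M) {p : M} {y : 𝔼}
    (hy : y ∈ (extChartAt (𝓡∂ n) p).target) : 0 < volDensity g p y :=
  Real.sqrt_pos.2 (metricMatrix_det_pos g hy)

/-- Testing (∇f, ·) = df on the coordinate field ∂_i lowers the index of the gradient. -/
theorem sum_metricMatrix_mul_gradient (g : SmoothMetric n M) {p : M} {y : 𝔼}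
    (hy : y ∈ (extChartAt (𝓡∂ n) p).target)
    {f : M → ℝ} (hf : MDifferentiableAt (𝓡∂ n) 𝓘(ℝ) f ((extChartAt (𝓡∂ n) p).symm y))
    (i : Fin n) :
    ∑ j, metricMatrix g p y i j * fieldCoord p (gradient g f) j y
      = partialDeriv i (chartRep p f) y := by
  rw [← mvfderiv_coordVec hy hf i, ← inner_gradient g f, inner_eq_sum g hy]
  refine Finset.sum_congr rfl fun j _ => ?_
  rw [Finset.sum_eq_single i]
  · rw [coordVec_eq, vecCoord_coordMap hy, metricMatrix_symm g p y i j]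
    simp [fieldCoord]
  · intro k _ hk
    rw [coordVec_eq, vecCoord_coordMap hy]
    simp [hk]
  · simp

end

/-! ### Smoothness of the metric coefficients and of gradients -/

section

/-- The coordinate field is the tangent map of the inverse chart applied to a constant section.
Smoothness of the metric is a bundle statement, so the fields fed to it must be smooth as sections
of the tangent bundle. -/
theorem contMDiffOn_coordVec (p : M) (i : Fin n) :
    ContMDiffOn 𝓘(ℝ, 𝔼) (𝓡∂ n).tangent ∞
      (fun y => (TotalSpace.mk' 𝔼 ((extChartAt (𝓡∂ n) p).symm y) (coordVec p y i) :
        TangentBundle (𝓡∂ n) M)) (extChartAt (𝓡∂ n) p).target := by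
  have : IsManifold (𝓡∂ n) 1 M := isManifold_one
  have h := ContMDiffOn.contMDiffOn_tangentMapWithin (m := ∞)
    (contMDiffOn_extChartAt_symm (I := 𝓡∂ n) (n := ∞) p) (by norm_num)
    (uniqueDiffOn_extChartAt_target p).uniqueMDiffOn
  have hc := (contMDiffOn_vectorSpace_iff_contDiffOn (𝕜 := ℝ) (E := 𝔼) (n := ∞)
    (V := fun _ => (EuclideanSpace.single i (1 : ℝ) : 𝔼))
    (s := (extChartAt (𝓡∂ n) p).target)).2 contDiffOn_const
  have h2 := h.comp hc (fun y hy => hy)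
  refine h2.congr fun y hy => ?_
  have h3 : (extChartAt (𝓡∂ n) p).target =ᶠ[nhds y] range (𝓡∂ n) := by
    have h1 := extChartAt_target_mem_nhdsWithin_of_mem hy
    rw [mem_nhdsWithin_iff_eventually] at h1
    filter_upwards [h1] with z hz
    exact propext ⟨fun h => target_subset_range p h, fun h => hz h⟩
  simp only [Function.comp_apply, tangentMapWithin]
  rw [mfderivWithin_congr_set h3]
  rfl

theorem contDiffOn_metricMatrix (g : SmoothMetric n M) (p : M) (i j : Fin n) :
    ContDiffOn ℝ ∞ (fun y => metricMatrix g p y i j) (extChartAt (𝓡∂ n) p).target := by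
  rw [← contMDiffOn_iff_contDiffOn]
  intro y hy
  have hb : ContMDiffWithinAt 𝓘(ℝ, 𝔼) (𝓡∂ n) ∞ (extChartAt (𝓡∂ n) p).symm
      (extChartAt (𝓡∂ n) p).target y := contMDiffOn_extChartAt_symm (n := ∞) p y hy
  have h : ContMDiffWithinAt 𝓘(ℝ, 𝔼) ((𝓡∂ n).prod 𝓘(ℝ)) ∞
      (fun y => TotalSpace.mk' ℝ (E := Bundle.Trivial M ℝ) ((extChartAt (𝓡∂ n) p).symm y)
        (g.inner _ (coordVec p y i) (coordVec p y j))) (extChartAt (𝓡∂ n) p).target y := by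
    apply ContMDiffWithinAt.clm_bundle_apply₂ (F₁ := 𝔼) (F₂ := 𝔼)
    · exact ContMDiffAt.comp_contMDiffWithinAt y g.contMDiff.contMDiffAt hb
    · exact contMDiffOn_coordVec p i y hy
    · exact contMDiffOn_coordVec p j y hy
  rw [contMDiffWithinAt_totalSpace] at h
  exact h.2

omit [NeZero n] in
theorem contDiffOn_matrix_det {ι : Type*} [Fintype ι] [DecidableEq ι] {k : WithTop ℕ∞} {s : Set 𝔼}
    {A : 𝔼 → Matrix ι ι ℝ} (hA : ∀ i j, ContDiffOn ℝ k (fun y => A y i j) s) :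
    ContDiffOn ℝ k (fun y => (A y).det) s := by
  simp only [Matrix.det_apply]
  refine ContDiffOn.sum fun σ _ => ?_
  refine ContDiffOn.const_smul _ ?_
  exact contDiffOn_prod fun i _ => hA _ _

/-- Cramer's rule: the adjugate is polynomial in the entries and the determinant is positive. -/
theorem contDiffOn_metricMatrix_inv (g : SmoothMetric n M) (p : M) (i j : Fin n) :
    ContDiffOn ℝ ∞ (fun y => (metricMatrix g p y)⁻¹ i j) (extChartAt (𝓡∂ n) p).target := by
  have h1 : ContDiffOn ℝ ∞ (fun y => (metricMatrix g p y).det) (extChartAt (𝓡∂ n) p).target :=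
    contDiffOn_matrix_det (contDiffOn_metricMatrix g p)
  have h2 : ContDiffOn ℝ ∞ (fun y => (metricMatrix g p y).adjugate i j)
      (extChartAt (𝓡∂ n) p).target := by
    simp only [Matrix.adjugate_apply]
    refine contDiffOn_matrix_det fun k l => ?_
    by_cases hk : k = j
    · subst hk
      simp only [Matrix.updateRow_self]
      exact contDiffOn_const
    · simp only [Matrix.updateRow_ne hk]
      exact contDiffOn_metricMatrix g p k l
  refine ((h1.inv fun y hy => (metricMatrix_det_pos g hy).ne').mul h2).congr fun y hy => ?_
  simp [Matrix.inv_def, Ring.inverse_eq_inv']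

theorem contDiffOn_volDensity (g : SmoothMetric n M) (p : M) :
    ContDiffOn ℝ ∞ (volDensity g p) (extChartAt (𝓡∂ n) p).target :=
  (contDiffOn_matrix_det (contDiffOn_metricMatrix g p)).sqrt
    fun _ hy => (metricMatrix_det_pos g hy).ne'

/-! ### Gradients in a chart -/

theorem fieldCoord_gradient (g : SmoothMetric n M) {p : M} {y : 𝔼}
    (hy : y ∈ (extChartAt (𝓡∂ n) p).target)
    {f : M → ℝ} (hf : MDifferentiableAt (𝓡∂ n) 𝓘(ℝ) f ((extChartAt (𝓡∂ n) p).symm y))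
    (i : Fin n) :
    fieldCoord p (gradient g f) i y
      = ∑ j, (metricMatrix g p y)⁻¹ i j * partialDeriv j (chartRep p f) y := by
  have h : (metricMatrix g p y).mulVec (fun j => fieldCoord p (gradient g f) j y)
      = fun j => partialDeriv j (chartRep p f) y :=
    funext fun j => sum_metricMatrix_mul_gradient g hy hf j
  have hu : IsUnit (metricMatrix g p y).det := (metricMatrix_det_pos g hy).ne'.isUnit
  have h2 : (fun j => fieldCoord p (gradient g f) j y)
      = (metricMatrix g p y)⁻¹.mulVec fun j => partialDeriv j (chartRep p f) y := by
    rw [← h, Matrix.mulVec_mulVec, Matrix.nonsing_inv_mul _ hu, Matrix.one_mulVec]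
  exact congrFun h2 i

theorem inner_gradient_eq_sum (g : SmoothMetric n M) {p : M} {y : 𝔼}
    (hy : y ∈ (extChartAt (𝓡∂ n) p).target)
    {f : M → ℝ} (hf : MDifferentiableAt (𝓡∂ n) 𝓘(ℝ) f ((extChartAt (𝓡∂ n) p).symm y))
    (X : TangentSpace (𝓡∂ n) ((extChartAt (𝓡∂ n) p).symm y)) :
    g.inner _ (gradient g f _) X = ∑ i, partialDeriv i (chartRep p f) y * vecCoord p _ X i := by
  rw [inner_gradient]
  conv_lhs => rw [eq_sum_vecCoord_smul hy X]
  rw [map_sum]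
  refine Finset.sum_congr rfl fun i _ => ?_
  rw [map_smul, mvfderiv_coordVec hy hf, smul_eq_mul, mul_comm]

/-- `(∇f, ∇h)`. -/
def gradInner (g : SmoothMetric n M) (f h : M → ℝ) (x : M) : ℝ :=
  g.inner x (gradient g f x) (gradient g h x)

theorem gradInner_comm (g : SmoothMetric n M) (f h : M → ℝ) (x : M) :
    gradInner g f h x = gradInner g h f x := g.symm _ _ _

theorem gradInner_eq_mvfderiv (g : SmoothMetric n M) (f h : M → ℝ) (x : M) :
    gradInner g f h x = mvfderiv (𝓡∂ n) f x (gradient g h x) := inner_gradient _ _ _ _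

theorem inner_self_nonneg (g : SmoothMetric n M) (x : M) (X : TangentSpace (𝓡∂ n) x) :
    0 ≤ g.inner x X X := by
  by_cases hX : X = 0
  · rw [hX]
    exact (congrArg (fun B : TangentSpace (𝓡∂ n) x →L[ℝ] ℝ => B 0)
      (map_zero (g.inner x))).symm.le
  · exact (g.pos x X hX).le

theorem gnorm_sq (g : SmoothMetric n M) (x : M) (X : TangentSpace (𝓡∂ n) x) :
    gnorm g x X ^ 2 = g.inner x X X := Real.sq_sqrt (inner_self_nonneg g x X)

theorem gnorm_nonneg (g : SmoothMetric n M) (x : M) (X : TangentSpace (𝓡∂ n) x) :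
    0 ≤ gnorm g x X := Real.sqrt_nonneg _

theorem gnorm_gradient_sq (g : SmoothMetric n M) (f : M → ℝ) (x : M) :
    gnorm g x (gradient g f x) ^ 2 = gradInner g f f x := gnorm_sq g x _

theorem gradInner_eq_sum_fieldCoord (g : SmoothMetric n M) {p : M} {y : 𝔼}
    (hy : y ∈ (extChartAt (𝓡∂ n) p).target)
    {f : M → ℝ} (hf : MDifferentiableAt (𝓡∂ n) 𝓘(ℝ) f ((extChartAt (𝓡∂ n) p).symm y))
    (h : M → ℝ) :
    chartRep p (gradInner g f h) y
      = ∑ i, partialDeriv i (chartRep p f) y * fieldCoord p (gradient g h) i y :=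
  inner_gradient_eq_sum g hy hf _

theorem gradInner_eq_sum (g : SmoothMetric n M) {p : M} {y : 𝔼}
    (hy : y ∈ (extChartAt (𝓡∂ n) p).target)
    {f h : M → ℝ} (hf : MDifferentiableAt (𝓡∂ n) 𝓘(ℝ) f ((extChartAt (𝓡∂ n) p).symm y))
    (hh : MDifferentiableAt (𝓡∂ n) 𝓘(ℝ) h ((extChartAt (𝓡∂ n) p).symm y)) :
    chartRep p (gradInner g f h) y
      = ∑ i, ∑ j, (metricMatrix g p y)⁻¹ i j * partialDeriv i (chartRep p f) y
          * partialDeriv j (chartRep p h) y := by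
  rw [gradInner_eq_sum_fieldCoord g hy hf]
  simp_rw [fieldCoord_gradient g hy hh, Finset.mul_sum]
  refine Finset.sum_congr rfl fun i _ => Finset.sum_congr rfl fun j _ => by ring

theorem contDiffOn_fieldCoord_gradient (g : SmoothMetric n M) (p : M) {k : ℕ∞} {f : M → ℝ}
    (hf : ContMDiff (𝓡∂ n) 𝓘(ℝ) (k + 1 : ℕ∞) f) (i : Fin n) :
    ContDiffOn ℝ k (fieldCoord p (gradient g f) i) (extChartAt (𝓡∂ n) p).target := by
  refine ContDiffOn.congr (f := fun y =>
    ∑ j, (metricMatrix g p y)⁻¹ i j * partialDeriv j (chartRep p f) y) ?_ fun _ hy => ?_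
  · refine ContDiffOn.sum fun j _ => ?_
    refine ((contDiffOn_metricMatrix_inv g p i j).of_le (by exact_mod_cast le_top)).mul ?_
    exact contDiffOn_partialDeriv (by norm_cast) (contDiffOn_chartRep p hf) j
  · exact fieldCoord_gradient g hy (hf.mdifferentiableAt (by simp)) i

theorem contMDiff_of_chartRep {k : ℕ∞} {f : M → ℝ}
    (hf : ∀ p : M, ContDiffOn ℝ k (chartRep p f) (extChartAt (𝓡∂ n) p).target) :
    ContMDiff (𝓡∂ n) 𝓘(ℝ) k f := by
  intro x
  have h := (contMDiffOn_of_chart x (hf x)).contMDiffAt (extChartAt_source_mem_nhds x)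
  refine h.congr_of_eventuallyEq ?_
  filter_upwards [extChartAt_source_mem_nhds (I := 𝓡∂ n) x] with z hz
  exact congrArg f ((extChartAt (𝓡∂ n) x).left_inv hz).symm

theorem contMDiff_gradInner (g : SmoothMetric n M) {k : ℕ∞} {f h : M → ℝ}
    (hf : ContMDiff (𝓡∂ n) 𝓘(ℝ) (k + 1 : ℕ∞) f) (hh : ContMDiff (𝓡∂ n) 𝓘(ℝ) (k + 1 : ℕ∞) h) :
    ContMDiff (𝓡∂ n) 𝓘(ℝ) k (gradInner g f h) := by
  refine contMDiff_of_chartRep fun p => ?_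
  refine ContDiffOn.congr (f := fun y =>
    ∑ i, partialDeriv i (chartRep p f) y * fieldCoord p (gradient g h) i y) ?_ fun y hy => ?_
  · refine ContDiffOn.sum fun j _ => ?_
    exact (contDiffOn_partialDeriv (by norm_cast) (contDiffOn_chartRep p hf) j).mul
      (contDiffOn_fieldCoord_gradient g p hh j)
  · exact gradInner_eq_sum_fieldCoord g hy (hf.mdifferentiableAt (by simp)) h

theorem continuous_gradInner (g : SmoothMetric n M) {f h : M → ℝ}
    (hf : ContMDiff (𝓡∂ n) 𝓘(ℝ) 1 f) (hh : ContMDiff (𝓡∂ n) 𝓘(ℝ) 1 h) :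
    Continuous (gradInner g f h) :=
  (contMDiff_gradInner (k := 0) g (by simpa using hf) (by simpa using hh)).continuous

end

section

/-! ### The half-space and the boundary in a chart -/

omit [IsManifold (𝓡∂ n) ∞ M] in
theorem nonneg_of_mem_target {p : M} {y : 𝔼} (hy : y ∈ (extChartAt (𝓡∂ n) p).target) :
    0 ≤ y 0 := by
  have h := target_subset_range p hy
  rwa [range_modelWithCornersEuclideanHalfSpace] at h

omit [IsManifold (𝓡∂ n) ∞ M] in
theorem exists_open_target (p : M) :
    ∃ O : Set 𝔼, IsOpen O ∧ (extChartAt (𝓡∂ n) p).target = O ∩ {y | 0 ≤ y 0} := by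
  refine ⟨_, (chartAt (EuclideanHalfSpace n) p).open_target.preimage (𝓡∂ n).continuous_symm, ?_⟩
  rw [extChartAt_target, range_modelWithCornersEuclideanHalfSpace]

theorem isClosed_halfSpace {n : ℕ} [NeZero n] :
    IsClosed {y : EuclideanSpace ℝ (Fin n) | 0 ≤ y 0} :=
  isClosed_le continuous_const (by fun_prop)

omit [IsManifold (𝓡∂ n) ∞ M] in
theorem mem_interior_target_iff {p : M} {y : 𝔼} (hy : y ∈ (extChartAt (𝓡∂ n) p).target) :
    y ∈ interior (extChartAt (𝓡∂ n) p).target ↔ 0 < y 0 := by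
  obtain ⟨O, hO, hOt⟩ := exists_open_target (n := n) p
  have : interior {y : 𝔼 | 0 ≤ y 0} = {y : 𝔼 | 0 < y 0} := interior_halfSpace _ _ _
  rw [hOt, interior_inter, hO.interior_eq, this]
  rw [hOt] at hy
  exact ⟨fun h => h.2, fun h => ⟨hy.1, h⟩⟩

/-- For a smooth atlas, being an interior point may be tested in any chart, not only in the
preferred one at x. -/
theorem mem_boundary_iff {p x : M} (hx : x ∈ (extChartAt (𝓡∂ n) p).source) :
    x ∈ (𝓡∂ n).boundary M ↔ extChartAt (𝓡∂ n) p x 0 = 0 := by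
  have hx' : x ∈ (chartAt (EuclideanHalfSpace n) p).source := by
    rwa [← extChartAt_source (𝓡∂ n)]
  have h := (𝓡∂ n).isInteriorPoint_iff_of_mem_atlas (n := ∞) (by simp)
    (chart_mem_atlas (EuclideanHalfSpace n) p) hx'
  have h2 : (𝓡∂ n).IsInteriorPoint x ↔ 0 < extChartAt (𝓡∂ n) p x 0 :=
    h.trans (mem_interior_target_iff ((extChartAt (𝓡∂ n) p).map_source hx))
  have h3 := (𝓡∂ n).isBoundaryPoint_iff_not_isInteriorPoint x
  have h4 := nonneg_of_mem_target ((extChartAt (𝓡∂ n) p).map_source hx)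
  change (𝓡∂ n).IsBoundaryPoint x ↔ _
  rw [h3, h2]
  exact ⟨fun h => le_antisymm (not_lt.1 h) h4, fun h => by rw [h]; exact lt_irrefl _⟩

/-! ### Changes of charts -/

/-- The change of coordinates from the chart at `p` to the chart at `q`. -/
def transition (p q : M) (y : 𝔼) : 𝔼 := extChartAt (𝓡∂ n) q ((extChartAt (𝓡∂ n) p).symm y)

/-- The part of the target of the chart at `p` which corresponds to the source of the chart
at `q`. -/
def overlap (p q : M) : Set 𝔼 :=
  (extChartAt (𝓡∂ n) p).target ∩ (extChartAt (𝓡∂ n) p).symm ⁻¹' (extChartAt (𝓡∂ n) q).source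

omit [IsManifold (𝓡∂ n) ∞ M] in
theorem transition_mem_target {p q : M} {y : 𝔼} (hy : y ∈ overlap p q) :
    transition p q y ∈ (extChartAt (𝓡∂ n) q).target := (extChartAt (𝓡∂ n) q).map_source hy.2

omit [IsManifold (𝓡∂ n) ∞ M] in
theorem symm_transition {p q : M} {y : 𝔼} (hy : y ∈ overlap p q) :
    (extChartAt (𝓡∂ n) q).symm (transition p q y) = (extChartAt (𝓡∂ n) p).symm y :=
  (extChartAt (𝓡∂ n) q).left_inv hy.2

/-- The differential of the change of coordinates. -/
def transMap (p q : M) (y : 𝔼) : 𝔼 →L[ℝ] 𝔼 :=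
  (mvfderiv (𝓡∂ n) (extChartAt (𝓡∂ n) q) ((extChartAt (𝓡∂ n) p).symm y)).comp (coordMap p y)

theorem hasFDerivWithinAt_transition {p q : M} {y : 𝔼} (hy : y ∈ overlap p q) :
    HasFDerivWithinAt (transition p q) (transMap p q y) (range (𝓡∂ n)) y := by
  have : IsManifold (𝓡∂ n) 1 M := isManifold_one
  have hx' : (extChartAt (𝓡∂ n) p).symm y ∈ (chartAt (EuclideanHalfSpace n) q).source := by
    rw [← extChartAt_source (𝓡∂ n)]; exact hy.2
  have h1 := (mdifferentiableAt_extChartAt (I := 𝓡∂ n) hx').hasMFDerivAt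
  have h2 := (mdifferentiableWithinAt_extChartAt_symm (I := 𝓡∂ n) hy.1).hasMFDerivWithinAt
  exact (h1.comp_hasMFDerivWithinAt y h2).hasFDerivWithinAt

/-- The Jacobian matrix of the change of coordinates. -/
def transMatrix (p q : M) (y : 𝔼) : Matrix (Fin n) (Fin n) ℝ :=
  Matrix.of fun i j => transMap p q y (EuclideanSpace.single j 1) i

omit [IsManifold (𝓡∂ n) ∞ M] in
theorem transMap_apply (p q : M) (y v : 𝔼) (i : Fin n) :
    transMap p q y v i = ∑ j, transMatrix p q y i j * v j := by
  have h : v = ∑ i, v i • (EuclideanSpace.single i (1 : ℝ) : 𝔼) := by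
    ext j
    simp [Finset.sum_apply, Pi.single_apply]
  conv_lhs => rw [h]
  rw [map_sum]
  simp_rw [map_smul]
  simp [transMatrix, mul_comm]

omit [IsManifold (𝓡∂ n) ∞ M] in
theorem det_transMap (p q : M) (y : 𝔼) :
    (transMap p q y).det = (transMatrix p q y).det := by
  rw [ContinuousLinearMap.det, ← LinearMap.det_toMatrix (EuclideanSpace.basisFun (Fin n) ℝ).toBasis]
  congr 1

theorem vecCoord_eq_transMatrix {p q : M} {y : 𝔼} (hy : y ∈ (extChartAt (𝓡∂ n) p).target)
    (X : TangentSpace (𝓡∂ n) ((extChartAt (𝓡∂ n) p).symm y)) (i : Fin n) :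
    vecCoord q _ X i = ∑ j, transMatrix p q y i j * vecCoord p _ X j := by
  conv_lhs => rw [← coordMap_mvfderiv_extChartAt hy X]
  exact transMap_apply p q y _ i

theorem inner_eq_sum_source (g : SmoothMetric n M) {p x : M}
    (hx : x ∈ (extChartAt (𝓡∂ n) p).source) (X Y : TangentSpace (𝓡∂ n) x) :
    g.inner x X Y = ∑ i, ∑ j, metricMatrix g p (extChartAt (𝓡∂ n) p x) i j
      * vecCoord p x X i * vecCoord p x Y j := by
  obtain ⟨y, hy, rfl⟩ : ∃ y ∈ (extChartAt (𝓡∂ n) p).target, (extChartAt (𝓡∂ n) p).symm y = x :=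
    ⟨_, (extChartAt (𝓡∂ n) p).map_source hx, (extChartAt (𝓡∂ n) p).left_inv hx⟩
  rw [(extChartAt (𝓡∂ n) p).right_inv hy]
  exact inner_eq_sum g hy X Y

theorem metricMatrix_transition (g : SmoothMetric n M) {p q : M} {y : 𝔼} (hy : y ∈ overlap p q) :
    metricMatrix g p y = (transMatrix p q y).transpose * metricMatrix g q (transition p q y)
      * transMatrix p q y := by
  ext i j
  have h := inner_eq_sum_source g hy.2 (coordVec p y i) (coordVec p y j)
  have hv : ∀ i k, vecCoord q ((extChartAt (𝓡∂ n) p).symm y) (coordVec p y i) k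
      = transMatrix p q y k i := fun i k => rfl
  simp only [hv] at h
  rw [show metricMatrix g p y i j = g.inner _ (coordVec p y i) (coordVec p y j) from rfl, h]
  simp only [Matrix.mul_apply, Matrix.transpose_apply, Finset.sum_mul]
  rw [Finset.sum_comm]
  refine Finset.sum_congr rfl fun k _ => Finset.sum_congr rfl fun l _ => ?_
  rw [transition]; ring

/-- The metric matrices are congruent through the Jacobian; the square root of the determinants
gives the factor of the change of variables formula. -/
theorem volDensity_transition (g : SmoothMetric n M) {p q : M} {y : 𝔼} (hy : y ∈ overlap p q) :
    volDensity g p y = |(transMap p q y).det| * volDensity g q (transition p q y) := by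
  unfold volDensity
  rw [metricMatrix_transition g hy, Matrix.det_mul, Matrix.det_mul, Matrix.det_transpose,
    det_transMap, ← Real.sqrt_sq_eq_abs, ← Real.sqrt_mul (sq_nonneg _)]
  congr 1; ring

/-- A vanishing Jacobian would force the positive density in the chart at p to vanish. -/
theorem det_transMatrix_ne_zero (g : SmoothMetric n M) {p q : M} {y : 𝔼} (hy : y ∈ overlap p q) :
    (transMatrix p q y).det ≠ 0 := by
  intro h
  have h1 := volDensity_transition g hy
  rw [det_transMap, h, abs_zero, zero_mul] at h1
  exact (volDensity_pos g hy.1).ne' h1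

/-! ### Changes of charts on the boundary -/

theorem transition_zero_iff {p q : M} {y : 𝔼} (hy : y ∈ overlap p q) :
    transition p q y 0 = 0 ↔ y 0 = 0 := by
  have h1 := mem_boundary_iff hy.2
  have h2 := mem_boundary_iff ((extChartAt (𝓡∂ n) p).map_target hy.1)
  rw [(extChartAt (𝓡∂ n) p).right_inv hy.1] at h2
  exact h1.symm.trans h2

omit [IsManifold (𝓡∂ n) ∞ M] in
theorem overlap_mem_nhdsWithin {p q : M} {y : 𝔼} (hy : y ∈ overlap p q) :
    overlap p q ∈ nhdsWithin y (range (𝓡∂ n)) := by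
  have h1 := extChartAt_target_mem_nhdsWithin_of_mem hy.1
  have h2 : ContinuousWithinAt (extChartAt (𝓡∂ n) p).symm (extChartAt (𝓡∂ n) p).target y :=
    continuousOn_extChartAt_symm p y hy.1
  have h3 := h2.preimage_mem_nhdsWithin ((isOpen_extChartAt_source (I := 𝓡∂ n) q).mem_nhds hy.2)
  exact nhdsWithin_le_of_mem h1 (Filter.inter_mem self_mem_nhdsWithin h3)

omit [IsManifold (𝓡∂ n) ∞ M] in
-- Positive multiples of a basis vector never leave the half-space, even from a boundary point.
-- One-sided derivatives along these rays therefore read off the columns of the Jacobian.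
theorem tendsto_line {p q : M} {y : 𝔼} (hy : y ∈ overlap p q) (i : Fin n) :
    (∀ t ∈ Ici (0 : ℝ), y + t • (EuclideanSpace.single i 1 : 𝔼) ∈ range (𝓡∂ n)) ∧
    ∀ᶠ t in nhdsWithin (0 : ℝ) (Ici 0),
      y + t • (EuclideanSpace.single i 1 : 𝔼) ∈ overlap p q := by
  have h0 := nonneg_of_mem_target hy.1
  have hcr : ∀ t ∈ Ici (0 : ℝ), y + t • (EuclideanSpace.single i 1 : 𝔼) ∈ range (𝓡∂ n) := by
    intro t ht
    rw [mem_Ici] at ht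
    rw [range_modelWithCornersEuclideanHalfSpace]
    by_cases hi : i = 0
    · subst hi
      simp only [mem_ofPred_eq, PiLp.add_apply, PiLp.smul_apply, PiLp.single_apply, if_true,
        smul_eq_mul, mul_one]
      linarith
    · simpa [Ne.symm hi] using h0
  refine ⟨hcr, ?_⟩
  have hcont : Continuous fun t : ℝ => y + t • (EuclideanSpace.single i 1 : 𝔼) := by fun_prop
  have ht : Filter.Tendsto (fun t : ℝ => y + t • (EuclideanSpace.single i 1 : 𝔼))
      (nhdsWithin (0 : ℝ) (Ici 0)) (nhdsWithin y (range (𝓡∂ n))) := by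
    refine tendsto_nhdsWithin_iff.2 ⟨?_, ?_⟩
    · have := hcont.tendsto 0
      simp only [zero_smul, add_zero] at this
      exact this.mono_left nhdsWithin_le_nhds
    · filter_upwards [self_mem_nhdsWithin] with t ht using hcr t ht
  exact ht (overlap_mem_nhdsWithin hy)

theorem hasDerivWithinAt_transition_line {p q : M} {y : 𝔼} (hy : y ∈ overlap p q) (i j : Fin n) :
    HasDerivWithinAt (fun t : ℝ => transition p q (y + t • EuclideanSpace.single j 1) i)
      (transMatrix p q y i j) (Ici 0) 0 := by
  have hd : HasDerivAt (fun t : ℝ => y + t • (EuclideanSpace.single j 1 : 𝔼))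
      (EuclideanSpace.single j 1) 0 := by
    have := ((hasDerivAt_id (0 : ℝ)).smul_const (EuclideanSpace.single j (1 : ℝ) : 𝔼)).const_add y
    rw [one_smul] at this
    exact this
  have h := (hasFDerivWithinAt_transition hy).comp_hasDerivWithinAt_of_eq (0 : ℝ)
    (hd.hasDerivWithinAt (s := Ici 0)) (fun t ht => (tendsto_line hy j).1 t ht) (by simp)
  have h2 := ((EuclideanSpace.proj i : 𝔼 →L[ℝ] ℝ).hasFDerivAt).comp_hasDerivWithinAt (0 : ℝ) h
  exact h2

/-- A change of charts preserves the boundary, so the new first coordinate stays zero along a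
tangential ray. -/
theorem transMatrix_zero_eq_zero {p q : M} {y : 𝔼} (hy : y ∈ overlap p q) (hy0 : y 0 = 0)
    {i : Fin n} (hi : i ≠ 0) : transMatrix p q y 0 i = 0 := by
  have h1 := hasDerivWithinAt_transition_line hy 0 i
  have h2 : HasDerivWithinAt (fun t : ℝ => transition p q (y + t • EuclideanSpace.single i 1) 0)
      0 (Ici 0) 0 := by
    refine (hasDerivWithinAt_const (0 : ℝ) (Ici 0) (0 : ℝ)).congr_of_eventuallyEq ?_ ?_
    · filter_upwards [(tendsto_line hy i).2] with t ht
      exact (transition_zero_iff ht).2 (by simp [hy0, hi.symm])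
    · simpa using (transition_zero_iff hy).2 hy0
  exact (uniqueDiffOn_Ici (0 : ℝ) 0 self_mem_Ici).eq_deriv _ h1 h2

/-- Along the inward ray the new first coordinate starts at zero and stays nonnegative, hence so do
its difference quotients. -/
theorem transMatrix_zero_zero_nonneg {p q : M} {y : 𝔼} (hy : y ∈ overlap p q) (hy0 : y 0 = 0) :
    0 ≤ transMatrix p q y 0 0 := by
  have h1 := hasDerivWithinAt_transition_line hy 0 0
  rw [hasDerivWithinAt_iff_tendsto_slope, Ici_sdiff_left] at h1
  refine ge_of_tendsto h1 ?_
  have h2 := (tendsto_line hy 0).2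
  filter_upwards [nhdsWithin_mono _ Ioi_subset_Ici_self h2, self_mem_nhdsWithin] with t ht ht0
  have h3 : transition p q y 0 = 0 := (transition_zero_iff hy).2 hy0
  rw [slope_def_field]
  simp only [zero_smul, add_zero, h3, sub_zero]
  exact div_nonneg (nonneg_of_mem_target (transition_mem_target ht)) (le_of_lt ht0)

/-- If this entry vanished, the whole first row would, against the invertibility of the Jacobian.
Its positivity makes the exterior normal independent of the chart. -/
theorem transMatrix_zero_zero_pos (g : SmoothMetric n M) {p q : M} {y : 𝔼}
    (hy : y ∈ overlap p q) (hy0 : y 0 = 0) : 0 < transMatrix p q y 0 0 := by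
  refine (transMatrix_zero_zero_nonneg hy hy0).lt_of_ne' fun h => ?_
  refine det_transMatrix_ne_zero g hy (Matrix.det_eq_zero_of_row_eq_zero 0 fun j => ?_)
  by_cases hj : j = 0
  · rw [hj, h]
  · exact transMatrix_zero_eq_zero hy hy0 hj

/-- At the boundary, the first coordinate forms of two charts are proportional. -/
theorem vecCoord_zero_of_boundary {p q : M} {y : 𝔼} (hy : y ∈ overlap p q) (hy0 : y 0 = 0)
    (X : TangentSpace (𝓡∂ n) ((extChartAt (𝓡∂ n) p).symm y)) :
    vecCoord q _ X 0 = transMatrix p q y 0 0 * vecCoord p _ X 0 := by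
  rw [vecCoord_eq_transMatrix hy.1, Finset.sum_eq_single 0]
  · intro j _ hj
    rw [transMatrix_zero_eq_zero hy hy0 hj, zero_mul]
  · simp

theorem bdryEmb_apply_zero (y' : {j : Fin n // j ≠ 0} → ℝ) : (bdryEmb y' : 𝔼) 0 = 0 := by
  simp [bdryEmb]

theorem bdryEmb_apply (y' : {j : Fin n // j ≠ 0} → ℝ) (j : {j : Fin n // j ≠ 0}) :
    (bdryEmb y' : 𝔼) j = y' j := by
  simp [bdryEmb, j.2]

/-- The tangential coordinates of a point. -/
def bdryProj : 𝔼 →L[ℝ] ({j : Fin n // j ≠ 0} → ℝ) :=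
  ContinuousLinearMap.pi fun j => EuclideanSpace.proj j.1

theorem bdryProj_bdryEmb (y' : {j : Fin n // j ≠ 0} → ℝ) : bdryProj (bdryEmb y') = y' :=
  funext fun j => bdryEmb_apply y' j

theorem bdryEmb_bdryProj {y : 𝔼} (hy : y 0 = 0) : bdryEmb (bdryProj y) = y := by
  ext j
  by_cases hj : j = 0
  · rw [hj, bdryEmb_apply_zero, hy]
  · exact bdryEmb_apply (bdryProj y) ⟨j, hj⟩

/-- `bdryEmb` as a continuous linear map. -/
def bdryEmbL : ({j : Fin n // j ≠ 0} → ℝ) →L[ℝ] 𝔼 :=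
  LinearMap.toContinuousLinearMap
    { toFun := bdryEmb
      map_add' := fun a b => by
        ext j; by_cases h : j = 0 <;> simp [bdryEmb, h]
      map_smul' := fun a b => by
        ext j; by_cases h : j = 0 <;> simp [bdryEmb, h] }

theorem bdryEmb_single (j : {j : Fin n // j ≠ 0}) :
    (bdryEmb (Pi.single j 1) : 𝔼) = EuclideanSpace.single j.1 1 := by
  ext k
  by_cases hk : k = 0
  · rw [hk, bdryEmb_apply_zero]
    simp [j.2.symm]
  · rw [bdryEmb_apply (Pi.single j 1) ⟨k, hk⟩]
    simp [Pi.single_apply, Subtype.ext_iff]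

theorem bdryEmb_mem_range (y' : {j : Fin n // j ≠ 0} → ℝ) : (bdryEmb y' : 𝔼) ∈ range (𝓡∂ n) := by
  rw [range_modelWithCornersEuclideanHalfSpace]
  exact (bdryEmb_apply_zero y').ge

/-- The change of coordinates on the boundary. -/
def bdryTransition (p q : M) (y' : {j : Fin n // j ≠ 0} → ℝ) : {j : Fin n // j ≠ 0} → ℝ :=
  bdryProj (transition p q (bdryEmb y'))

/-- The differential of the change of coordinates on the boundary. -/
def bdryTransMap (p q : M) (y' : {j : Fin n // j ≠ 0} → ℝ) :
    ({j : Fin n // j ≠ 0} → ℝ) →L[ℝ] ({j : Fin n // j ≠ 0} → ℝ) :=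
  bdryProj.comp ((transMap p q (bdryEmb y')).comp bdryEmbL)

theorem bdryEmb_bdryTransition {p q : M} {y' : {j : Fin n // j ≠ 0} → ℝ}
    (hy : bdryEmb y' ∈ overlap p q) :
    bdryEmb (bdryTransition p q y') = transition p q (bdryEmb y') :=
  bdryEmb_bdryProj ((transition_zero_iff hy).2 (bdryEmb_apply_zero y'))

/-- The hyperplane lies in the half-space, so a derivative within the half-space composes with
`bdryEmb` to a full derivative on the tangential coordinates. -/
theorem hasFDerivAt_bdryTransition {p q : M} {y' : {j : Fin n // j ≠ 0} → ℝ}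
    (hy : bdryEmb y' ∈ overlap p q) :
    HasFDerivAt (bdryTransition p q) (bdryTransMap p q y') y' := by
  have h := (hasFDerivWithinAt_transition hy).comp_hasFDerivAt y'
    (bdryEmbL.hasFDerivAt (x := y')) (Filter.Eventually.of_forall bdryEmb_mem_range)
  exact bdryProj.hasFDerivAt.comp y' h

omit [IsManifold (𝓡∂ n) ∞ M] in
theorem det_bdryTransMap (p q : M) (y' : {j : Fin n // j ≠ 0} → ℝ) :
    (bdryTransMap p q y').det = ((transMatrix p q (bdryEmb y')).submatrix
      (fun i : {j : Fin n // j ≠ 0} => i.1) (fun i : {j : Fin n // j ≠ 0} => i.1)).det := by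
  rw [ContinuousLinearMap.det, ← LinearMap.det_toMatrix']
  congr 1
  ext i j
  simp only [LinearMap.toMatrix'_apply, bdryTransMap, Matrix.submatrix_apply, transMatrix,
    Matrix.of_apply, ← bdryEmb_single]
  rfl

/-- At the boundary the first row of the Jacobian is (c, 0, ..., 0), so the congruence of the metric
matrices restricts to their tangential blocks. -/
theorem surfDensity_transition (g : SmoothMetric n M) {p q : M} {y' : {j : Fin n // j ≠ 0} → ℝ}
    (hy : bdryEmb y' ∈ overlap p q) :
    surfDensity g p y' = |(bdryTransMap p q y').det| * surfDensity g q (bdryTransition p q y') := by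
  unfold surfDensity
  rw [bdryEmb_bdryTransition hy, det_bdryTransMap]
  set K := (transMatrix p q (bdryEmb y')).submatrix
      (fun i : {j : Fin n // j ≠ 0} => i.1) (fun i : {j : Fin n // j ≠ 0} => i.1) with hK
  set G := (metricMatrix g q (transition p q (bdryEmb y'))).submatrix
      (fun i : {j : Fin n // j ≠ 0} => i.1) (fun i : {j : Fin n // j ≠ 0} => i.1) with hG
  have h : (metricMatrix g p (bdryEmb y')).submatrix
      (fun i : {j : Fin n // j ≠ 0} => i.1) (fun i : {j : Fin n // j ≠ 0} => i.1)
      = K.transpose * G * K := by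
    have hsum : ∀ F : Fin n → ℝ, F 0 = 0 → ∑ k, F k = ∑ k : {j : Fin n // j ≠ 0}, F k := by
      intro F hF
      rw [Fintype.sum_eq_add_sum_subtype_ne F 0, hF, zero_add]
    have hz : ∀ i : {j : Fin n // j ≠ 0}, transMatrix p q (bdryEmb y') 0 i = 0 :=
      fun i => transMatrix_zero_eq_zero hy (bdryEmb_apply_zero y') i.2
    rw [metricMatrix_transition g hy]
    ext i j
    simp only [Matrix.submatrix_apply, Matrix.mul_apply, Matrix.transpose_apply, hK, hG]
    rw [hsum _ (by rw [hz j, mul_zero])]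
    refine Finset.sum_congr rfl fun k _ => ?_
    rw [hsum _ (by rw [hz i, zero_mul])]
  rw [h, Matrix.det_mul, Matrix.det_mul, Matrix.det_transpose, ← Real.sqrt_sq_eq_abs,
    ← Real.sqrt_mul (sq_nonneg _)]
  congr 1; ring

end

/-! ### The volume and surface measures, glued from the charts -/

section

section MeasureGeneral

variable {X Y ι : Type*} [MeasurableSpace X] [MeasurableSpace Y]

/-- The supremum of a family of measures carried by sets `s i`, and compatible on the
intersections of these sets, restricts to each of them. -/
theorem restrict_iSup_of_compatible (m : ι → Measure X) (s : ι → Set X)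
    (hs : ∀ i, MeasurableSet (s i)) (h0 : ∀ i, m i (s i)ᶜ = 0)
    (hm : ∀ i j A, MeasurableSet A → A ⊆ s i → A ⊆ s j → m i A = m j A) (i : ι) :
    (⨆ j, m j).restrict (s i) = m i := by
  -- The comparison measure is `m i` plus an infinite mass off `s i`: off that set it dominates
  -- anything, and on it compatibility applies. Restricted to `s i`, the extra mass disappears.
  have hle : (⨆ j, m j) ≤ m i + (⊤ : Measure X).restrict (s i)ᶜ := by
    refine iSup_le fun j => Measure.le_iff.2 fun A hA => ?_
    rw [Measure.add_apply, Measure.restrict_apply hA]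
    rw [← measure_inter_add_sdiff A (hs i)]
    refine add_le_add ?_ ?_
    · have h1 : m j (A ∩ s i) = m j ((A ∩ s i) ∩ s j) := by
        rw [← measure_inter_add_sdiff (A ∩ s i) (hs j)]
        have : m j ((A ∩ s i) \ s j) = 0 := measure_mono_null (fun x hx => hx.2) (h0 j)
        rw [this, add_zero]
      rw [h1, hm j i _ ((hA.inter (hs i)).inter (hs j)) inter_subset_right
        (inter_subset_left.trans inter_subset_right)]
      exact measure_mono (inter_subset_left.trans inter_subset_left)
    · exact Measure.le_iff'.1 le_top _
  ext A hA
  rw [Measure.restrict_apply hA]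
  refine le_antisymm ?_ ?_
  · refine (Measure.le_iff'.1 hle _).trans ?_
    rw [Measure.add_apply, Measure.restrict_apply (hA.inter (hs i))]
    have : A ∩ s i ∩ (s i)ᶜ = ∅ := by ext; simp
    rw [this, measure_empty, add_zero]
    exact measure_mono inter_subset_left
  · rw [← measure_inter_add_sdiff A (hs i)]
    have : m i (A \ s i) = 0 := measure_mono_null (fun x hx => hx.2) (h0 i)
    rw [this, add_zero]
    exact Measure.le_iff'.1 (le_iSup m i) _

theorem measurableSet_inter_preimage [TopologicalSpace X] [OpensMeasurableSpace X]
    [TopologicalSpace Y] [BorelSpace Y] {f : X → Y} {t : Set X} (ht : MeasurableSet t)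
    (hf : ContinuousOn f t) {A : Set Y} (hA : MeasurableSet A) : MeasurableSet (t ∩ f ⁻¹' A) := by
  have h1 : Measurable (t.domRestrict f) := (continuousOn_iff_continuous_domRestrict.1 hf).measurable
  have h2 := MeasurableSet.subtype_image ht (h1 hA)
  convert h2 using 1
  ext x
  simp [and_comm]

/-- The map is only known to be continuous on t. The measure does not charge the complement of t, so
its values there are irrelevant and almost everywhere measurability suffices. -/
theorem map_withDensity_restrict_apply [TopologicalSpace X] [OpensMeasurableSpace X]
    [TopologicalSpace Y] [BorelSpace Y] {f : X → Y} {t : Set X} (ht : MeasurableSet t)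
    (hf : ContinuousOn f t) (ν : Measure X) (d : X → ENNReal) {A : Set Y} (hA : MeasurableSet A) :
    ((ν.restrict t).withDensity d).map f A = ∫⁻ x in t ∩ f ⁻¹' A, d x ∂ν := by
  have hfm : AEMeasurable f ((ν.restrict t).withDensity d) :=
    (hf.aemeasurable ht).mono_ac (withDensity_absolutelyContinuous _ _)
  rw [Measure.map_apply_of_aemeasurable hfm hA]
  have h1 : ((ν.restrict t).withDensity d) (f ⁻¹' A) = ((ν.restrict t).withDensity d) (t ∩ f ⁻¹' A) := by
    have hz : ((ν.restrict t).withDensity d) tᶜ = 0 :=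
      withDensity_absolutelyContinuous _ _ (by simp [Measure.restrict_apply ht.compl])
    refine le_antisymm ?_ (measure_mono inter_subset_right)
    calc ((ν.restrict t).withDensity d) (f ⁻¹' A)
        ≤ ((ν.restrict t).withDensity d) ((t ∩ f ⁻¹' A) ∪ tᶜ) :=
          measure_mono fun x hx => by
            by_cases h : x ∈ t
            · exact Or.inl ⟨h, hx⟩
            · exact Or.inr h
      _ ≤ _ := (measure_union_le _ _).trans (by rw [hz, add_zero])
  rw [h1, withDensity_apply _ (measurableSet_inter_preimage ht hf hA),
    Measure.restrict_restrict (measurableSet_inter_preimage ht hf hA)]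
  rw [inter_eq_left.2 inter_subset_left]

end MeasureGeneral

omit [IsManifold (𝓡∂ n) ∞ M] in
theorem measurableSet_target (p : M) : MeasurableSet (extChartAt (𝓡∂ n) p).target := by
  obtain ⟨O, hO, hOt⟩ := exists_open_target (n := n) p
  rw [hOt]
  exact hO.measurableSet.inter isClosed_halfSpace.measurableSet

theorem continuous_bdryEmb : Continuous (bdryEmb : 𝔼' → 𝔼) := bdryEmbL.continuous

omit [IsManifold (𝓡∂ n) ∞ M] in
theorem isOpen_bdryEmb_preimage_target (p : M) :
    IsOpen (bdryEmb ⁻¹' (extChartAt (𝓡∂ n) p).target : Set 𝔼') := by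
  obtain ⟨O, hO, hOt⟩ := exists_open_target (n := n) p
  have : (bdryEmb ⁻¹' (extChartAt (𝓡∂ n) p).target : Set 𝔼') = bdryEmb ⁻¹' O := by
    rw [hOt]; ext y'; simp [bdryEmb_apply_zero]
  rw [this]
  exact hO.preimage continuous_bdryEmb

omit [IsManifold (𝓡∂ n) ∞ M] in
theorem continuousOn_symm_bdryEmb (p : M) :
    ContinuousOn (fun y' : 𝔼' => (extChartAt (𝓡∂ n) p).symm (bdryEmb y'))
      (bdryEmb ⁻¹' (extChartAt (𝓡∂ n) p).target) :=
  (continuousOn_extChartAt_symm p).comp continuous_bdryEmb.continuousOn fun _ h => h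

variable [MeasurableSpace M] [BorelSpace M]

theorem chartVolume_apply (g : SmoothMetric n M) (p : M) {A : Set M} (hA : MeasurableSet A) :
    chartVolume g p A = ∫⁻ y in (extChartAt (𝓡∂ n) p).target ∩ (extChartAt (𝓡∂ n) p).symm ⁻¹' A,
      ENNReal.ofReal (volDensity g p y) :=
  map_withDensity_restrict_apply (measurableSet_target p) (continuousOn_extChartAt_symm p) _ _ hA

theorem chartSurface_apply (g : SmoothMetric n M) (p : M) {A : Set M} (hA : MeasurableSet A) :
    chartSurface g p A = ∫⁻ y' in (bdryEmb ⁻¹' (extChartAt (𝓡∂ n) p).target) ∩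
        (fun y' => (extChartAt (𝓡∂ n) p).symm (bdryEmb y')) ⁻¹' A,
      ENNReal.ofReal (surfDensity g p y') :=
  map_withDensity_restrict_apply (isOpen_bdryEmb_preimage_target p).measurableSet
    (continuousOn_symm_bdryEmb p) _ _ hA

omit [IsManifold (𝓡∂ n) ∞ M] [MeasurableSpace M] [BorelSpace M] in
theorem injOn_transition (p q : M) : InjOn (transition p q : 𝔼 → 𝔼) (overlap p q) := by
  intro y hy z hz h
  have h1 : (extChartAt (𝓡∂ n) p).symm y = (extChartAt (𝓡∂ n) p).symm z := by
    rw [← symm_transition hy, ← symm_transition hz, h]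
  rw [← (extChartAt (𝓡∂ n) p).right_inv hy.1, ← (extChartAt (𝓡∂ n) p).right_inv hz.1, h1]

omit [IsManifold (𝓡∂ n) ∞ M] [MeasurableSpace M] [BorelSpace M] in
theorem transition_image {p q : M} {A : Set M} (hp : A ⊆ (extChartAt (𝓡∂ n) p).source)
    (hq : A ⊆ (extChartAt (𝓡∂ n) q).source) :
    transition p q '' ((extChartAt (𝓡∂ n) p).target ∩ (extChartAt (𝓡∂ n) p).symm ⁻¹' A)
      = (extChartAt (𝓡∂ n) q).target ∩ (extChartAt (𝓡∂ n) q).symm ⁻¹' A := by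
  ext z
  constructor
  · rintro ⟨y, ⟨hy, hyA⟩, rfl⟩
    have ho : y ∈ overlap p q := ⟨hy, hq hyA⟩
    refine ⟨transition_mem_target ho, ?_⟩
    rw [mem_preimage, symm_transition ho]
    exact hyA
  · rintro ⟨hz, hzA⟩
    have ho : z ∈ overlap q p := ⟨hz, hp hzA⟩
    refine ⟨transition q p z, ⟨transition_mem_target ho, ?_⟩, ?_⟩
    · rw [mem_preimage, symm_transition ho]; exact hzA
    · rw [transition, symm_transition ho, (extChartAt (𝓡∂ n) q).right_inv hz]

/-- This is the change of variables formula for the transition map. It needs only derivatives within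
the set of integration, so boundary points require no separate treatment. -/
theorem chartVolume_compatible (g : SmoothMetric n M) (p q : M) (A : Set M) (hA : MeasurableSet A)
    (hp : A ⊆ (extChartAt (𝓡∂ n) p).source) (hq : A ⊆ (extChartAt (𝓡∂ n) q).source) :
    chartVolume g p A = chartVolume g q A := by
  rw [chartVolume_apply g p hA, chartVolume_apply g q hA, ← transition_image hp hq]
  set S := (extChartAt (𝓡∂ n) p).target ∩ (extChartAt (𝓡∂ n) p).symm ⁻¹' A with hS
  have hSm : MeasurableSet S :=
    measurableSet_inter_preimage (measurableSet_target p) (continuousOn_extChartAt_symm p) hA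
  have hSo : S ⊆ overlap p q := fun y hy => ⟨hy.1, hq hy.2⟩
  rw [lintegral_image_eq_lintegral_abs_det_fderiv_mul volume hSm
    (fun y hy => (hasFDerivWithinAt_transition (hSo hy)).mono
      (inter_subset_left.trans (target_subset_range p))) ((injOn_transition p q).mono hSo)]
  refine setLIntegral_congr_fun hSm fun y hy => ?_
  rw [← ENNReal.ofReal_mul (abs_nonneg _), ← volDensity_transition g (hSo hy)]

theorem chartSurface_compatible (g : SmoothMetric n M) (p q : M) (A : Set M)
    (hA : MeasurableSet A)
    (hp : A ⊆ (extChartAt (𝓡∂ n) p).source) (hq : A ⊆ (extChartAt (𝓡∂ n) q).source) :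
    chartSurface g p A = chartSurface g q A := by
  rw [chartSurface_apply g p hA, chartSurface_apply g q hA]
  set S : Set 𝔼' := (bdryEmb ⁻¹' (extChartAt (𝓡∂ n) p).target) ∩
        (fun y' => (extChartAt (𝓡∂ n) p).symm (bdryEmb y')) ⁻¹' A with hS
  have hSm : MeasurableSet S := measurableSet_inter_preimage
    (isOpen_bdryEmb_preimage_target p).measurableSet (continuousOn_symm_bdryEmb p) hA
  have hSo : ∀ y' ∈ S, bdryEmb y' ∈ overlap p q := fun y hy => ⟨hy.1, hq hy.2⟩
  have himage : (bdryEmb ⁻¹' (extChartAt (𝓡∂ n) q).target) ∩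
        (fun y' => (extChartAt (𝓡∂ n) q).symm (bdryEmb y')) ⁻¹' A = bdryTransition p q '' S := by
    have h := transition_image hp hq
    ext z
    constructor
    · intro hz
      have hz' : bdryEmb z ∈ (extChartAt (𝓡∂ n) q).target ∩ (extChartAt (𝓡∂ n) q).symm ⁻¹' A := hz
      rw [← h] at hz'
      obtain ⟨y, hy, hyz⟩ := hz'
      have ho : y ∈ overlap p q := ⟨hy.1, hq hy.2⟩
      -- Transitions preserve the hyperplane in both directions, so the preimage of a boundary point
      -- is again some `bdryEmb y'`.
      have hy0 : y 0 = 0 := (transition_zero_iff ho).1 (by rw [hyz, bdryEmb_apply_zero])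
      refine ⟨bdryProj y, ?_, ?_⟩
      · rw [hS]
        simp only [mem_inter_iff, mem_preimage, bdryEmb_bdryProj hy0]
        exact hy
      · rw [bdryTransition, bdryEmb_bdryProj hy0, hyz, bdryProj_bdryEmb]
    · rintro ⟨y', hy', rfl⟩
      have : transition p q (bdryEmb y') ∈
          (extChartAt (𝓡∂ n) q).target ∩ (extChartAt (𝓡∂ n) q).symm ⁻¹' A := by
        rw [← h]; exact ⟨_, hy', rfl⟩
      simp only [mem_inter_iff, mem_preimage, bdryEmb_bdryTransition (hSo y' hy')]
      exact this
  have hinj : InjOn (bdryTransition p q) S := by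
    intro y hy z hz hyz
    have h1 := bdryEmb_bdryTransition (hSo y hy)
    rw [hyz, bdryEmb_bdryTransition (hSo z hz)] at h1
    have h2 := injOn_transition p q (hSo z hz) (hSo y hy) h1
    rw [← bdryProj_bdryEmb y, ← bdryProj_bdryEmb z, h2]
  rw [himage, lintegral_image_eq_lintegral_abs_det_fderiv_mul volume hSm
    (fun y hy => (hasFDerivAt_bdryTransition (hSo y hy)).hasFDerivWithinAt) hinj]
  refine setLIntegral_congr_fun hSm fun y hy => ?_
  rw [← ENNReal.ofReal_mul (abs_nonneg _), ← surfDensity_transition g (hSo y hy)]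

omit [IsManifold (𝓡∂ n) ∞ M] in
theorem measurableSet_source (p : M) : MeasurableSet (extChartAt (𝓡∂ n) p).source :=
  (isOpen_extChartAt_source p).measurableSet

theorem volumeMeasure_restrict (g : SmoothMetric n M) (p : M) :
    (volumeMeasure g).restrict (extChartAt (𝓡∂ n) p).source = chartVolume g p := by
  refine restrict_iSup_of_compatible (chartVolume g) (fun p => (extChartAt (𝓡∂ n) p).source)
    measurableSet_source (fun p => ?_) (chartVolume_compatible g) p
  rw [chartVolume_apply g p (measurableSet_source p).compl]
  have : (extChartAt (𝓡∂ n) p).target ∩ (extChartAt (𝓡∂ n) p).symm ⁻¹'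
      (extChartAt (𝓡∂ n) p).sourceᶜ = ∅ := by
    ext y
    simp only [mem_inter_iff, mem_preimage, mem_compl_iff, mem_empty_iff_false, iff_false, not_and,
      not_not]
    exact fun hy => (extChartAt (𝓡∂ n) p).map_target hy
  rw [this]; simp

theorem surfaceMeasure_restrict (g : SmoothMetric n M) (p : M) :
    (surfaceMeasure g).restrict (extChartAt (𝓡∂ n) p).source = chartSurface g p := by
  refine restrict_iSup_of_compatible (chartSurface g) (fun p => (extChartAt (𝓡∂ n) p).source)
    measurableSet_source (fun p => ?_) (chartSurface_compatible g) p
  rw [chartSurface_apply g p (measurableSet_source p).compl]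
  have : (bdryEmb ⁻¹' (extChartAt (𝓡∂ n) p).target : Set 𝔼') ∩
      (fun y' => (extChartAt (𝓡∂ n) p).symm (bdryEmb y')) ⁻¹'
      (extChartAt (𝓡∂ n) p).sourceᶜ = ∅ := by
    ext y
    simp only [mem_inter_iff, mem_preimage, mem_compl_iff, mem_empty_iff_false, iff_false, not_and,
      not_not]
    exact fun hy => (extChartAt (𝓡∂ n) p).map_target hy
  rw [this]; simp

end

/-! ### The Cauchy–Schwarz inequality and the exterior normal -/

section

theorem inner_sq_le (g : SmoothMetric n M) (x : M) (X Y : TangentSpace (𝓡∂ n) x) :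
    g.inner x X Y ^ 2 ≤ g.inner x X X * g.inner x Y Y := by
  have h : ∀ t : ℝ, 0 ≤ g.inner x Y Y * (t * t) + (2 * g.inner x X Y) * t + g.inner x X X := by
    intro t
    have h1 := inner_self_nonneg g x (X + t • Y)
    have h2 : g.inner x (X + t • Y) (X + t • Y)
        = g.inner x Y Y * (t * t) + (2 * g.inner x X Y) * t + g.inner x X X := by
      simp only [map_add, map_smul, add_apply, smul_apply, smul_eq_mul]
      rw [g.symm x Y X]; ring
    rwa [h2] at h1
  have := discrim_le_zero h
  rw [discrim] at this
  linarith

theorem gradInner_sq_le (g : SmoothMetric n M) (f h : M → ℝ) (x : M) :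
    gradInner g f h x ^ 2 ≤ gradInner g f f x * gradInner g h h x := inner_sq_le g x _ _

theorem gradInner_self_nonneg (g : SmoothMetric n M) (f : M → ℝ) (x : M) :
    0 ≤ gradInner g f f x := inner_self_nonneg g x _

/-! ### The normal derivative in a chart -/

/-- The first coordinate function of the chart at `p`. -/
def coordZero (p : M) (q : M) : ℝ := extChartAt (𝓡∂ n) p q 0

theorem mdifferentiableAt_coordZero {p x : M} (hx : x ∈ (extChartAt (𝓡∂ n) p).source) :
    MDifferentiableAt (𝓡∂ n) 𝓘(ℝ) (coordZero (n := n) p) x := by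
  have : IsManifold (𝓡∂ n) 1 M := isManifold_one
  rw [extChartAt_source] at hx
  exact ((EuclideanSpace.proj 0 : 𝔼 →L[ℝ] ℝ).mdifferentiableAt).comp x
    (mdifferentiableAt_extChartAt hx)

theorem inner_gradient_coordZero (g : SmoothMetric n M) {p x : M}
    (hx : x ∈ (extChartAt (𝓡∂ n) p).source) (X : TangentSpace (𝓡∂ n) x) :
    g.inner x (gradient g (coordZero (n := n) p) x) X = vecCoord p x X 0 := by
  have : IsManifold (𝓡∂ n) 1 M := isManifold_one
  rw [inner_gradient]
  rw [extChartAt_source] at hx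
  have h := ((EuclideanSpace.proj 0 : 𝔼 →L[ℝ] ℝ).hasMFDerivAt).comp x
    (mdifferentiableAt_extChartAt (I := 𝓡∂ n) hx).hasMFDerivAt
  exact DFunLike.congr_fun h.mfderiv X

theorem vecCoord_zero_source {p q x : M} (hp : x ∈ (extChartAt (𝓡∂ n) p).source)
    (hq : x ∈ (extChartAt (𝓡∂ n) q).source) (hx : x ∈ (𝓡∂ n).boundary M)
    (X : TangentSpace (𝓡∂ n) x) :
    vecCoord q x X 0 = transMatrix p q (extChartAt (𝓡∂ n) p x) 0 0 * vecCoord p x X 0 := by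
  obtain ⟨y, hy, rfl⟩ : ∃ y ∈ (extChartAt (𝓡∂ n) p).target, (extChartAt (𝓡∂ n) p).symm y = x :=
    ⟨_, (extChartAt (𝓡∂ n) p).map_source hp, (extChartAt (𝓡∂ n) p).left_inv hp⟩
  rw [mem_boundary_iff hp] at hx
  rw [(extChartAt (𝓡∂ n) p).right_inv hy] at hx ⊢
  exact vecCoord_zero_of_boundary ⟨hy, hq⟩ hx X

theorem unitNormal_eq (g : SmoothMetric n M) (x : M) :
    unitNormal g x = -((gnorm g x (gradient g (coordZero (n := n) x) x))⁻¹ • gradient g (coordZero (n := n) x) x) :=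
  rfl

theorem normalDeriv_eq_self (g : SmoothMetric n M) (f : M → ℝ) (x : M) :
    normalDeriv g f x = -((gnorm g x (gradient g (coordZero (n := n) x) x))⁻¹
      * vecCoord x x (gradient g f x) 0) := by
  rw [normalDeriv, unitNormal_eq, map_neg, map_smul, g.symm, smul_eq_mul,
    inner_gradient_coordZero g (mem_extChartAt_source x)]

/-- The normal derivative can be computed in any chart. -/
theorem normalDeriv_eq (g : SmoothMetric n M) (f : M → ℝ) {p x : M}
    (hp : x ∈ (extChartAt (𝓡∂ n) p).source) (hx : x ∈ (𝓡∂ n).boundary M) :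
    normalDeriv g f x = -((gnorm g x (gradient g (coordZero (n := n) p) x))⁻¹
      * vecCoord p x (gradient g f x) 0) := by
  have hxx := mem_extChartAt_source (I := 𝓡∂ n) x
  set c := transMatrix p x (extChartAt (𝓡∂ n) p x) 0 0 with hc
  have hcpos : 0 < c := by
    refine transMatrix_zero_zero_pos g ⟨(extChartAt (𝓡∂ n) p).map_source hp, ?_⟩
      ((mem_boundary_iff hp).1 hx)
    rw [mem_preimage, (extChartAt (𝓡∂ n) p).left_inv hp]; exact hxx
  have hv := vecCoord_zero_source hp hxx hx
  rw [← hc] at hv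
  -- At a boundary point the conormals of the two charts differ by the factor c > 0, which
  -- multiplies numerator and norm alike and cancels, with no change of sign.
  have hn : gnorm g x (gradient g (coordZero (n := n) x) x) = c * gnorm g x (gradient g (coordZero (n := n) p) x) := by
    unfold gnorm
    rw [inner_gradient_coordZero g hxx, hv, ← inner_gradient_coordZero g hp, g.symm,
      inner_gradient_coordZero g hxx, hv, ← mul_assoc, ← inner_gradient_coordZero g hp,
      Real.sqrt_mul (mul_self_nonneg _), Real.sqrt_mul_self hcpos.le]
  rw [normalDeriv_eq_self, hn, hv, mul_inv]
  field_simp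

theorem gradient_coordZero_ne_zero (g : SmoothMetric n M) {p x : M}
    (hp : x ∈ (extChartAt (𝓡∂ n) p).source) :
    0 < g.inner x (gradient g (coordZero (n := n) p) x) (gradient g (coordZero (n := n) p) x) := by
  refine g.pos x _ fun h => ?_
  obtain ⟨y, hy, rfl⟩ : ∃ y ∈ (extChartAt (𝓡∂ n) p).target, (extChartAt (𝓡∂ n) p).symm y = x :=
    ⟨_, (extChartAt (𝓡∂ n) p).map_source hp, (extChartAt (𝓡∂ n) p).left_inv hp⟩
  have h1 := inner_gradient_coordZero g hp (coordVec p y 0)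
  rw [coordVec_eq, vecCoord_coordMap hy, h] at h1
  have h2 : g.inner ((extChartAt (𝓡∂ n) p).symm y) 0 (coordMap p y (EuclideanSpace.single 0 1))
      = 0 := by rw [map_zero]; rfl
  have h3 : (1 : ℝ) = 0 := by simpa using h1.symm.trans h2
  exact one_ne_zero h3

theorem gnorm_unitNormal (g : SmoothMetric n M) (x : M) :
    g.inner x (unitNormal g x) (unitNormal g x) = 1 := by
  have h := gradient_coordZero_ne_zero g (mem_extChartAt_source (I := 𝓡∂ n) x)
  rw [unitNormal_eq]
  simp only [map_neg, map_smul, neg_apply, smul_apply, smul_eq_mul]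
  rw [← gnorm_sq]
  have h2 : 0 < gnorm g x (gradient g (coordZero (n := n) x) x) := Real.sqrt_pos.2 h
  field_simp

theorem normalDeriv_sq_le (g : SmoothMetric n M) (f : M → ℝ) (x : M) :
    normalDeriv g f x ^ 2 ≤ gradInner g f f x := by
  have h := inner_sq_le g x (gradient g f x) (unitNormal g x)
  rwa [gnorm_unitNormal, mul_one] at h

theorem inverse_metricMatrix_zero_zero (g : SmoothMetric n M) {p : M} {y : 𝔼}
    (hy : y ∈ (extChartAt (𝓡∂ n) p).target) :
    g.inner _ (gradient g (coordZero (n := n) p) ((extChartAt (𝓡∂ n) p).symm y))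
      (gradient g (coordZero (n := n) p) ((extChartAt (𝓡∂ n) p).symm y)) = (metricMatrix g p y)⁻¹ 0 0 := by
  have hs := (extChartAt (𝓡∂ n) p).map_target hy
  rw [inner_gradient_coordZero g hs]
  have h := fieldCoord_gradient g hy (mdifferentiableAt_coordZero hs) 0
  have h2 : ∀ j, partialDeriv j (chartRep p (coordZero (n := n) p)) y = if j = 0 then 1 else 0 := by
    intro j
    rw [← mvfderiv_coordVec hy (mdifferentiableAt_coordZero hs), ← inner_gradient g,
      inner_gradient_coordZero g hs, coordVec_eq, vecCoord_coordMap hy]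
    simp [eq_comm]
  simp only [h2, mul_ite, mul_one, mul_zero, Finset.sum_ite_eq', Finset.mem_univ, if_true] at h
  exact h

/-- Replacing the first row by a basis vector makes the matrix block triangular with a block equal
to 1; this identifies the minor with a cofactor. -/
theorem det_submatrix_ne_zero (A : Matrix (Fin n) (Fin n) ℝ) :
    (A.submatrix (fun i : {j : Fin n // j ≠ 0} => i.1) (fun i : {j : Fin n // j ≠ 0} => i.1)).det
      = A.adjugate 0 0 := by
  rw [Matrix.adjugate_apply, Matrix.twoBlockTriangular_det _ (fun i : Fin n => i ≠ 0)]
  · have h2 : ((A.updateRow 0 (Pi.single 0 1)).toSquareBlockProp fun i => ¬ i ≠ 0).det = 1 := by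
      have : (A.updateRow 0 (Pi.single 0 1)).toSquareBlockProp (fun i : Fin n => ¬ i ≠ 0) = 1 := by
        ext ⟨i, hi⟩ ⟨j, hj⟩
        obtain rfl : i = 0 := not_not.1 hi
        obtain rfl : j = 0 := not_not.1 hj
        simp [Matrix.toSquareBlockProp_def]
      rw [this, Matrix.det_one]
    rw [h2, mul_one]
    congr 1
    ext i j
    simp [Matrix.toSquareBlockProp_def, Matrix.updateRow_ne i.2]
  · intro i hi j hj
    obtain rfl : i = 0 := not_not.1 hi
    simp [hj]

/-- By Cramer's rule the tangential minor is det(g) g^{00}. -/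
theorem surfDensity_eq (g : SmoothMetric n M) {p : M} {y' : 𝔼'}
    (hy : bdryEmb y' ∈ (extChartAt (𝓡∂ n) p).target) :
    surfDensity g p y' = volDensity g p (bdryEmb y')
      * Real.sqrt ((metricMatrix g p (bdryEmb y'))⁻¹ 0 0) := by
  have hd := metricMatrix_det_pos g hy
  rw [surfDensity, det_submatrix_ne_zero, volDensity, ← Real.sqrt_mul hd.le, Matrix.inv_def,
    Matrix.smul_apply, Ring.inverse_eq_inv', smul_eq_mul, mul_inv_cancel_left₀ hd.ne']

/-- The factor (g^{00})^{1/2} of the surface density cancels the normalization of ν. What remains is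
the boundary integrand of the half-space divergence theorem; the minus sign appears because the
exterior normal points towards negative y⁰. -/
theorem normalDeriv_mul_surfDensity (g : SmoothMetric n M) (f : M → ℝ) {p : M} {y' : 𝔼'}
    (hy : bdryEmb y' ∈ (extChartAt (𝓡∂ n) p).target) :
    normalDeriv g f ((extChartAt (𝓡∂ n) p).symm (bdryEmb y')) * surfDensity g p y'
      = -(volDensity g p (bdryEmb y') * fieldCoord p (gradient g f) 0 (bdryEmb y')) := by
  have hs := (extChartAt (𝓡∂ n) p).map_target hy
  have hb : (extChartAt (𝓡∂ n) p).symm (bdryEmb y') ∈ (𝓡∂ n).boundary M := by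
    rw [mem_boundary_iff hs, (extChartAt (𝓡∂ n) p).right_inv hy, bdryEmb_apply_zero]
  have h := gradient_coordZero_ne_zero g hs
  have hn : gnorm g _ (gradient g (coordZero (n := n) p) ((extChartAt (𝓡∂ n) p).symm (bdryEmb y')))
      = Real.sqrt ((metricMatrix g p (bdryEmb y'))⁻¹ 0 0) := by
    rw [gnorm, inverse_metricMatrix_zero_zero g hy]
  rw [inverse_metricMatrix_zero_zero g hy] at h
  rw [normalDeriv_eq g f hs hb, surfDensity_eq g hy, hn, fieldCoord]
  have := (Real.sqrt_pos.2 h).ne'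
  field_simp

/-! ### Functions vanishing on the boundary -/

/-- The representative is identically zero along tangential rays of the hyperplane. -/
theorem partialDeriv_eq_zero_of_boundary {f : M → ℝ}
    (hf : ContMDiff (𝓡∂ n) 𝓘(ℝ) 1 f) (h0 : ∀ x ∈ (𝓡∂ n).boundary M, f x = 0) {p : M} {y : 𝔼}
    (hy : y ∈ (extChartAt (𝓡∂ n) p).target) (hy0 : y 0 = 0) {i : Fin n} (hi : i ≠ 0) :
    partialDeriv i (chartRep p f) y = 0 := by
  have hd : DifferentiableWithinAt ℝ (chartRep p f) (range (𝓡∂ n)) y :=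
    ((contDiffOn_chartRep (k := 1) p hf).differentiableOn one_ne_zero y hy).mono_of_mem_nhdsWithin
      (extChartAt_target_mem_nhdsWithin_of_mem hy)
  have ho : y ∈ overlap p p := ⟨hy, (extChartAt (𝓡∂ n) p).map_target hy⟩
  have hline : HasDerivAt (fun t : ℝ => y + t • (EuclideanSpace.single i 1 : 𝔼))
      (EuclideanSpace.single i 1) 0 := by
    have := ((hasDerivAt_id (0 : ℝ)).smul_const (EuclideanSpace.single i (1 : ℝ) : 𝔼)).const_add y
    rw [one_smul] at this
    exact this
  have h1 := hd.hasFDerivWithinAt.comp_hasDerivWithinAt_of_eq (0 : ℝ)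
    (hline.hasDerivWithinAt (s := Ici 0)) (fun t ht => (tendsto_line ho i).1 t ht) (by simp)
  have hz : ∀ z ∈ (extChartAt (𝓡∂ n) p).target, z 0 = 0 → chartRep p f z = 0 := by
    intro z hz hz0
    refine h0 _ ((mem_boundary_iff ((extChartAt (𝓡∂ n) p).map_target hz)).2 ?_)
    rw [(extChartAt (𝓡∂ n) p).right_inv hz, hz0]
  have h2 : HasDerivWithinAt (chartRep p f ∘ fun t : ℝ => y + t • (EuclideanSpace.single i 1 : 𝔼))
      0 (Ici 0) 0 := by
    refine (hasDerivWithinAt_const (0 : ℝ) (Ici 0) (0 : ℝ)).congr_of_eventuallyEq ?_ ?_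
    · filter_upwards [(tendsto_line ho i).2] with t ht
      exact hz _ ht.1 (by simp [hy0, hi.symm])
    · exact hz _ (by simpa using hy) (by simp [hy0])
  exact (uniqueDiffOn_Ici (0 : ℝ) 0 self_mem_Ici).eq_deriv _ h1 h2

/-- The gradient of a function vanishing on the boundary is normal there. -/
theorem gradInner_of_zero_boundary (g : SmoothMetric n M) {f : M → ℝ}
    (hf : ContMDiff (𝓡∂ n) 𝓘(ℝ) 1 f) (h0 : ∀ x ∈ (𝓡∂ n).boundary M, f x = 0) (h : M → ℝ) {x : M}
    (hx : x ∈ (𝓡∂ n).boundary M) :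
    gradInner g f h x = normalDeriv g f x * normalDeriv g h x := by
  have hs := mem_extChartAt_source (I := 𝓡∂ n) x
  have hy := mem_extChartAt_target (I := 𝓡∂ n) x
  have hy0 := (mem_boundary_iff hs).1 hx
  -- Only the first partial derivative of f survives, so df is a multiple of dy⁰, that is, of the
  -- conormal.
  have key : ∃ k : ℝ, ∀ X : TangentSpace (𝓡∂ n) x,
      g.inner x (gradient g f x) X = k * vecCoord x x X 0 := by
    have h1 : ∀ z ∈ (extChartAt (𝓡∂ n) x).target, z 0 = 0 → ∃ k : ℝ,
        ∀ X : TangentSpace (𝓡∂ n) ((extChartAt (𝓡∂ n) x).symm z),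
        g.inner _ (gradient g f _) X = k * vecCoord x _ X 0 := by
      intro z hz hz0
      refine ⟨partialDeriv 0 (chartRep x f) z, fun X => ?_⟩
      rw [inner_gradient_eq_sum g hz (hf.mdifferentiableAt one_ne_zero), Finset.sum_eq_single 0]
      · intro j _ hj
        rw [partialDeriv_eq_zero_of_boundary hf h0 hz hz0 hj, zero_mul]
      · simp
    have h2 := h1 _ hy hy0
    rwa [(extChartAt (𝓡∂ n) x).left_inv hs] at h2
  obtain ⟨k, hk⟩ := key
  have hpos := gradient_coordZero_ne_zero g hs
  have hpos' : 0 < gnorm g x (gradient g (coordZero (n := n) x) x) := Real.sqrt_pos.2 hpos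
  have hfn : normalDeriv g f x = -(k * gnorm g x (gradient g (coordZero (n := n) x) x)) := by
    rw [normalDeriv, hk, unitNormal_eq, ← inner_gradient_coordZero g hs, map_neg, map_smul,
      ← gnorm_sq, smul_eq_mul]
    field_simp
  rw [gradInner, hk, hfn, normalDeriv_eq_self]
  field_simp

end

/-! ### The divergence theorem in the half-space -/

section

/-- The divergence theorem in the half-space, in dimension `m + 1`. -/
theorem integral_divergence_halfSpace_succ {m : ℕ}
    (F : Fin (m + 1) → EuclideanSpace ℝ (Fin (m + 1)) → ℝ)
    (F' : Fin (m + 1) → EuclideanSpace ℝ (Fin (m + 1)) →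
      EuclideanSpace ℝ (Fin (m + 1)) →L[ℝ] ℝ) {R : ℝ} (hR : 0 < R)
    (hc : ∀ i, ContinuousOn (F i) {y | 0 ≤ y 0})
    (hd : ∀ i y, 0 < y 0 → HasFDerivAt (F i) (F' i y) y)
    (h0 : ∀ i y, 0 ≤ y 0 → (∃ j, R ≤ |y j|) → F i y = 0)
    (h0' : ∀ i y, 0 ≤ y 0 → (∃ j, R ≤ |y j|) → F' i y = 0)
    (hi : IntegrableOn (fun y => ∑ i, F' i y (EuclideanSpace.single i 1)) {y | 0 ≤ y 0}) :
    ∫ y in {y | 0 ≤ y 0}, ∑ i, F' i y (EuclideanSpace.single i 1)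
      = -∫ y' : {j : Fin (m + 1) // j ≠ 0} → ℝ, F 0 (bdryEmb y') := by
  set D : EuclideanSpace ℝ (Fin (m + 1)) → ℝ :=
    fun y => ∑ i, F' i y (EuclideanSpace.single i 1) with hD
  -- The box [0,R] × [-R,R]^m meets the boundary of the half-space in its bottom face, and the
  -- fields vanish on all its other faces. For m = 0 the boundary integral is over a one-point
  -- space, and the formula is the fundamental theorem of calculus.
  set a : Fin (m + 1) → ℝ := Fin.cons 0 (fun _ => -R) with ha
  set b : Fin (m + 1) → ℝ := fun _ => R with hb
  have hab : a ≤ b := by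
    intro i
    refine Fin.cases ?_ (fun i => ?_) i
    · simp [ha, hb, hR.le]
    · simp only [ha, hb, Fin.cons_succ]; linarith
  have hIcc : Icc a b ⊆ {x | 0 ≤ x 0} := fun x hx => by
    have := hx.1 0
    simpa [ha] using this
  have hHm : MeasurableSet {x : Fin (m + 1) → ℝ | 0 ≤ x 0} :=
    measurableSet_le measurable_const (measurable_pi_apply 0)
  have hemb : MeasurableEmbedding (@WithLp.toLp 2 (Fin (m + 1) → ℝ)) :=
    (MeasurableEquiv.toLp 2 (Fin (m + 1) → ℝ)).measurableEmbedding
  have hpre : (@WithLp.toLp 2 (Fin (m + 1) → ℝ)) ⁻¹'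
      {y : EuclideanSpace ℝ (Fin (m + 1)) | 0 ≤ y 0} = {x | 0 ≤ x 0} := rfl
  have s1 : ∫ y in {y | 0 ≤ y 0}, D y = ∫ x in {x : Fin (m + 1) → ℝ | 0 ≤ x 0},
      D (WithLp.toLp 2 x) := by
    rw [← hpre, (PiLp.volume_preserving_toLp (Fin (m + 1))).setIntegral_preimage_emb hemb]
  have hbig : ∀ x : Fin (m + 1) → ℝ, 0 ≤ x 0 → x ∉ Icc a b → ∃ j, R ≤ |x j| := by
    intro x hx0 hx
    by_contra hcon
    push Not at hcon
    refine hx ⟨fun i => ?_, fun i => (abs_lt.1 (hcon i)).2.le⟩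
    refine Fin.cases ?_ (fun i => ?_) i
    · simpa [ha] using hx0
    · simpa only [ha, Fin.cons_succ] using (abs_lt.1 (hcon i.succ)).1.le
  have s2 : ∫ x in {x : Fin (m + 1) → ℝ | 0 ≤ x 0}, D (WithLp.toLp 2 x)
      = ∫ x in Icc a b, D (WithLp.toLp 2 x) := by
    refine setIntegral_eq_of_subset_of_forall_sdiff_eq_zero hHm hIcc fun x hx => ?_
    have h1 := hbig x hx.1 hx.2
    simp only [hD]
    refine Finset.sum_eq_zero fun i _ => ?_
    rw [h0' i (WithLp.toLp 2 x) hx.1 h1]; rfl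
  have hi' : IntegrableOn (fun x : Fin (m + 1) → ℝ => D (WithLp.toLp 2 x)) (Icc a b) := by
    refine IntegrableOn.mono_set ?_ hIcc
    rw [← hpre]
    exact ((PiLp.volume_preserving_toLp (Fin (m + 1))).integrableOn_comp_preimage hemb).2 hi
  obtain ⟨e, he⟩ : ∃ e : (Fin (m + 1) → ℝ) →L[ℝ] EuclideanSpace ℝ (Fin (m + 1)),
      ∀ x, e x = WithLp.toLp 2 x :=
    ⟨((PiLp.continuousLinearEquiv 2 ℝ (fun _ : Fin (m + 1) => ℝ)).symm :
      (Fin (m + 1) → ℝ) →L[ℝ] EuclideanSpace ℝ (Fin (m + 1))), fun _ => rfl⟩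
  have hsum : ∀ x, ∑ i, (F' i (WithLp.toLp 2 x)).comp e (Pi.single i 1) = D (WithLp.toLp 2 x) := by
    intro x
    simp only [hD, ContinuousLinearMap.comp_apply, he]
    rfl
  have hdiv := integral_divergence_of_hasFDerivAt_off_countable' a b hab
    (fun i x => F i (WithLp.toLp 2 x))
    (fun i x => (F' i (WithLp.toLp 2 x)).comp e) ∅ countable_empty
    (fun i => (hc i).comp (PiLp.continuous_toLp 2 _).continuousOn fun x hx => hIcc hx)
    (fun x hx i => by
      have hx0 : 0 < x 0 := by
        have := (hx.1 0 (mem_univ _)).1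
        simpa [ha] using this
      have h1 := hd i (e x) (by rw [he]; exact hx0)
      have h2 := h1.comp x e.hasFDerivAt
      simp only [he] at h2
      exact h2.congr_of_eventuallyEq (Filter.Eventually.of_forall fun z => by simp [he]))
    (by simp only [hsum]; exact hi')
  simp only [hsum] at hdiv
  rw [s1, s2, hdiv, Fin.sum_univ_succ]
  have hmem : ∀ (j : Fin (m + 1)) (x : Fin m → ℝ), x ∈ Icc (a ∘ j.succAbove) (b ∘ j.succAbove) →
      ∀ t ∈ Icc (a j) (b j), (0 : ℝ) ≤ (j.insertNth t x : Fin (m + 1) → ℝ) 0 := fun j x hx t ht =>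
    hIcc (Fin.insertNth_mem_Icc.2 ⟨ht, hx⟩)
  have hfront : ∀ j : Fin (m + 1), ∫ x in Icc (a ∘ j.succAbove) (b ∘ j.succAbove),
      F j (WithLp.toLp 2 (j.insertNth (b j) x)) = 0 := by
    intro j
    refine setIntegral_eq_zero_of_forall_eq_zero fun x hx => ?_
    refine h0 j _ (hmem j x hx (b j) ⟨hab j, le_rfl⟩) ⟨j, ?_⟩
    simp [hb, abs_of_pos hR]
  have hback : ∀ j : Fin m, ∫ x in Icc (a ∘ j.succ.succAbove) (b ∘ j.succ.succAbove),
      F j.succ (WithLp.toLp 2 (j.succ.insertNth (a j.succ) x)) = 0 := by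
    intro j
    refine setIntegral_eq_zero_of_forall_eq_zero fun x hx => ?_
    refine h0 j.succ _ (hmem j.succ x hx (a j.succ) ⟨le_rfl, hab j.succ⟩) ⟨j.succ, ?_⟩
    simp [ha, abs_of_pos hR]
  rw [hfront 0, Finset.sum_eq_zero fun j _ => by rw [hfront j.succ, hback j, sub_zero], zero_sub,
    add_zero]
  congr 1
  have ha0 : a 0 = 0 := rfl
  rw [ha0]
  rw [setIntegral_eq_integral_of_forall_compl_eq_zero]
  -- Faces of the box are indexed by `Fin m` and the boundary hyperplane by the nonzero indices. The
  -- reindexing preserves the volume.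
  · have hmp := volume_measurePreserving_piCongrLeft (fun _ : {j : Fin (m + 1) // j ≠ 0} => ℝ)
      (finSuccAboveEquiv (0 : Fin (m + 1)))
    rw [← hmp.integral_comp']
    refine integral_congr_ae (Filter.Eventually.of_forall fun x => ?_)
    dsimp only
    congr 1
    ext j
    refine Fin.cases ?_ (fun j => ?_) j
    · rw [bdryEmb_apply_zero]; simp
    · have h1 := bdryEmb_apply (MeasurableEquiv.piCongrLeft
        (fun _ : {j : Fin (m + 1) // j ≠ 0} => ℝ) (finSuccAboveEquiv (0 : Fin (m + 1))) x)
        (finSuccAboveEquiv 0 j)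
      rw [MeasurableEquiv.piCongrLeft_apply_apply] at h1
      simp only [finSuccAboveEquiv_apply, Fin.succAbove_zero] at h1
      rw [h1]
      simp
  · intro x hx
    have hx0 : (0 : ℝ) ≤ (Fin.insertNth 0 0 x : Fin (m + 1) → ℝ) 0 := by simp
    refine h0 0 _ hx0 (hbig _ hx0 fun hmem => hx ?_)
    exact (Fin.insertNth_mem_Icc.1 hmem).2

/-- The divergence theorem in the half-space for compactly supported vector fields. -/
theorem integral_divergence_halfSpace {n : ℕ} [NeZero n]
    (F : Fin n → EuclideanSpace ℝ (Fin n) → ℝ)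
    (F' : Fin n → EuclideanSpace ℝ (Fin n) → EuclideanSpace ℝ (Fin n) →L[ℝ] ℝ)
    {K : Set (EuclideanSpace ℝ (Fin n))} (hK : IsCompact K)
    (hc : ∀ i, ContinuousOn (F i) {y | 0 ≤ y 0})
    (hd : ∀ i y, 0 < y 0 → HasFDerivAt (F i) (F' i y) y)
    (h0 : ∀ i, ∀ y ∉ K, F i y = 0) (h0' : ∀ i, ∀ y ∉ K, F' i y = 0)
    (hi : IntegrableOn (fun y => ∑ i, F' i y (EuclideanSpace.single i 1)) {y | 0 ≤ y 0}) :
    ∫ y in {y | 0 ≤ y 0}, ∑ i, F' i y (EuclideanSpace.single i 1)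
      = -∫ y' : {j : Fin n // j ≠ 0} → ℝ, F 0 (bdryEmb y') := by
  obtain ⟨R, hR, hKR⟩ : ∃ R : ℝ, 0 < R ∧ ∀ y ∈ K, ∀ j, |y j| < R := by
    obtain ⟨R, hR⟩ := hK.isBounded.exists_norm_le
    refine ⟨max R 0 + 1, by positivity, fun y hy j => ?_⟩
    have h1 := PiLp.norm_apply_le y j
    have h2 := hR y hy
    rw [Real.norm_eq_abs] at h1
    linarith [le_max_left R 0]
  have hnot : ∀ y : EuclideanSpace ℝ (Fin n), (∃ j, R ≤ |y j|) → y ∉ K :=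
    fun y ⟨j, hj⟩ hy => absurd (hKR y hy j) (not_lt.2 hj)
  obtain ⟨m, rfl⟩ := Nat.exists_eq_succ_of_ne_zero (NeZero.ne n)
  exact integral_divergence_halfSpace_succ F F' hR hc hd (fun i y _ hy => h0 i y (hnot y hy))
    (fun i y _ hy => h0' i y (hnot y hy)) hi

end

section

/-! ### Continuity, read in charts -/

omit [IsManifold (𝓡∂ n) ∞ M] in
theorem continuousOn_source_of_target {p : M} {F : M → ℝ}
    (hF : ContinuousOn (chartRep p F) (extChartAt (𝓡∂ n) p).target) :
    ContinuousOn F (extChartAt (𝓡∂ n) p).source := by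
  have h := hF.comp (continuousOn_extChartAt p) fun x hx => (extChartAt (𝓡∂ n) p).map_source hx
  refine h.congr fun x hx => ?_
  simp only [Function.comp_apply, chartRep, (extChartAt (𝓡∂ n) p).left_inv hx]

omit [IsManifold (𝓡∂ n) ∞ M] in
theorem continuous_of_support_subset_source {p : M} {F : M → ℝ} {K : Set M} (hK : IsClosed K)
    (hKs : K ⊆ (extChartAt (𝓡∂ n) p).source) (h0 : ∀ x ∉ K, F x = 0)
    (hF : ContinuousOn F (extChartAt (𝓡∂ n) p).source) : Continuous F := by
  rw [continuous_iff_continuousAt]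
  intro x
  by_cases hx : x ∈ (extChartAt (𝓡∂ n) p).source
  · exact hF.continuousAt ((isOpen_extChartAt_source p).mem_nhds hx)
  · refine (continuousAt_const (y := (0 : ℝ))).congr ?_
    filter_upwards [hK.isOpen_compl.mem_nhds fun h => hx (hKs h)] with z hz using (h0 z hz).symm

/-- The normal at x is computed in the chart at x, which may jump with x. On the boundary
`normalDeriv_eq` replaces it by the formula in one fixed chart; off the boundary that formula does
depend on the chart, hence the restriction. -/
theorem continuousOn_normalDeriv (g : SmoothMetric n M) {h : M → ℝ}
    (hh : ContMDiff (𝓡∂ n) 𝓘(ℝ) 1 h) :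
    ContinuousOn (normalDeriv g h) ((𝓡∂ n).boundary M) := by
  intro p hpb
  have hp := mem_extChartAt_source (I := 𝓡∂ n) p
  have hG : ContinuousOn (fun x => -((Real.sqrt
      ((metricMatrix g p (extChartAt (𝓡∂ n) p x))⁻¹ 0 0))⁻¹
      * fieldCoord p (gradient g h) 0 (extChartAt (𝓡∂ n) p x)))
      (extChartAt (𝓡∂ n) p).source := by
    have h1 : ContinuousOn (fun y => -((Real.sqrt ((metricMatrix g p y)⁻¹ 0 0))⁻¹
        * fieldCoord p (gradient g h) 0 y)) (extChartAt (𝓡∂ n) p).target := by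
      refine ((ContinuousOn.inv₀ ?_ fun y hy => ?_).mul ?_).neg
      · exact (contDiffOn_metricMatrix_inv g p 0 0).continuousOn.sqrt
      · rw [← inverse_metricMatrix_zero_zero g hy]
        exact (Real.sqrt_pos.2
          (gradient_coordZero_ne_zero g ((extChartAt (𝓡∂ n) p).map_target hy))).ne'
      · exact (contDiffOn_fieldCoord_gradient (k := 0) g p (by simpa using hh) 0).continuousOn
    exact h1.comp (continuousOn_extChartAt p) fun x hx => (extChartAt (𝓡∂ n) p).map_source hx
  have hN := (isOpen_extChartAt_source (I := 𝓡∂ n) p).mem_nhds hp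
  refine ContinuousWithinAt.congr_of_eventuallyEq_of_mem
    ((hG.continuousAt hN).continuousWithinAt) ?_ hpb
  filter_upwards [self_mem_nhdsWithin, mem_nhdsWithin_of_mem_nhds hN] with x hxb hxs
  have ht := (extChartAt (𝓡∂ n) p).map_source hxs
  have h2 := inverse_metricMatrix_zero_zero g ht
  rw [(extChartAt (𝓡∂ n) p).left_inv hxs] at h2
  rw [normalDeriv_eq g h hxs hxb, gnorm, h2, fieldCoord, (extChartAt (𝓡∂ n) p).left_inv hxs]

theorem isClosed_boundary : IsClosed ((𝓡∂ n).boundary M) :=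
  (𝓡∂ n).isClosed_boundary (n := ∞) (by simp)

variable [MeasurableSpace M] [BorelSpace M]

/-! ### Integration in charts -/

theorem integral_chartVolume (g : SmoothMetric n M) (p : M) {F : M → ℝ} (hF : Continuous F) :
    ∫ x, F x ∂(chartVolume g p)
      = ∫ y in (extChartAt (𝓡∂ n) p).target, volDensity g p y * chartRep p F y := by
  have hm := measurableSet_target (n := n) p
  have hd : AEMeasurable (fun y => ENNReal.ofReal (volDensity g p y))
      (volume.restrict (extChartAt (𝓡∂ n) p).target) :=
    ((contDiffOn_volDensity g p).continuousOn.aemeasurable hm).ennreal_ofReal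
  rw [chartVolume, integral_map]
  · rw [integral_withDensity_eq_integral_toReal_smul₀ hd (by simp)]
    refine setIntegral_congr_fun hm fun y hy => ?_
    rw [ENNReal.toReal_ofReal (volDensity_pos g hy).le, smul_eq_mul, chartRep]
  · exact ((continuousOn_extChartAt_symm p).aemeasurable hm).mono_ac
      (withDensity_absolutelyContinuous _ _)
  · exact hF.aestronglyMeasurable

theorem integral_volumeMeasure (g : SmoothMetric n M) (p : M) {F : M → ℝ} (hF : Continuous F)
    (h0 : ∀ x ∉ (extChartAt (𝓡∂ n) p).source, F x = 0) :
    ∫ x, F x ∂(volumeMeasure g)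
      = ∫ y in (extChartAt (𝓡∂ n) p).target, volDensity g p y * chartRep p F y := by
  rw [← integral_chartVolume g p hF, ← volumeMeasure_restrict,
    setIntegral_eq_integral_of_forall_compl_eq_zero h0]

theorem integral_weightedVolume (g : SmoothMetric n M) {μ : M → ℝ} (hμ : Continuous μ)
    (hμpos : ∀ x, 0 < μ x) (F : M → ℝ) :
    ∫ x, F x ∂(weightedVolume g μ) = ∫ x, μ x * F x ∂(volumeMeasure g) := by
  rw [weightedVolume, integral_withDensity_eq_integral_toReal_smul₀
    hμ.measurable.ennreal_ofReal.aemeasurable (by simp)]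
  simp only [ENNReal.toReal_ofReal (hμpos _).le, smul_eq_mul]

theorem chartSurface_compl_boundary (g : SmoothMetric n M) (p : M) :
    chartSurface g p ((𝓡∂ n).boundary M)ᶜ = 0 := by
  rw [chartSurface_apply g p isClosed_boundary.measurableSet.compl]
  have : (bdryEmb ⁻¹' (extChartAt (𝓡∂ n) p).target : Set 𝔼') ∩
      (fun y' => (extChartAt (𝓡∂ n) p).symm (bdryEmb y')) ⁻¹' ((𝓡∂ n).boundary M)ᶜ = ∅ := by
    ext y
    simp only [mem_inter_iff, mem_preimage, mem_compl_iff, mem_empty_iff_false, iff_false, not_and,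
      not_not]
    intro hy
    rw [mem_boundary_iff ((extChartAt (𝓡∂ n) p).map_target hy), (extChartAt (𝓡∂ n) p).right_inv hy,
      bdryEmb_apply_zero]
  rw [this]; simp

theorem integral_chartSurface (g : SmoothMetric n M) (p : M) {F : M → ℝ}
    (hF : ContinuousOn F ((𝓡∂ n).boundary M)) :
    ∫ x, F x ∂(chartSurface g p)
      = ∫ y' in (bdryEmb ⁻¹' (extChartAt (𝓡∂ n) p).target : Set 𝔼'),
        surfDensity g p y' * F ((extChartAt (𝓡∂ n) p).symm (bdryEmb y')) := by
  have hm := (isOpen_bdryEmb_preimage_target (n := n) p).measurableSet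
  have hsub : ContinuousOn (surfDensity g p) (bdryEmb ⁻¹' (extChartAt (𝓡∂ n) p).target) := by
    refine ContinuousOn.congr (f := fun y' : 𝔼' => volDensity g p (bdryEmb y')
      * Real.sqrt ((metricMatrix g p (bdryEmb y'))⁻¹ 0 0)) ?_ fun y' hy => surfDensity_eq g hy
    refine ContinuousOn.mul ?_ (ContinuousOn.sqrt ?_)
    · exact (contDiffOn_volDensity g p).continuousOn.comp continuous_bdryEmb.continuousOn
        fun _ h => h
    · exact (contDiffOn_metricMatrix_inv g p 0 0).continuousOn.comp continuous_bdryEmb.continuousOn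
        fun _ h => h
  have hd : AEMeasurable (fun y' => ENNReal.ofReal (surfDensity g p y'))
      (volume.restrict (bdryEmb ⁻¹' (extChartAt (𝓡∂ n) p).target)) :=
    (hsub.aemeasurable hm).ennreal_ofReal
  -- F is continuous on the boundary only. The measure is carried by the boundary, and this is what
  -- makes F measurable for it.
  have hr : (chartSurface g p).restrict ((𝓡∂ n).boundary M) = chartSurface g p :=
    Measure.restrict_eq_self_of_ae_mem (by
      rw [ae_iff]; exact chartSurface_compl_boundary g p)
  have hFm : AEStronglyMeasurable F (chartSurface g p) := by
    rw [← hr]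
    exact hF.aestronglyMeasurable isClosed_boundary.measurableSet
  have hFm' := hFm
  rw [chartSurface] at hFm' ⊢
  rw [integral_map]
  · rw [integral_withDensity_eq_integral_toReal_smul₀ hd (by simp)]
    refine setIntegral_congr_fun hm fun y hy => ?_
    rw [ENNReal.toReal_ofReal (show 0 ≤ surfDensity g p y from Real.sqrt_nonneg _), smul_eq_mul]
  · exact ((continuousOn_symm_bdryEmb p).aemeasurable hm).mono_ac
      (withDensity_absolutelyContinuous _ _)
  · exact hFm'

theorem integral_surfaceMeasure (g : SmoothMetric n M) (p : M) {F : M → ℝ}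
    (hF : ContinuousOn F ((𝓡∂ n).boundary M))
    (h0 : ∀ x ∉ (extChartAt (𝓡∂ n) p).source, F x = 0) :
    ∫ x, F x ∂(surfaceMeasure g)
      = ∫ y' in (bdryEmb ⁻¹' (extChartAt (𝓡∂ n) p).target : Set 𝔼'),
        surfDensity g p y' * F ((extChartAt (𝓡∂ n) p).symm (bdryEmb y')) := by
  rw [← integral_chartSurface g p hF, ← surfaceMeasure_restrict,
    setIntegral_eq_integral_of_forall_compl_eq_zero h0]

/-! ### Finiteness of the measures -/

theorem map_withDensity_restrict_lt_top {X Y : Type*} [MeasurableSpace X] [MeasurableSpace Y]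
    [TopologicalSpace X] [OpensMeasurableSpace X]
    [TopologicalSpace Y] [BorelSpace Y] {f : X → Y} {t : Set X} (ht : MeasurableSet t)
    (hf : ContinuousOn f t) (ν : Measure X) (d : X → ℝ) {A : Set Y} (hA : MeasurableSet A)
    {B : Set X} (hB : ν B < ⊤) {c : ℝ} (hAB : ∀ x ∈ t, f x ∈ A → x ∈ B ∧ d x ≤ c) :
    ((ν.restrict t).withDensity fun x => ENNReal.ofReal (d x)).map f A < ⊤ := by
  rw [map_withDensity_restrict_apply ht hf ν _ hA]
  calc ∫⁻ x in t ∩ f ⁻¹' A, ENNReal.ofReal (d x) ∂ν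
      ≤ ∫⁻ _ in t ∩ f ⁻¹' A, ENNReal.ofReal c ∂ν :=
        setLIntegral_mono' (measurableSet_inter_preimage ht hf hA) fun x hx =>
          ENNReal.ofReal_le_ofReal (hAB x hx.1 hx.2).2
    _ = ENNReal.ofReal c * ν (t ∩ f ⁻¹' A) := by rw [setLIntegral_const]
    _ ≤ ENNReal.ofReal c * ν B := by
        gcongr
        exact fun x hx => (hAB x hx.1 hx.2).1
    _ < ⊤ := ENNReal.mul_lt_top ENNReal.ofReal_lt_top hB

omit [IsManifold (𝓡∂ n) ∞ M] [MeasurableSpace M] [BorelSpace M] in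
theorem exists_isOpen_bounded_in_chart (x : M) {d : 𝔼 → ℝ}
    (hd : ContinuousOn d (extChartAt (𝓡∂ n) x).target) :
    ∃ O : Set M, IsOpen O ∧ x ∈ O ∧ O ⊆ (extChartAt (𝓡∂ n) x).source ∧ ∃ c, ∀ z ∈ O,
      extChartAt (𝓡∂ n) x z ∈ Metric.closedBall (extChartAt (𝓡∂ n) x x) 1 ∧
      d (extChartAt (𝓡∂ n) x z) ≤ c := by
  have hs := extChartAt_source_mem_nhds (I := 𝓡∂ n) x
  have h1 : ∀ᶠ z in nhds x, extChartAt (𝓡∂ n) x z ∈ Metric.closedBall (extChartAt (𝓡∂ n) x x) 1 :=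
    (continuousAt_extChartAt (I := 𝓡∂ n) x).eventually_mem (Metric.closedBall_mem_nhds _ one_pos)
  have hc : ContinuousAt (fun z => d (extChartAt (𝓡∂ n) x z)) x :=
    (hd.comp (continuousOn_extChartAt x) fun z hz =>
      (extChartAt (𝓡∂ n) x).map_source hz).continuousAt hs
  have h2 := hc.eventually_lt_const (lt_add_one _)
  obtain ⟨O, hO, hOo, hxO⟩ := mem_nhds_iff.1 (Filter.inter_mem hs (h1.and h2))
  exact ⟨O, hOo, hxO, fun z hz => (hO hz).1, _, fun z hz => ⟨(hO hz).2.1, (hO hz).2.2.le⟩⟩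

theorem isFiniteMeasure_volumeMeasure [CompactSpace M] (g : SmoothMetric n M) :
    IsFiniteMeasure (volumeMeasure g) := by
  have : IsLocallyFiniteMeasure (volumeMeasure g) := by
    refine ⟨fun x => ?_⟩
    obtain ⟨O, hO, hxO, hOs, c, hc⟩ := exists_isOpen_bounded_in_chart x
      (contDiffOn_volDensity g x).continuousOn
    refine ⟨O, hO.mem_nhds hxO, ?_⟩
    rw [← inter_eq_left.2 hOs, ← Measure.restrict_apply hO.measurableSet, volumeMeasure_restrict]
    refine map_withDensity_restrict_lt_top (measurableSet_target x)
      (continuousOn_extChartAt_symm x) volume _ hO.measurableSet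
      (B := Metric.closedBall (extChartAt (𝓡∂ n) x x) 1) (c := c)
      (isCompact_closedBall _ _).measure_lt_top fun y hy hyO => ?_
    have := hc _ hyO
    rwa [(extChartAt (𝓡∂ n) x).right_inv hy] at this
  infer_instance

theorem isFiniteMeasure_surfaceMeasure [CompactSpace M] (g : SmoothMetric n M) :
    IsFiniteMeasure (surfaceMeasure g) := by
  have : IsLocallyFiniteMeasure (surfaceMeasure g) := by
    refine ⟨fun x => ?_⟩
    obtain ⟨O, hO, hxO, hOs, c, hc⟩ := exists_isOpen_bounded_in_chart x
      ((contDiffOn_volDensity g x).continuousOn.mul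
        (contDiffOn_metricMatrix_inv g x 0 0).continuousOn.sqrt)
    refine ⟨O, hO.mem_nhds hxO, ?_⟩
    rw [← inter_eq_left.2 hOs, ← Measure.restrict_apply hO.measurableSet, surfaceMeasure_restrict]
    refine map_withDensity_restrict_lt_top (isOpen_bdryEmb_preimage_target x).measurableSet
      (continuousOn_symm_bdryEmb x) volume _ hO.measurableSet
      (B := bdryProj '' Metric.closedBall (extChartAt (𝓡∂ n) x x) 1) (c := c)
      ((isCompact_closedBall _ _).image bdryProj.continuous).measure_lt_top fun y hy hyO => ?_
    have := hc _ hyO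
    rw [(extChartAt (𝓡∂ n) x).right_inv hy] at this
    exact ⟨⟨_, this.1, bdryProj_bdryEmb y⟩, by rw [surfDensity_eq g hy]; exact this.2⟩
  infer_instance

theorem isFiniteMeasure_weightedVolume [CompactSpace M] (g : SmoothMetric n M) {μ : M → ℝ}
    (hμ : Continuous μ) : IsFiniteMeasure (weightedVolume g μ) := by
  have := isFiniteMeasure_volumeMeasure g
  refine isFiniteMeasure_withDensity_ofReal ?_
  exact (hμ.integrable_of_hasCompactSupport (HasCompactSupport.of_compactSpace μ)).2

theorem surfaceMeasure_compl_boundary [CompactSpace M] (g : SmoothMetric n M) :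
    surfaceMeasure g ((𝓡∂ n).boundary M)ᶜ = 0 := by
  obtain ⟨s, -, hs⟩ := isCompact_univ.elim_nhds_subcover
    (fun p : M => (extChartAt (𝓡∂ n) p).source) fun p _ => extChartAt_source_mem_nhds p
  have h : ((𝓡∂ n).boundary M)ᶜ
      ⊆ ⋃ p ∈ s, ((𝓡∂ n).boundary M)ᶜ ∩ (extChartAt (𝓡∂ n) p).source := fun x hx => by
    obtain ⟨p, hp, hxp⟩ := mem_iUnion₂.1 (hs (mem_univ x))
    exact mem_iUnion₂.2 ⟨p, hp, hx, hxp⟩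
  refine measure_mono_null h ((measure_biUnion_null_iff s.countable_toSet).2 fun p _ => ?_)
  rw [← Measure.restrict_apply isClosed_boundary.measurableSet.compl, surfaceMeasure_restrict]
  exact chartSurface_compl_boundary g p

theorem ae_surfaceMeasure_mem_boundary [CompactSpace M] (g : SmoothMetric n M) :
    ∀ᵐ x ∂(surfaceMeasure g), x ∈ (𝓡∂ n).boundary M := by
  rw [ae_iff]; exact surfaceMeasure_compl_boundary g

theorem integrable_surfaceMeasure [CompactSpace M] (g : SmoothMetric n M) {F : M → ℝ}
    (hF : ContinuousOn F ((𝓡∂ n).boundary M)) : Integrable F (surfaceMeasure g) := by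
  have := isFiniteMeasure_surfaceMeasure g
  have hr : (surfaceMeasure g).restrict ((𝓡∂ n).boundary M) = surfaceMeasure g :=
    Measure.restrict_eq_self_of_ae_mem (ae_surfaceMeasure_mem_boundary g)
  rw [← hr]
  exact hF.integrableOn_compact' isClosed_boundary.isCompact isClosed_boundary.measurableSet

theorem integrable_weightedVolume [CompactSpace M] (g : SmoothMetric n M) {μ : M → ℝ}
    (hμ : Continuous μ) {F : M → ℝ} (hF : Continuous F) : Integrable F (weightedVolume g μ) := by
  have := isFiniteMeasure_weightedVolume g hμ
  exact hF.integrable_of_hasCompactSupport (HasCompactSupport.of_compactSpace F)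

end

section

/-! ### The weighted Laplacian in a chart -/

/-- The weighted Laplacian computed in the chart at `p`. -/
def lapIn (g : SmoothMetric n M) (μ : M → ℝ) (p : M) (h : M → ℝ) (x : M) : ℝ :=
  (μ x)⁻¹ * divergenceIn g p (fun y => μ y • gradient g h y) x

/-- The components of `|g|^{1/2} μ ∇h` in the chart at `p`. -/
def flux (g : SmoothMetric n M) (μ : M → ℝ) (p : M) (h : M → ℝ) (i : Fin n) (y : 𝔼) : ℝ :=
  volDensity g p y * (chartRep p μ y * fieldCoord p (gradient g h) i y)

theorem chartRep_lapIn (g : SmoothMetric n M) (μ : M → ℝ) (h : M → ℝ) {p : M} {y : 𝔼}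
    (hy : y ∈ (extChartAt (𝓡∂ n) p).target) :
    chartRep p (lapIn g μ p h) y = (chartRep p μ y)⁻¹ * ((volDensity g p y)⁻¹
      * ∑ i, partialDeriv i (flux g μ p h i) y) := by
  have h1 : ∀ i, (fun y => volDensity g p y * fieldCoord p (fun y => μ y • gradient g h y) i y)
      = flux g μ p h i := by
    intro i
    ext y
    rw [flux, fieldCoord, vecCoord, map_smul]
    rfl
  rw [chartRep, lapIn, divergenceIn, (extChartAt (𝓡∂ n) p).right_inv hy]
  simp only [h1]
  rfl

theorem contDiffOn_flux (g : SmoothMetric n M) {μ : M → ℝ} (hμ : ContMDiff (𝓡∂ n) 𝓘(ℝ) ∞ μ)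
    (p : M) {k : ℕ∞} {h : M → ℝ} (hh : ContMDiff (𝓡∂ n) 𝓘(ℝ) (k + 1 : ℕ∞) h) (i : Fin n) :
    ContDiffOn ℝ k (flux g μ p h i) (extChartAt (𝓡∂ n) p).target := by
  refine ((contDiffOn_volDensity g p).of_le (by exact_mod_cast le_top)).mul
    (ContDiffOn.mul ?_ (contDiffOn_fieldCoord_gradient g p hh i))
  exact contDiffOn_chartRep p (hμ.of_le (by exact_mod_cast le_top))

theorem contDiffOn_lapIn (g : SmoothMetric n M) {μ : M → ℝ} (hμ : ContMDiff (𝓡∂ n) 𝓘(ℝ) ∞ μ)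
    (hμpos : ∀ x, 0 < μ x)
    (p : M) {k : ℕ∞} {h : M → ℝ} (hh : ContMDiff (𝓡∂ n) 𝓘(ℝ) (k + 1 + 1 : ℕ∞) h) :
    ContDiffOn ℝ k (chartRep p (lapIn g μ p h)) (extChartAt (𝓡∂ n) p).target := by
  refine ContDiffOn.congr ?_ fun y hy => chartRep_lapIn g μ h hy
  refine ContDiffOn.mul ?_ (ContDiffOn.mul ?_ (ContDiffOn.sum fun i _ => ?_))
  · exact (contDiffOn_chartRep p (hμ.of_le (by exact_mod_cast le_top))).inv
      fun y _ => (hμpos _).ne'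
  · exact ((contDiffOn_volDensity g p).of_le (by exact_mod_cast le_top)).inv
      fun y hy => (volDensity_pos g hy).ne'
  · exact contDiffOn_partialDeriv (by norm_cast) (contDiffOn_flux g hμ p hh i) i

omit [IsManifold (𝓡∂ n) ∞ M] in
theorem partialDeriv_mul {p : M} {F G : 𝔼 → ℝ} {y : 𝔼}
    (hF : ContDiffOn ℝ 1 F (extChartAt (𝓡∂ n) p).target)
    (hG : ContDiffOn ℝ 1 G (extChartAt (𝓡∂ n) p).target)
    (hy : y ∈ (extChartAt (𝓡∂ n) p).target) (i : Fin n) :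
    partialDeriv i (fun z => F z * G z) y = partialDeriv i F y * G y + F y * partialDeriv i G y := by
  simp only [partialDeriv_eq_target hy]
  have hu := uniqueDiffOn_extChartAt_target (I := 𝓡∂ n) p y hy
  have h := fderivWithin_fun_mul hu (hF.differentiableOn one_ne_zero y hy)
    (hG.differentiableOn one_ne_zero y hy)
  rw [h]
  simp only [add_apply, smul_apply, smul_eq_mul]
  ring

/-- The bounding hyperplane is a proper subspace, hence null, so volume integrands need be
identified only at interior points. -/
theorem ae_pos_of_nonneg :
    ∀ᵐ y ∂(volume.restrict {y : 𝔼 | 0 ≤ y 0}), 0 < y 0 := by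
  have h0 : volume {y : 𝔼 | y 0 = 0} = 0 := by
    have := Measure.addHaar_submodule (volume : Measure 𝔼)
      (LinearMap.ker ((EuclideanSpace.proj 0 : 𝔼 →L[ℝ] ℝ) : 𝔼 →ₗ[ℝ] ℝ)) (by
        intro h
        have h1 : (EuclideanSpace.single 0 1 : 𝔼) ∈ LinearMap.ker
          ((EuclideanSpace.proj 0 : 𝔼 →L[ℝ] ℝ) : 𝔼 →ₗ[ℝ] ℝ) := by rw [h]; trivial
        simp at h1)
    exact this
  rw [ae_restrict_iff' isClosed_halfSpace.measurableSet]
  have : ∀ᵐ y ∂(volume : Measure 𝔼), ¬ y 0 = 0 := by rw [ae_iff]; simpa using h0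
  filter_upwards [this] with y hy hy0
  exact lt_of_le_of_ne hy0 (Ne.symm hy)

/-- The product rule for div(f μ ∇h), multiplied by the volume density. -/
theorem sum_partialDeriv_mul_flux (g : SmoothMetric n M) {μ : M → ℝ}
    (hμ : ContMDiff (𝓡∂ n) 𝓘(ℝ) ∞ μ) (hμpos : ∀ x, 0 < μ x) {p : M} {f h : M → ℝ}
    (hf : ContMDiff (𝓡∂ n) 𝓘(ℝ) 1 f) (hh : ContMDiff (𝓡∂ n) 𝓘(ℝ) 2 h) {y : 𝔼}
    (hy : y ∈ (extChartAt (𝓡∂ n) p).target) :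
    ∑ i, partialDeriv i (fun z => chartRep p f z * flux g μ p h i z) y
      = volDensity g p y * chartRep p (fun x => μ x * (f x * lapIn g μ p h x + gradInner g f h x)) y
      := by
  have h1 : ∀ i, partialDeriv i (fun z => chartRep p f z * flux g μ p h i z) y
      = partialDeriv i (chartRep p f) y * flux g μ p h i y
        + chartRep p f y * partialDeriv i (flux g μ p h i) y := fun i =>
    partialDeriv_mul (contDiffOn_chartRep (k := 1) p hf)
      (contDiffOn_flux (k := 1) g hμ p (by exact_mod_cast hh) i) hy i
  have h2 : ∑ i, partialDeriv i (flux g μ p h i) y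
      = chartRep p μ y * volDensity g p y * chartRep p (lapIn g μ p h) y := by
    rw [chartRep_lapIn g μ h hy]
    have ha : chartRep p μ y ≠ 0 := (hμpos _).ne'
    have hb := (volDensity_pos g hy).ne'
    field_simp
  have h3 := gradInner_eq_sum_fieldCoord g hy (hf.mdifferentiableAt one_ne_zero) h
  simp only [h1, Finset.sum_add_distrib, ← Finset.mul_sum, h2]
  have h4 : chartRep p (fun x => μ x * (f x * lapIn g μ p h x + gradInner g f h x)) y
      = chartRep p μ y * (chartRep p f y * chartRep p (lapIn g μ p h) y
        + chartRep p (gradInner g f h) y) := rfl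
  rw [h4, h3]
  have h5 : ∑ i, partialDeriv i (chartRep p f) y * flux g μ p h i y
      = volDensity g p y * chartRep p μ y
        * ∑ i, partialDeriv i (chartRep p f) y * fieldCoord p (gradient g h) i y := by
    rw [Finset.mul_sum]
    refine Finset.sum_congr rfl fun i _ => ?_
    rw [flux]; ring
  rw [h5]
  ring

theorem gradInner_eq_zero_of_notMem_tsupport (g : SmoothMetric n M) {f : M → ℝ} (h : M → ℝ) {x : M}
    (hx : x ∉ tsupport f) : gradInner g f h x = 0 := by
  have h1 : f =ᶠ[nhds x] fun _ => 0 := notMem_tsupport_iff_eventuallyEq.1 hx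
  rw [gradInner_eq_mvfderiv]
  have h2 : mfderiv (𝓡∂ n) 𝓘(ℝ) f x = mfderiv (𝓡∂ n) 𝓘(ℝ) (fun _ => (0 : ℝ)) x := by
    apply Filter.EventuallyEq.mfderiv_eq h1
  have h3 : mfderiv (𝓡∂ n) 𝓘(ℝ) f x = 0 := by rw [h2]; exact mfderiv_const
  exact DFunLike.congr_fun h3 _

variable [MeasurableSpace M] [BorelSpace M] [CompactSpace M]

/-- Green's formula in a chart. -/
theorem integral_mul_lapIn_add (g : SmoothMetric n M) {μ : M → ℝ}
    (hμ : ContMDiff (𝓡∂ n) 𝓘(ℝ) ∞ μ) (hμpos : ∀ x, 0 < μ x) {p : M} {f h : M → ℝ}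
    (hf : ContMDiff (𝓡∂ n) 𝓘(ℝ) 1 f) (hh : ContMDiff (𝓡∂ n) 𝓘(ℝ) 2 h)
    (hfp : tsupport f ⊆ (extChartAt (𝓡∂ n) p).source) :
    ∫ x, (f x * lapIn g μ p h x + gradInner g f h x) ∂(weightedVolume g μ)
      = ∫ x, f x * normalDeriv g h x * μ x ∂(surfaceMeasure g) := by
  set t := (extChartAt (𝓡∂ n) p).target with ht
  have htm : MeasurableSet t := measurableSet_target p
  set K : Set 𝔼 := extChartAt (𝓡∂ n) p '' tsupport f with hK
  have hKc : IsCompact K := (isClosed_tsupport f).isCompact.image_of_continuousOn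
    ((continuousOn_extChartAt p).mono hfp)
  have hKt : K ⊆ t := by
    rintro _ ⟨x, hx, rfl⟩
    exact (extChartAt (𝓡∂ n) p).map_source (hfp hx)
  have hfK : ∀ y ∈ t, y ∉ K → (extChartAt (𝓡∂ n) p).symm y ∉ tsupport f := fun y hy hyK h =>
    hyK ⟨_, h, (extChartAt (𝓡∂ n) p).right_inv hy⟩
  have hh1 : ContMDiff (𝓡∂ n) 𝓘(ℝ) 1 h := hh.of_le one_le_two
  -- The flux of f ∇h is extended by zero outside the target. On the half-space the extension stays
  -- continuous, because f has compact support in the relatively open target.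
  set F : Fin n → 𝔼 → ℝ := fun i => t.indicator fun y => chartRep p f y * flux g μ p h i y with hF
  have hsm : ∀ i, ContDiffOn ℝ 1 (fun y => chartRep p f y * flux g μ p h i y) t := fun i =>
    (contDiffOn_chartRep (k := 1) p hf).mul
      (contDiffOn_flux (k := 1) g hμ p (by exact_mod_cast hh) i)
  have hF0 : ∀ i, ∀ y ∉ K, F i y = 0 := by
    intro i y hy
    by_cases hyt : y ∈ t
    · simp only [hF, indicator_of_mem hyt]
      rw [chartRep, image_eq_zero_of_notMem_tsupport (hfK y hyt hy), zero_mul]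
    · exact indicator_of_notMem hyt _
  have hF0' : ∀ i, ∀ y ∉ K, F i =ᶠ[nhds y] fun _ => 0 := fun i y hy => by
    filter_upwards [hKc.isClosed.isOpen_compl.mem_nhds hy] with z hz using hF0 i z hz
  have hFt : ∀ i, ∀ y ∈ t, 0 < y 0 → F i =ᶠ[nhds y] fun y => chartRep p f y * flux g μ p h i y := by
    intro i y hy hy0
    have := mem_interior_iff_mem_nhds.1 ((mem_interior_target_iff hy).2 hy0)
    filter_upwards [this] with z hz using indicator_of_mem hz _
  have hdF : ∀ i y, 0 < y 0 → DifferentiableAt ℝ (F i) y := by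
    intro i y hy0
    by_cases hy : y ∈ t
    · have h1 := mem_interior_iff_mem_nhds.1 ((mem_interior_target_iff hy).2 hy0)
      exact (((hsm i).differentiableOn one_ne_zero y hy).differentiableAt h1).congr_of_eventuallyEq
        (hFt i y hy hy0)
    · exact (differentiableAt_const (0 : ℝ)).congr_of_eventuallyEq (hF0' i y fun h => hy (hKt h))
  have hFd : ∀ i, ∀ y ∈ t, 0 < y 0 → fderiv ℝ (F i) y (EuclideanSpace.single i 1)
      = partialDeriv i (fun z => chartRep p f z * flux g μ p h i z) y := by
    intro i y hy hy0
    rw [(hFt i y hy hy0).fderiv_eq, partialDeriv_eq_target hy,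
      fderivWithin_of_mem_nhds (mem_interior_iff_mem_nhds.1 ((mem_interior_target_iff hy).2 hy0))]
  set D : 𝔼 → ℝ := fun y => volDensity g p y
    * chartRep p (fun x => μ x * (f x * lapIn g μ p h x + gradInner g f h x)) y with hD
  have hDc : ContinuousOn D t := by
    refine (contDiffOn_volDensity g p).continuousOn.mul ?_
    refine ((contDiffOn_chartRep (k := ⊤) p hμ).continuousOn).mul
      (ContinuousOn.add (ContinuousOn.mul ?_ ?_) ?_)
    · exact (contDiffOn_chartRep (k := 1) p hf).continuousOn
    · exact (contDiffOn_lapIn (k := 0) g hμ hμpos p (by exact_mod_cast hh)).continuousOn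
    · exact (contDiffOn_chartRep (k := 0) p
        (contMDiff_gradInner (k := 0) g (by simpa using hf) (by simpa using hh1))).continuousOn
  have hD0 : ∀ y ∈ t, y ∉ K → D y = 0 := by
    intro y hy hyK
    have h1 := hfK y hy hyK
    simp only [hD, chartRep]
    rw [image_eq_zero_of_notMem_tsupport h1, gradInner_eq_zero_of_notMem_tsupport g h h1]
    ring
  have hae : (fun y => ∑ i, fderiv ℝ (F i) y (EuclideanSpace.single i 1))
      =ᵐ[volume.restrict {y : 𝔼 | 0 ≤ y 0}] t.indicator D := by
    filter_upwards [ae_pos_of_nonneg] with y hy0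
    by_cases hy : y ∈ t
    · rw [indicator_of_mem hy, hD]
      simp only
      rw [← sum_partialDeriv_mul_flux g hμ hμpos hf hh hy]
      exact Finset.sum_congr rfl fun i _ => hFd i y hy hy0
    · rw [indicator_of_notMem hy]
      refine Finset.sum_eq_zero fun i _ => ?_
      rw [(hF0' i y fun h => hy (hKt h)).fderiv_eq]
      simp
  have hHt : t ∩ {y : 𝔼 | 0 ≤ y 0} = t := inter_eq_left.2 fun y hy => nonneg_of_mem_target hy
  -- The target need not be bounded, but D is continuous on it and vanishes off the compact set K.
  have hint : IntegrableOn D t := by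
    have h1 : IntegrableOn D K := (hDc.mono hKt).integrableOn_compact hKc
    refine (integrableOn_iff_integrable_of_support_subset (f := t.indicator D) (s := K) ?_).1 ?_
      |>.integrableOn.congr_fun (fun y hy => indicator_of_mem hy D) htm
    · intro y hy
      by_contra hyK
      apply hy
      by_cases hyt : y ∈ t
      · rw [indicator_of_mem hyt, hD0 y hyt hyK]
      · exact indicator_of_notMem hyt _
    · exact h1.congr_fun (fun y hy => (indicator_of_mem (hKt hy) D).symm) hKc.measurableSet
  have hmain := integral_divergence_halfSpace F (fun i => fderiv ℝ (F i)) hKc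
    (fun i => ?_) (fun i y hy => (hdF i y hy).hasFDerivAt) hF0
    (fun i y hy => by rw [(hF0' i y hy).fderiv_eq]; simp) ?_
  · rw [integral_congr_ae hae, setIntegral_indicator htm, inter_comm, hHt] at hmain
    have hμc := hμ.continuous
    have hcont : Continuous fun x => μ x * (f x * lapIn g μ p h x + gradInner g f h x) := by
      refine continuous_of_support_subset_source (p := p) (isClosed_tsupport f) hfp
        (fun x hx => ?_) (continuousOn_source_of_target ?_)
      · rw [image_eq_zero_of_notMem_tsupport hx, gradInner_eq_zero_of_notMem_tsupport g h hx]
        ring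
      · refine (ContinuousOn.congr (f := fun y => (volDensity g p y)⁻¹ * D y) ?_ fun y hy => ?_)
        · exact ((contDiffOn_volDensity g p).continuousOn.inv₀
            fun y hy => (volDensity_pos g hy).ne').mul hDc
        · simp only [hD]
          rw [inv_mul_cancel_left₀ (volDensity_pos g hy).ne']
    rw [integral_weightedVolume g hμc hμpos, integral_volumeMeasure g p hcont, hmain,
      integral_surfaceMeasure g p]
    · rw [← integral_indicator (isOpen_bdryEmb_preimage_target p).measurableSet, ← integral_neg]
      refine integral_congr_ae (Filter.Eventually.of_forall fun y' => ?_)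
      dsimp only
      by_cases hy : bdryEmb y' ∈ t
      · rw [indicator_of_mem (show y' ∈ bdryEmb ⁻¹' (extChartAt (𝓡∂ n) p).target from hy)]
        simp only [hF, indicator_of_mem hy, flux]
        -- This identity makes the integrand over the hyperplane the one prescribed by the surface
        -- measure and the normal derivative.
        have h1 := normalDeriv_mul_surfDensity g h hy
        calc _ = -(volDensity g p (bdryEmb y') * fieldCoord p (gradient g h) 0 (bdryEmb y'))
            * (chartRep p f (bdryEmb y') * chartRep p μ (bdryEmb y')) := by ring
          _ = _ := by rw [← h1]; simp only [chartRep]; ring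
      · rw [indicator_of_notMem (show y' ∉ bdryEmb ⁻¹' (extChartAt (𝓡∂ n) p).target from hy)]
        simp only [hF, indicator_of_notMem hy, neg_zero]
    · exact (hf.continuous.continuousOn.mul (continuousOn_normalDeriv g hh1)).mul hμc.continuousOn
    · intro x hx
      rw [image_eq_zero_of_notMem_tsupport fun h => hx (hfp h)]
      ring
    · intro x hx
      rw [image_eq_zero_of_notMem_tsupport fun h => hx (hfp h),
        gradInner_eq_zero_of_notMem_tsupport g h fun h => hx (hfp h)]
      ring
  · intro y hy
    by_cases hyt : y ∈ t
    · have h1 := (hsm i).continuousOn y hyt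
      have h2 : ContinuousWithinAt (F i) t y :=
        h1.congr (fun z hz => indicator_of_mem hz _) (indicator_of_mem hyt _)
      refine h2.mono_of_mem_nhdsWithin ?_
      have h3 := extChartAt_target_mem_nhdsWithin_of_mem hyt
      rwa [range_modelWithCornersEuclideanHalfSpace] at h3
    · exact (continuousAt_const.congr (hF0' i y fun h => hyt (hKt h)).symm).continuousWithinAt
  · refine IntegrableOn.congr_fun_ae ?_ hae.symm
    rw [IntegrableOn, integrable_indicator_iff htm, IntegrableOn, Measure.restrict_restrict htm, hHt]
    exact hint

end

section

/-! ### Functions supported in a chart -/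

open Classical in
/-- The function on `M` which is `F` in the chart at `p`, and zero elsewhere. -/
def pullback (p : M) (F : 𝔼 → ℝ) (x : M) : ℝ :=
  if x ∈ (extChartAt (𝓡∂ n) p).source then F (extChartAt (𝓡∂ n) p x) else 0

omit [IsManifold (𝓡∂ n) ∞ M] in
theorem pullback_of_mem {p x : M} (F : 𝔼 → ℝ) (hx : x ∈ (extChartAt (𝓡∂ n) p).source) :
    pullback p F x = F (extChartAt (𝓡∂ n) p x) := if_pos hx

omit [IsManifold (𝓡∂ n) ∞ M] in
theorem pullback_of_notMem {p x : M} (F : 𝔼 → ℝ) (hx : x ∉ (extChartAt (𝓡∂ n) p).source) :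
    pullback p F x = 0 := if_neg hx

omit [IsManifold (𝓡∂ n) ∞ M] in
theorem chartRep_pullback {p : M} (F : 𝔼 → ℝ) {y : 𝔼}
    (hy : y ∈ (extChartAt (𝓡∂ n) p).target) : chartRep p (pullback p F) y = F y := by
  rw [chartRep, pullback_of_mem F ((extChartAt (𝓡∂ n) p).map_target hy),
    (extChartAt (𝓡∂ n) p).right_inv hy]

omit [IsManifold (𝓡∂ n) ∞ M] in
theorem tsupport_pullback_subset [T2Space M] {p : M} {F : 𝔼 → ℝ} {K : Set 𝔼} (hK : IsCompact K)
    (hKt : K ⊆ (extChartAt (𝓡∂ n) p).target)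
    (h0 : ∀ y ∈ (extChartAt (𝓡∂ n) p).target, y ∉ K → F y = 0) :
    tsupport (pullback p F) ⊆ (extChartAt (𝓡∂ n) p).symm '' K := by
  refine closure_minimal ?_
    (hK.image_of_continuousOn ((continuousOn_extChartAt_symm p).mono hKt)).isClosed
  intro x hx
  by_cases hxs : x ∈ (extChartAt (𝓡∂ n) p).source
  · rw [Function.mem_support, pullback_of_mem F hxs] at hx
    have h1 := (extChartAt (𝓡∂ n) p).map_source hxs
    exact ⟨_, not_not.1 fun h => hx (h0 _ h1 h), (extChartAt (𝓡∂ n) p).left_inv hxs⟩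
  · exact absurd (pullback_of_notMem F hxs) hx

theorem contMDiff_pullback [T2Space M] {k : ℕ∞} {p : M} {F : 𝔼 → ℝ} {K : Set 𝔼}
    (hK : IsCompact K) (hKt : K ⊆ (extChartAt (𝓡∂ n) p).target)
    (h0 : ∀ y ∈ (extChartAt (𝓡∂ n) p).target, y ∉ K → F y = 0)
    (hF : ContDiffOn ℝ k F (extChartAt (𝓡∂ n) p).target) :
    ContMDiff (𝓡∂ n) 𝓘(ℝ) k (pullback p F) := by
  intro x
  by_cases hx : x ∈ tsupport (pullback p F)
  · obtain ⟨y, hy, rfl⟩ := tsupport_pullback_subset hK hKt h0 hx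
    have hs := (extChartAt (𝓡∂ n) p).map_target (hKt hy)
    have h := (contMDiffOn_of_chart p hF).contMDiffAt
      ((isOpen_extChartAt_source (I := 𝓡∂ n) p).mem_nhds hs)
    refine h.congr_of_eventuallyEq ?_
    filter_upwards [(isOpen_extChartAt_source (I := 𝓡∂ n) p).mem_nhds hs] with z hz
      using pullback_of_mem F hz
  · exact (contMDiffAt_const (c := (0 : ℝ))).congr_of_eventuallyEq
      (notMem_tsupport_iff_eventuallyEq.1 hx)

/-! ### The weighted Laplacian does not depend on the chart -/

theorem continuousOn_lapIn (g : SmoothMetric n M) {μ : M → ℝ} (hμ : ContMDiff (𝓡∂ n) 𝓘(ℝ) ∞ μ)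
    (hμpos : ∀ x, 0 < μ x) (p : M) {h : M → ℝ} (hh : ContMDiff (𝓡∂ n) 𝓘(ℝ) 2 h) :
    ContinuousOn (lapIn g μ p h) (extChartAt (𝓡∂ n) p).source :=
  continuousOn_source_of_target
    (contDiffOn_lapIn (k := 0) g hμ hμpos p (by exact_mod_cast hh)).continuousOn

theorem continuous_mul_lapIn (g : SmoothMetric n M) {μ : M → ℝ}
    (hμ : ContMDiff (𝓡∂ n) 𝓘(ℝ) ∞ μ) (hμpos : ∀ x, 0 < μ x) {p : M} {f h : M → ℝ}
    (hf : Continuous f) (hh : ContMDiff (𝓡∂ n) 𝓘(ℝ) 2 h)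
    (hfp : tsupport f ⊆ (extChartAt (𝓡∂ n) p).source) :
    Continuous fun x => f x * lapIn g μ p h x := by
  refine continuous_of_support_subset_source (p := p) (isClosed_tsupport f) hfp
    (fun x hx => ?_) (hf.continuousOn.mul (continuousOn_lapIn g hμ hμpos p hh))
  rw [image_eq_zero_of_notMem_tsupport hx, zero_mul]

variable [MeasurableSpace M] [BorelSpace M] [CompactSpace M]

/-- The right side of Green's formula mentions no chart, so the two chart Laplacians have the same
weak form. -/
theorem integral_mul_lapIn_eq (g : SmoothMetric n M) {μ : M → ℝ}
    (hμ : ContMDiff (𝓡∂ n) 𝓘(ℝ) ∞ μ) (hμpos : ∀ x, 0 < μ x) {p q : M} {f h : M → ℝ}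
    (hf : ContMDiff (𝓡∂ n) 𝓘(ℝ) 1 f) (hh : ContMDiff (𝓡∂ n) 𝓘(ℝ) 2 h)
    (hfp : tsupport f ⊆ (extChartAt (𝓡∂ n) p).source)
    (hfq : tsupport f ⊆ (extChartAt (𝓡∂ n) q).source) :
    ∫ x, f x * (lapIn g μ p h x - lapIn g μ q h x) ∂(weightedVolume g μ) = 0 := by
  have hg := continuous_gradInner g hf (hh.of_le one_le_two)
  have h1 := integral_mul_lapIn_add g hμ hμpos hf hh hfp
  rw [← integral_mul_lapIn_add g hμ hμpos hf hh hfq, ← sub_eq_zero, ← integral_sub] at h1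
  · rw [← h1]
    refine integral_congr_ae (Filter.Eventually.of_forall fun x => ?_)
    dsimp only
    ring
  · exact integrable_weightedVolume g hμ.continuous
      ((continuous_mul_lapIn g hμ hμpos hf.continuous hh hfp).add hg)
  · exact integrable_weightedVolume g hμ.continuous
      ((continuous_mul_lapIn g hμ hμpos hf.continuous hh hfq).add hg)

/-- The fundamental lemma of the calculus of variations: bumps supported in the open part of the
overlap are pulled back to M and used as test functions. The difference of the Laplacians then
vanishes almost everywhere and, being continuous, everywhere there. -/
theorem lapIn_eq_of_pos [T2Space M] (g : SmoothMetric n M) {μ : M → ℝ}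
    (hμ : ContMDiff (𝓡∂ n) 𝓘(ℝ) ∞ μ) (hμpos : ∀ x, 0 < μ x) {p q : M} {h : M → ℝ}
    (hh : ContMDiff (𝓡∂ n) 𝓘(ℝ) 2 h) {y : 𝔼} (hy : y ∈ overlap p q) (hy0 : 0 < y 0) :
    chartRep p (lapIn g μ p h) y = chartRep p (lapIn g μ q h) y := by
  set D : 𝔼 → ℝ := fun y => chartRep p (lapIn g μ p h) y - chartRep p (lapIn g μ q h) y with hD
  set U : Set 𝔼 := overlap p q ∩ {y | 0 < y 0} with hU
  have hUt : U ⊆ (extChartAt (𝓡∂ n) p).target := fun y hy => hy.1.1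
  have hUo : IsOpen U := by
    rw [isOpen_iff_mem_nhds]
    intro z hz
    have hpos : {y : 𝔼 | 0 < y 0} ∈ nhds z :=
      (isOpen_lt continuous_const (by fun_prop)).mem_nhds hz.2
    refine Filter.inter_mem ?_ hpos
    have h1 := overlap_mem_nhdsWithin hz.1
    rwa [nhdsWithin_eq_nhds.2] at h1
    rw [range_modelWithCornersEuclideanHalfSpace]
    exact Filter.mem_of_superset hpos fun y (hy : 0 < y 0) => hy.le
  have hDc : ContinuousOn D U := by
    refine ((contDiffOn_lapIn (k := 0) g hμ hμpos p (by exact_mod_cast hh)).continuousOn.mono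
      hUt).sub ?_
    exact (continuousOn_lapIn g hμ hμpos q hh).comp ((continuousOn_extChartAt_symm p).mono hUt)
      fun z hz => hz.1.2
  set W : 𝔼 → ℝ := fun y => volDensity g p y * (chartRep p μ y * D y) with hW
  have hWc : ContinuousOn W U := by
    refine ((contDiffOn_volDensity g p).continuousOn.mono hUt).mul (ContinuousOn.mul ?_ hDc)
    exact (contDiffOn_chartRep (k := ⊤) p hμ).continuousOn.mono hUt
  have hae : ∀ᵐ z ∂(volume : Measure 𝔼), z ∈ U → W z = 0 := by
    refine hUo.ae_eq_zero_of_integral_contDiff_smul_eq_zero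
      (hWc.locallyIntegrableOn hUo.measurableSet) fun φ hφ hφc hφU => ?_
    have hKt := hφU.trans hUt
    have h0 : ∀ y ∈ (extChartAt (𝓡∂ n) p).target, y ∉ tsupport φ → φ y = 0 :=
      fun y _ hy => image_eq_zero_of_notMem_tsupport hy
    have hsm : ContMDiff (𝓡∂ n) 𝓘(ℝ) ∞ (pullback p φ) :=
      contMDiff_pullback (k := ⊤) hφc hKt h0 hφ.contDiffOn
    have hs := tsupport_pullback_subset (p := p) hφc hKt h0
    have hp : tsupport (pullback p φ) ⊆ (extChartAt (𝓡∂ n) p).source := fun x hx => by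
      obtain ⟨y, hy, rfl⟩ := hs hx
      exact (extChartAt (𝓡∂ n) p).map_target (hKt hy)
    have hq : tsupport (pullback p φ) ⊆ (extChartAt (𝓡∂ n) q).source := fun x hx => by
      obtain ⟨y, hy, rfl⟩ := hs hx
      exact (hφU hy).1.2
    have hsm1 : ContMDiff (𝓡∂ n) 𝓘(ℝ) 1 (pullback p φ) := hsm.of_le (by exact_mod_cast le_top)
    have h1 := integral_mul_lapIn_eq g hμ hμpos hsm1 hh hp hq
    rw [integral_weightedVolume g hμ.continuous hμpos, integral_volumeMeasure g p] at h1
    · rw [← h1, ← integral_indicator (measurableSet_target p)]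
      refine integral_congr_ae (Filter.Eventually.of_forall fun z => ?_)
      dsimp only
      by_cases hz : z ∈ (extChartAt (𝓡∂ n) p).target
      · rw [indicator_of_mem hz]
        have h2 := chartRep_pullback φ hz
        simp only [chartRep] at h2
        simp only [hW, hD, chartRep, h2, smul_eq_mul]
        ring
      · rw [indicator_of_notMem hz, image_eq_zero_of_notMem_tsupport fun h => hz (hKt h), zero_smul]
    · have h3 := (continuous_mul_lapIn g hμ hμpos hsm1.continuous hh hp).sub
        (continuous_mul_lapIn g hμ hμpos hsm1.continuous hh hq)
      refine hμ.continuous.mul (h3.congr fun x => ?_)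
      simp only [Pi.sub_apply]
      ring
    · intro x hx
      rw [pullback_of_notMem _ hx]; ring
  have heq : EqOn W (fun _ => 0) U :=
    Measure.eqOn_open_of_ae_eq ((ae_restrict_iff' hUo.measurableSet).2 hae) hUo hWc
      continuousOn_const
  have h2 : volDensity g p y * (chartRep p μ y * D y) = 0 := heq ⟨hy, hy0⟩
  rcases mul_eq_zero.1 h2 with h3 | h3
  · exact absurd h3 (volDensity_pos g hy.1).ne'
  · rcases mul_eq_zero.1 h3 with h4 | h4
    · exact absurd h4 (hμpos _).ne'
    · exact sub_eq_zero.1 h4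

/-- A boundary point is the limit of interior ones along the inward ray, and both chart Laplacians
are continuous up to the boundary. -/
theorem lapIn_eq [T2Space M] (g : SmoothMetric n M) {μ : M → ℝ}
    (hμ : ContMDiff (𝓡∂ n) 𝓘(ℝ) ∞ μ) (hμpos : ∀ x, 0 < μ x) {p q x : M} {h : M → ℝ}
    (hh : ContMDiff (𝓡∂ n) 𝓘(ℝ) 2 h) (hp : x ∈ (extChartAt (𝓡∂ n) p).source)
    (hq : x ∈ (extChartAt (𝓡∂ n) q).source) : lapIn g μ p h x = lapIn g μ q h x := by
  obtain ⟨y, hy, rfl⟩ : ∃ y ∈ (extChartAt (𝓡∂ n) p).target, (extChartAt (𝓡∂ n) p).symm y = x :=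
    ⟨_, (extChartAt (𝓡∂ n) p).map_source hp, (extChartAt (𝓡∂ n) p).left_inv hp⟩
  have hy' : y ∈ overlap p q := ⟨hy, hq⟩
  have hc : ContinuousOn
      (fun z : 𝔼 => chartRep p (lapIn g μ p h) z - chartRep p (lapIn g μ q h) z)
      (overlap p q) := by
    refine ((contDiffOn_lapIn (k := 0) g hμ hμpos p (by exact_mod_cast hh)).continuousOn.mono
      inter_subset_left).sub ?_
    exact (continuousOn_lapIn g hμ hμpos q hh).comp
      ((continuousOn_extChartAt_symm p).mono inter_subset_left) fun z hz => hz.2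
  obtain ⟨-, hl⟩ := tendsto_line (n := n) hy' 0
  have hl' : ∀ᶠ t in nhdsWithin (0 : ℝ) (Ioi 0),
      y + t • (EuclideanSpace.single 0 1 : 𝔼) ∈ overlap p q :=
    hl.filter_mono (nhdsWithin_mono _ Ioi_subset_Ici_self)
  have ht : Filter.Tendsto (fun t : ℝ => y + t • (EuclideanSpace.single 0 1 : 𝔼))
      (nhdsWithin (0 : ℝ) (Ioi 0)) (nhdsWithin y (overlap p q)) := by
    refine tendsto_nhdsWithin_iff.2 ⟨?_, hl'⟩
    have : Continuous fun t : ℝ => y + t • (EuclideanSpace.single 0 1 : 𝔼) := by fun_prop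
    have h2 := this.tendsto 0
    rw [zero_smul, add_zero] at h2
    exact h2.mono_left nhdsWithin_le_nhds
  have h3 := (hc y hy').tendsto.comp ht
  have h4 : Filter.Tendsto ((fun z : 𝔼 => chartRep p (lapIn g μ p h) z - chartRep p (lapIn g μ q h) z) ∘
      fun t : ℝ => y + t • (EuclideanSpace.single 0 1 : 𝔼)) (nhdsWithin (0 : ℝ) (Ioi 0))
      (nhds 0) := by
    refine tendsto_const_nhds.congr' ?_
    filter_upwards [hl', self_mem_nhdsWithin] with t ht1 ht2
    have := nonneg_of_mem_target hy
    have ht3 : (0 : ℝ) < t := ht2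
    refine (sub_eq_zero.2 (lapIn_eq_of_pos g hμ hμpos hh ht1 ?_)).symm
    simp
    linarith
  exact sub_eq_zero.1 (tendsto_nhds_unique h3 h4)

theorem weightedLaplacian_eq_lapIn [T2Space M] (g : SmoothMetric n M) {μ : M → ℝ}
    (hμ : ContMDiff (𝓡∂ n) 𝓘(ℝ) ∞ μ) (hμpos : ∀ x, 0 < μ x) {p x : M} {h : M → ℝ}
    (hh : ContMDiff (𝓡∂ n) 𝓘(ℝ) 2 h) (hp : x ∈ (extChartAt (𝓡∂ n) p).source) :
    weightedLaplacian g μ h x = lapIn g μ p h x :=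
  lapIn_eq g hμ hμpos hh (mem_extChartAt_source x) hp

theorem contMDiff_weightedLaplacian [T2Space M] (g : SmoothMetric n M) {μ : M → ℝ}
    (hμ : ContMDiff (𝓡∂ n) 𝓘(ℝ) ∞ μ) (hμpos : ∀ x, 0 < μ x) {k : ℕ∞} {h : M → ℝ}
    (hh : ContMDiff (𝓡∂ n) 𝓘(ℝ) (k + 1 + 1 : ℕ∞) h) :
    ContMDiff (𝓡∂ n) 𝓘(ℝ) k (weightedLaplacian g μ h) := by
  refine contMDiff_of_chartRep fun p => (contDiffOn_lapIn g hμ hμpos p hh).congr fun y hy => ?_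
  have h2 : ContMDiff (𝓡∂ n) 𝓘(ℝ) 2 h := hh.of_le (by
    have : (2 : ℕ∞) ≤ k + 1 + 1 := by
      rw [add_assoc, one_add_one_eq_two]; exact le_add_self
    exact WithTop.coe_le_coe.2 this)
  exact weightedLaplacian_eq_lapIn g hμ hμpos h2 ((extChartAt (𝓡∂ n) p).map_target hy)

/-! ### Rules for gradients -/

omit [MeasurableSpace M] [BorelSpace M] [CompactSpace M] in
theorem gradInner_add_left (g : SmoothMetric n M) {f₁ f₂ : M → ℝ} (h : M → ℝ) {x : M}
    (h₁ : MDifferentiableAt (𝓡∂ n) 𝓘(ℝ) f₁ x) (h₂ : MDifferentiableAt (𝓡∂ n) 𝓘(ℝ) f₂ x) :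
    gradInner g (fun y => f₁ y + f₂ y) h x = gradInner g f₁ h x + gradInner g f₂ h x := by
  simp only [gradInner_eq_mvfderiv]
  exact DFunLike.congr_fun (mvfderiv_add h₁ h₂) _

omit [MeasurableSpace M] [BorelSpace M] [CompactSpace M] in
theorem gradInner_sub_left (g : SmoothMetric n M) {f₁ f₂ : M → ℝ} (h : M → ℝ) {x : M}
    (h₁ : MDifferentiableAt (𝓡∂ n) 𝓘(ℝ) f₁ x) (h₂ : MDifferentiableAt (𝓡∂ n) 𝓘(ℝ) f₂ x) :
    gradInner g (fun y => f₁ y - f₂ y) h x = gradInner g f₁ h x - gradInner g f₂ h x := by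
  simp only [gradInner_eq_mvfderiv]
  exact DFunLike.congr_fun (mvfderiv_sub h₁ h₂) _

omit [MeasurableSpace M] [BorelSpace M] [CompactSpace M] in
theorem gradInner_mul_left (g : SmoothMetric n M) {f₁ f₂ : M → ℝ} (h : M → ℝ) {x : M}
    (h₁ : MDifferentiableAt (𝓡∂ n) 𝓘(ℝ) f₁ x) (h₂ : MDifferentiableAt (𝓡∂ n) 𝓘(ℝ) f₂ x) :
    gradInner g (fun y => f₁ y * f₂ y) h x
      = f₁ x * gradInner g f₂ h x + f₂ x * gradInner g f₁ h x := by
  simp only [gradInner_eq_mvfderiv]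
  exact DFunLike.congr_fun (mvfderiv_mul h₁ h₂) _

omit [MeasurableSpace M] [BorelSpace M] [CompactSpace M] in
theorem gradInner_comp_left (g : SmoothMetric n M) {φ : ℝ → ℝ} {φ' : ℝ} {f : M → ℝ} (h : M → ℝ)
    {x : M} (hφ : HasDerivAt φ φ' (f x)) (hf : MDifferentiableAt (𝓡∂ n) 𝓘(ℝ) f x) :
    gradInner g (fun y => φ (f y)) h x = φ' * gradInner g f h x := by
  simp only [gradInner_eq_mvfderiv]
  have h1 := (hφ.hasFDerivAt.hasMFDerivAt.comp x hf.hasMFDerivAt).mfderiv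
  refine (DFunLike.congr_fun h1 (gradient g h x)).trans ?_
  change (ContinuousLinearMap.toSpanSingleton ℝ φ') (mvfderiv (𝓡∂ n) f x (gradient g h x)) = _
  rw [ContinuousLinearMap.toSpanSingleton_apply, smul_eq_mul, mul_comm]

omit [MeasurableSpace M] [BorelSpace M] [CompactSpace M] in
theorem gradInner_const_mul_left (g : SmoothMetric n M) (c : ℝ) {f : M → ℝ} (h : M → ℝ)
    {x : M} (hf : MDifferentiableAt (𝓡∂ n) 𝓘(ℝ) f x) :
    gradInner g (fun y => c * f y) h x = c * gradInner g f h x :=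
  gradInner_comp_left g h (by simpa using (hasDerivAt_id (f x)).const_mul c) hf

omit [MeasurableSpace M] [BorelSpace M] [CompactSpace M] in
theorem gradInner_sum_left {ι : Type*} (g : SmoothMetric n M) (s : Finset ι) {f : ι → M → ℝ}
    (h : M → ℝ) {x : M} (hf : ∀ i, ContMDiff (𝓡∂ n) 𝓘(ℝ) 1 (f i)) :
    gradInner g (fun y => ∑ i ∈ s, f i y) h x = ∑ i ∈ s, gradInner g (f i) h x := by
  classical
  induction s using Finset.induction_on with
  | empty =>
    simp only [Finset.sum_empty, gradInner_eq_mvfderiv]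
    exact DFunLike.congr_fun (mvfderiv_const (0 : ℝ)) _
  | insert i s hi ih =>
    simp only [Finset.sum_insert hi]
    rw [gradInner_add_left g h ((hf i).mdifferentiableAt one_ne_zero), ih]
    have : ContMDiff (𝓡∂ n) 𝓘(ℝ) 1 fun y => ∑ i ∈ s, f i y :=
      contMDiff_finsetSum fun i _ => hf i
    exact this.mdifferentiableAt one_ne_zero

/-! ### Green's formula -/

omit [MeasurableSpace M] [BorelSpace M] in
theorem exists_partitionOfUnity (n : ℕ) [NeZero n] (M : Type*) [TopologicalSpace M]
    [ChartedSpace (EuclideanHalfSpace n) M] [IsManifold (𝓡∂ n) ∞ M] [CompactSpace M] [T2Space M] :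
    ∃ (s : Finset M) (χ : M → M → ℝ), (∀ p, ContMDiff (𝓡∂ n) 𝓘(ℝ) ∞ (χ p)) ∧
      (∀ p, tsupport (χ p) ⊆ (extChartAt (𝓡∂ n) p).source) ∧ (∀ p x, 0 ≤ χ p x) ∧
      ∀ x, ∑ p ∈ s, χ p x = 1 := by
  obtain ⟨χ, hχ⟩ := SmoothPartitionOfUnity.exists_isSubordinate_chartAt_source (𝓡∂ n) M
  have hfin := χ.locallyFinite.finite_nonempty_of_compact
  refine ⟨hfin.toFinset, fun p => χ p, fun p => (χ p).contMDiff, fun p => ?_,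
    fun p x => χ.nonneg p x, fun x => ?_⟩
  · rw [extChartAt_source]; exact hχ p
  · rw [← χ.sum_eq_one (mem_univ x), finsum_eq_sum_of_support_subset]
    intro p hp
    simp only [Finite.coe_toFinset]
    exact ⟨x, hp⟩

/-- Green's formula. -/
theorem integral_mul_weightedLaplacian_add [T2Space M] (g : SmoothMetric n M) {μ : M → ℝ}
    (hμ : ContMDiff (𝓡∂ n) 𝓘(ℝ) ∞ μ) (hμpos : ∀ x, 0 < μ x) {f h : M → ℝ}
    (hf : ContMDiff (𝓡∂ n) 𝓘(ℝ) 1 f) (hh : ContMDiff (𝓡∂ n) 𝓘(ℝ) 2 h) :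
    ∫ x, (f x * weightedLaplacian g μ h x + gradInner g f h x) ∂(weightedVolume g μ)
      = ∫ x, f x * normalDeriv g h x * μ x ∂(surfaceMeasure g) := by
  obtain ⟨s, χ, hχ, hs, -, h1⟩ := exists_partitionOfUnity n M
  set f' : M → M → ℝ := fun p x => χ p x * f x with hf'
  have hf1 : ∀ p, ContMDiff (𝓡∂ n) 𝓘(ℝ) 1 (f' p) := fun p =>
    ((hχ p).of_le (by exact_mod_cast le_top)).mul hf
  have hsupp : ∀ p, tsupport (f' p) ⊆ (extChartAt (𝓡∂ n) p).source := fun p =>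
    (closure_mono fun x (hx : χ p x * f x ≠ 0) => left_ne_zero_of_mul hx).trans (hs p)
  have hsum : f = fun x => ∑ p ∈ s, f' p x := by
    ext x
    simp only [hf', ← Finset.sum_mul, h1, one_mul]
  have hkey := fun p => integral_mul_lapIn_add g hμ hμpos (hf1 p) hh (hsupp p)
  -- On the support of the localized factor the chart Laplacian is the global one; elsewhere both
  -- products are zero.
  have hlap : ∀ p x, f' p x * lapIn g μ p h x = f' p x * weightedLaplacian g μ h x := by
    intro p x
    by_cases hx : x ∈ tsupport (f' p)
    · rw [weightedLaplacian_eq_lapIn g hμ hμpos hh (hsupp p hx)]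
    · rw [image_eq_zero_of_notMem_tsupport hx, zero_mul, zero_mul]
  calc ∫ x, (f x * weightedLaplacian g μ h x + gradInner g f h x) ∂(weightedVolume g μ)
      = ∫ x, ∑ p ∈ s, (f' p x * lapIn g μ p h x + gradInner g (f' p) h x)
          ∂(weightedVolume g μ) := by
        refine integral_congr_ae (Filter.Eventually.of_forall fun x => ?_)
        dsimp only
        simp only [hlap, Finset.sum_add_distrib, ← Finset.sum_mul]
        rw [← gradInner_sum_left g s h hf1, ← hsum, ← congrFun hsum x]
    _ = ∑ p ∈ s, ∫ x, f' p x * normalDeriv g h x * μ x ∂(surfaceMeasure g) := by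
        rw [integral_finsetSum]
        · exact Finset.sum_congr rfl fun p _ => hkey p
        · intro p _
          exact integrable_weightedVolume g hμ.continuous
            ((continuous_mul_lapIn g hμ hμpos (hf1 p).continuous hh (hsupp p)).add
              (continuous_gradInner g (hf1 p) (hh.of_le one_le_two)))
    _ = ∫ x, f x * normalDeriv g h x * μ x ∂(surfaceMeasure g) := by
        rw [← integral_finsetSum]
        · refine integral_congr_ae (Filter.Eventually.of_forall fun x => ?_)
          dsimp only
          rw [← Finset.sum_mul, ← Finset.sum_mul, ← congrFun hsum x]
        · intro p _
          exact integrable_surfaceMeasure g (((hf1 p).continuous.continuousOn.mul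
            (continuousOn_normalDeriv g (hh.of_le one_le_two))).mul hμ.continuous.continuousOn)

end

section

/-! ### The Hessian -/

omit [IsManifold (𝓡∂ n) ∞ M] in
theorem partialDeriv_congr {p : M} {F G : 𝔼 → ℝ} {y : 𝔼}
    (hy : y ∈ (extChartAt (𝓡∂ n) p).target) (h : EqOn F G (extChartAt (𝓡∂ n) p).target)
    (i : Fin n) : partialDeriv i F y = partialDeriv i G y := by
  rw [partialDeriv_eq_target hy, partialDeriv_eq_target hy, fderivWithin_congr h (h hy)]

omit [IsManifold (𝓡∂ n) ∞ M] in
theorem partialDeriv_sum {ι : Type*} (s : Finset ι) {p : M} {F : ι → 𝔼 → ℝ} {y : 𝔼}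
    (hF : ∀ k, ContDiffOn ℝ 1 (F k) (extChartAt (𝓡∂ n) p).target)
    (hy : y ∈ (extChartAt (𝓡∂ n) p).target) (i : Fin n) :
    partialDeriv i (fun z => ∑ k ∈ s, F k z) y = ∑ k ∈ s, partialDeriv i (F k) y := by
  simp only [partialDeriv_eq_target hy]
  rw [fderivWithin_fun_sum (uniqueDiffOn_extChartAt_target (I := 𝓡∂ n) p y hy)
    fun k _ => (hF k).differentiableOn one_ne_zero y hy, sum_apply]

omit [IsManifold (𝓡∂ n) ∞ M] in
-- Second derivatives within the target are symmetric even at its boundary points, since these are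
-- limits of interior points.
theorem partialDeriv_comm {p : M} {F : 𝔼 → ℝ} {y : 𝔼}
    (hF : ContDiffOn ℝ 2 F (extChartAt (𝓡∂ n) p).target)
    (hy : y ∈ (extChartAt (𝓡∂ n) p).target) (i j : Fin n) :
    partialDeriv i (partialDeriv j F) y = partialDeriv j (partialDeriv i F) y := by
  have hu := uniqueDiffOn_extChartAt_target (I := 𝓡∂ n) p
  have key : ∀ i j : Fin n, partialDeriv i (partialDeriv j F) y
      = fderivWithin ℝ (fderivWithin ℝ F (extChartAt (𝓡∂ n) p).target)
        (extChartAt (𝓡∂ n) p).target y (EuclideanSpace.single i 1) (EuclideanSpace.single j 1) := by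
    intro i j
    rw [partialDeriv_congr hy (fun z hz => partialDeriv_eq_target hz j F),
      partialDeriv_eq_target hy]
    have h1 : DifferentiableWithinAt ℝ (fderivWithin ℝ F (extChartAt (𝓡∂ n) p).target)
        (extChartAt (𝓡∂ n) p).target y :=
      (hF.fderivWithin hu (m := 1) (by norm_num)).differentiableOn one_ne_zero y hy
    rw [fderivWithin_clm_apply (hu y hy) h1 (differentiableWithinAt_const _)]
    simp
  rw [key, key]
  exact ((hF y hy).isSymmSndFDerivWithinAt (by simp) hu
    (extChartAt_target_subset_closure_interior hy) hy) _ _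

/-- The algebra behind D²ℓ(v,v): `da` and `dg` stand for the first derivatives of ∇ℓ and of the
metric, `v` for the components of ∇h and `h` for the same vector with its index lowered. -/
theorem sum_christoffel {ι : Type*} [Fintype ι] [DecidableEq ι] {G : Matrix ι ι ℝ}
    (hG : G.det ≠ 0) (hsymm : ∀ i j, G i j = G j i) (da : ι → ι → ℝ) {dg : ι → ι → ι → ℝ}
    (hdg : ∀ i j k, dg i j k = dg i k j) (a : ι → ℝ) {v h : ι → ℝ}
    (hv : ∀ k, ∑ l, G k l * v l = h k) :
    ∑ k, ∑ l, G k l * (∑ i, v i * da i k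
        + ∑ i, ∑ j, (1 / 2 * ∑ m, G⁻¹ k m * (dg i j m + dg j i m - dg m i j)) * v i * a j) * v l
      = ∑ i, v i * ∑ k, da i k * h k + 1 / 2 * ∑ j, a j * ∑ i, ∑ l, dg j i l * v i * v l := by
  have hinv : ∀ m, ∑ k, h k * G⁻¹ k m = v m := by
    intro m
    have h1 : h = G.mulVec v := funext fun k => (hv k).symm
    have h2 : G.transpose = G := by ext i j; exact hsymm j i
    have h3 : Matrix.vecMul h G⁻¹ = v := by
      rw [h1, ← Matrix.vecMul_transpose, h2, Matrix.vecMul_vecMul,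
        Matrix.mul_nonsing_inv _ (isUnit_iff_ne_zero.2 hG), Matrix.vecMul_one]
    exact congrFun h3 m
  have h1 : ∀ k (c : ℝ), ∑ l, G k l * c * v l = h k * c := by
    intro k c
    rw [← hv k, Finset.sum_mul]
    exact Finset.sum_congr rfl fun l _ => by ring
  have h2 : ∑ k, h k * (∑ i, ∑ j, (1 / 2 * ∑ m, G⁻¹ k m * (dg i j m + dg j i m - dg m i j))
        * v i * a j)
      = ∑ i, ∑ j, 1 / 2 * (v i * a j) * ∑ m, v m * (dg i j m + dg j i m - dg m i j) := by
    have h2' : ∀ B : ι → ℝ, ∑ k, h k * ∑ m, G⁻¹ k m * B m = ∑ m, v m * B m := by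
      intro B
      simp_rw [← hinv, Finset.sum_mul, Finset.mul_sum]
      rw [Finset.sum_comm]
      exact Finset.sum_congr rfl fun m _ => Finset.sum_congr rfl fun k _ => by ring
    simp_rw [← h2']
    simp_rw [Finset.mul_sum (s := Finset.univ) (f := fun i => ∑ j, (1 / 2 * _) * v i * a j)]
    rw [Finset.sum_comm]
    refine Finset.sum_congr rfl fun i _ => ?_
    simp_rw [Finset.mul_sum (s := Finset.univ) (f := fun j => (1 / 2 * _) * v i * a j)]
    rw [Finset.sum_comm]
    refine Finset.sum_congr rfl fun j _ => ?_
    rw [Finset.mul_sum]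
    exact Finset.sum_congr rfl fun k _ => by ring
  -- Two of the three Christoffel terms cancel when they are contracted with the symmetric v_i v_m;
  -- only the derivative of the metric along `a` is left.
  have h3 : ∑ i, ∑ j, ∑ m, v i * a j * (v m * dg m i j)
      = ∑ i, ∑ j, ∑ m, v i * a j * (v m * dg i j m) := by
    rw [Finset.sum_comm]
    conv_rhs => rw [Finset.sum_comm]
    refine Finset.sum_congr rfl fun j _ => ?_
    rw [Finset.sum_comm]
    refine Finset.sum_congr rfl fun i _ => Finset.sum_congr rfl fun m _ => ?_
    rw [hdg i m j]; ring
  have h4 : ∑ j, a j * ∑ i, ∑ l, dg j i l * v i * v l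
      = ∑ i, ∑ j, ∑ m, v i * a j * (v m * dg j i m) := by
    rw [Finset.sum_comm]
    simp_rw [Finset.mul_sum]
    exact Finset.sum_congr rfl fun j _ => Finset.sum_congr rfl fun i _ =>
      Finset.sum_congr rfl fun m _ => by ring
  simp_rw [h1]
  simp_rw [mul_add, Finset.sum_add_distrib]
  rw [h2, h4]
  congr 1
  · simp_rw [Finset.mul_sum]
    rw [Finset.sum_comm]
    exact Finset.sum_congr rfl fun i _ => Finset.sum_congr rfl fun k _ => by ring
  · simp_rw [mul_sub, mul_add, Finset.sum_sub_distrib, Finset.sum_add_distrib, mul_sub, mul_add,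
      Finset.sum_sub_distrib, Finset.sum_add_distrib]
    simp_rw [mul_assoc (1 / 2 : ℝ), ← Finset.mul_sum]
    simp_rw [Finset.mul_sum] at h3 ⊢
    simp_rw [← Finset.mul_sum] at h3 ⊢
    linarith

theorem partialDeriv_gradInner (g : SmoothMetric n M) {p : M} {y : 𝔼} (hy : y ∈ (extChartAt (𝓡∂ n) p).target)
    {f h : M → ℝ} (hf : ContMDiff (𝓡∂ n) 𝓘(ℝ) 2 f) (hh : ContMDiff (𝓡∂ n) 𝓘(ℝ) 2 h)
    (i : Fin n) :
    partialDeriv i (chartRep p (gradInner g f h)) y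
      = ∑ k, (partialDeriv i (fieldCoord p (gradient g f) k) y * partialDeriv k (chartRep p h) y
        + fieldCoord p (gradient g f) k y * partialDeriv i (partialDeriv k (chartRep p h)) y) := by
  have h1 : ∀ k, ContDiffOn ℝ 1 (fieldCoord p (gradient g f) k) (extChartAt (𝓡∂ n) p).target :=
    fun k => contDiffOn_fieldCoord_gradient (k := 1) g p (by exact_mod_cast hf) k
  have h2 : ∀ k, ContDiffOn ℝ 1 (partialDeriv k (chartRep p h)) (extChartAt (𝓡∂ n) p).target :=
    fun k => contDiffOn_partialDeriv (k := 2) (by norm_num) (contDiffOn_chartRep (k := 2) p hh) k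
  have h3 : EqOn (chartRep p (gradInner g f h)) (fun y => ∑ k,
      fieldCoord p (gradient g f) k y * partialDeriv k (chartRep p h) y)
      (extChartAt (𝓡∂ n) p).target := fun z hz => by
    have : gradInner g f h = gradInner g h f := funext fun x => gradInner_comm g f h x
    rw [this, gradInner_eq_sum_fieldCoord g hz (hh.mdifferentiableAt two_ne_zero)]
    exact Finset.sum_congr rfl fun k _ => mul_comm _ _
  rw [partialDeriv_congr hy h3, partialDeriv_sum _ (fun k => (h1 k).mul (h2 k)) hy]
  exact Finset.sum_congr rfl fun k _ => partialDeriv_mul (h1 k) (h2 k) hy i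

/-- Differentiating g_{kl} v^l = ∂_k h avoids differentiating the inverse matrix. It puts the
derivative of |∇h|² in the form that matches the Christoffel terms of `sum_christoffel`. -/
theorem partialDeriv_gradInner_self (g : SmoothMetric n M) {p : M} {y : 𝔼} (hy : y ∈ (extChartAt (𝓡∂ n) p).target)
    {h : M → ℝ} (hh : ContMDiff (𝓡∂ n) 𝓘(ℝ) 2 h)
    (i : Fin n) :
    partialDeriv i (chartRep p (gradInner g h h)) y
      = 2 * ∑ k, fieldCoord p (gradient g h) k y * partialDeriv i (partialDeriv k (chartRep p h)) y
        - ∑ k, ∑ l, partialDeriv i (fun z => metricMatrix g p z k l) y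
          * fieldCoord p (gradient g h) k y * fieldCoord p (gradient g h) l y := by
  set v := fun k => fieldCoord p (gradient g h) k with hvdef
  set t := (extChartAt (𝓡∂ n) p).target with ht
  have h1 : ∀ k, ContDiffOn ℝ 1 (v k) t :=
    fun k => contDiffOn_fieldCoord_gradient (k := 1) g p (by exact_mod_cast hh) k
  have h2 : ∀ k l, ContDiffOn ℝ 1 (fun z => metricMatrix g p z k l) t :=
    fun k l => (contDiffOn_metricMatrix g p k l).of_le (by exact_mod_cast le_top)
  have hG : ∀ z ∈ t, ∀ k, ∑ l, metricMatrix g p z k l * v l z = partialDeriv k (chartRep p h) z :=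
    fun z hz k => sum_metricMatrix_mul_gradient g hz (hh.mdifferentiableAt two_ne_zero) k
  have h3 : ∀ k, partialDeriv i (partialDeriv k (chartRep p h)) y
      = ∑ l, (partialDeriv i (fun z => metricMatrix g p z k l) y * v l y
        + metricMatrix g p y k l * partialDeriv i (v l) y) := by
    intro k
    rw [← partialDeriv_congr hy (fun z hz => hG z hz k),
      partialDeriv_sum _ (fun l => (h2 k l).mul (h1 l)) hy]
    exact Finset.sum_congr rfl fun l _ => partialDeriv_mul (h2 k l) (h1 l) hy i
  have h4 : ∑ k, v k y * partialDeriv i (partialDeriv k (chartRep p h)) y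
      = ∑ k, ∑ l, partialDeriv i (fun z => metricMatrix g p z k l) y * v k y * v l y
        + ∑ k, partialDeriv i (v k) y * partialDeriv k (chartRep p h) y := by
    simp_rw [h3, Finset.sum_add_distrib, mul_add, Finset.sum_add_distrib]
    congr 1
    · simp_rw [Finset.mul_sum]
      exact Finset.sum_congr rfl fun k _ => Finset.sum_congr rfl fun l _ => by ring
    · simp_rw [← hG y hy, Finset.mul_sum]
      rw [Finset.sum_comm]
      exact Finset.sum_congr rfl fun k _ => Finset.sum_congr rfl fun l _ => by
        rw [metricMatrix_symm g p y l k]; ring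
  rw [partialDeriv_gradInner g hy hh hh, Finset.sum_add_distrib, h4]
  ring

omit [IsManifold (𝓡∂ n) ∞ M] in
theorem fieldCoord_extChartAt {p x : M} (hx : x ∈ (extChartAt (𝓡∂ n) p).source)
    (X : (x : M) → TangentSpace (𝓡∂ n) x) (i : Fin n) :
    fieldCoord p X i (extChartAt (𝓡∂ n) p x) = vecCoord p x (X x) i :=
  congrArg (fun z => vecCoord p z (X z) i) ((extChartAt (𝓡∂ n) p).left_inv hx)

theorem gradInner_eq_sum_source (g : SmoothMetric n M) {p x : M}
    (hx : x ∈ (extChartAt (𝓡∂ n) p).source) {f : M → ℝ} (hf : ContMDiff (𝓡∂ n) 𝓘(ℝ) 1 f)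
    (h : M → ℝ) :
    gradInner g f h x = ∑ i, partialDeriv i (chartRep p f) (extChartAt (𝓡∂ n) p x)
      * fieldCoord p (gradient g h) i (extChartAt (𝓡∂ n) p x) := by
  rw [← gradInner_eq_sum_fieldCoord g ((extChartAt (𝓡∂ n) p).map_source hx)
    (hf.mdifferentiableAt one_ne_zero), chartRep, (extChartAt (𝓡∂ n) p).left_inv hx]

/-- By the product rule (∇(∇ℓ,∇h),∇h) = D²ℓ(∇h,∇h) + D²h(∇h,∇ℓ), and half of (∇|∇h|²,∇ℓ) is that
last term. Afterwards Christoffel symbols are no longer needed: all computations are made with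
`gradInner`. -/
theorem hessian_gradient (g : SmoothMetric n M) {ℓ h : M → ℝ}
    (hℓ : ContMDiff (𝓡∂ n) 𝓘(ℝ) 2 ℓ) (hh : ContMDiff (𝓡∂ n) 𝓘(ℝ) 2 h) (x : M) :
    hessian g ℓ x (gradient g h x) (gradient g h x)
      = gradInner g (gradInner g ℓ h) h x - 1 / 2 * gradInner g (gradInner g h h) ℓ x := by
  have hx := mem_extChartAt_source (I := 𝓡∂ n) x
  have hy := mem_extChartAt_target (I := 𝓡∂ n) x
  have hP : ∀ {f h : M → ℝ}, ContMDiff (𝓡∂ n) 𝓘(ℝ) 2 f → ContMDiff (𝓡∂ n) 𝓘(ℝ) 2 h →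
      ContMDiff (𝓡∂ n) 𝓘(ℝ) 1 (gradInner g f h) := fun hf hh =>
    contMDiff_gradInner (k := 1) g (by exact_mod_cast hf) (by exact_mod_cast hh)
  set y := extChartAt (𝓡∂ n) x x with hydef
  rw [gradInner_eq_sum_source g hx (hP hℓ hh), gradInner_eq_sum_source g hx (hP hh hh), ← hydef]
  simp_rw [partialDeriv_gradInner g hy hℓ hh, partialDeriv_gradInner_self g hy hh]
  unfold hessian innerCovDerivIn covDerivCoord christoffel
  simp_rw [← fieldCoord_extChartAt hx, ← hydef]
  rw [sum_christoffel (metricMatrix_det_pos g hy).ne' (metricMatrix_symm g x y)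
    (fun i k => partialDeriv i (fieldCoord x (gradient g ℓ) k) y)
    (dg := fun i j l => partialDeriv i (fun z => metricMatrix g x z j l) y)
    (fun i j k => by simp only [metricMatrix_symm g x _ j k])
    (fun j => fieldCoord x (gradient g ℓ) j y)
    (sum_metricMatrix_mul_gradient g hy (hh.mdifferentiableAt two_ne_zero))]
  -- The second derivatives of h occur contracted with ∇ℓ and ∇h in either order and cancel by
  -- symmetry.
  have h5 : ∑ i, (∑ k, fieldCoord x (gradient g ℓ) k y
        * partialDeriv i (partialDeriv k (chartRep x h)) y) * fieldCoord x (gradient g h) i y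
      = ∑ i, (∑ k, fieldCoord x (gradient g h) k y
        * partialDeriv i (partialDeriv k (chartRep x h)) y) * fieldCoord x (gradient g ℓ) i y := by
    simp_rw [Finset.sum_mul]
    rw [Finset.sum_comm]
    refine Finset.sum_congr rfl fun k _ => Finset.sum_congr rfl fun l _ => ?_
    rw [partialDeriv_comm (contDiffOn_chartRep (k := 2) x hh) hy l k]
    ring
  simp_rw [Finset.sum_add_distrib, add_mul, sub_mul, Finset.sum_add_distrib,
    Finset.sum_sub_distrib, mul_assoc (2 : ℝ), ← Finset.mul_sum, h5]
  simp_rw [mul_comm (fieldCoord x (gradient g h) _ y) (∑ k, _),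
    mul_comm (fieldCoord x (gradient g ℓ) _ y) (∑ k, _)]
  ring

/-! ### The multiplier -/

/-- The weight `e^{τℓ}`. -/
def expWeight (τ : ℝ) (ℓ : M → ℝ) (x : M) : ℝ := Real.exp (τ * ℓ x)

omit [IsManifold (𝓡∂ n) ∞ M] in
theorem contMDiff_expWeight (τ : ℝ) {k : WithTop ℕ∞} {ℓ : M → ℝ} (hℓ : ContMDiff (𝓡∂ n) 𝓘(ℝ) k ℓ) :
    ContMDiff (𝓡∂ n) 𝓘(ℝ) k (expWeight τ ℓ) := by
  have h : ContDiff ℝ k fun t : ℝ => Real.exp (τ * t) := by fun_prop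
  exact h.contMDiff.comp hℓ

theorem gradInner_expWeight (g : SmoothMetric n M) (τ : ℝ) {ℓ : M → ℝ} (h : M → ℝ) {x : M}
    (hℓ : MDifferentiableAt (𝓡∂ n) 𝓘(ℝ) ℓ x) :
    gradInner g (expWeight τ ℓ) h x = τ * expWeight τ ℓ x * gradInner g ℓ h x := by
  have h1 : HasDerivAt (fun t : ℝ => Real.exp (τ * t)) (τ * Real.exp (τ * ℓ x)) (ℓ x) := by
    have := ((hasDerivAt_id (ℓ x)).const_mul τ).exp
    simpa [mul_comm] using this
  exact gradInner_comp_left g h h1 hℓ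

/-- The weighted function `e^{τℓ} u`. -/
def weighted (τ : ℝ) (ℓ u : M → ℝ) (x : M) : ℝ := expWeight τ ℓ x * u x

/-- The multiplier `(∇ℓ, ∇w) + (s - ρ) w / 2`. -/
def multiplier (g : SmoothMetric n M) (ℓ s : M → ℝ) (ρ : ℝ) (w : M → ℝ) (x : M) : ℝ :=
  gradInner g ℓ w x + 1 / 2 * ((s x - ρ) * w x)

/-- The density whose flux along `∇ℓ` appears in the multiplier identity; `w` and `y` are the
weighted solution and its time derivative. -/
def auxDensity (g : SmoothMetric n M) (ℓ s : M → ℝ) (ρ τ : ℝ) (w y : M → ℝ) (x : M) : ℝ :=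
  1 / 2 * (y x * y x) - 1 / 2 * gradInner g w w x + 1 / 2 * τ ^ 2 * (gradInner g ℓ ℓ x * (w x * w x))
    + τ * (w x * multiplier g ℓ s ρ w x)

section Multiplier
variable {ℓ s u v : M → ℝ} {ρ τ : ℝ}

theorem contMDiff_gradInner_one (g : SmoothMetric n M) {f h : M → ℝ}
    (hf : ContMDiff (𝓡∂ n) 𝓘(ℝ) 2 f) (hh : ContMDiff (𝓡∂ n) 𝓘(ℝ) 2 h) :
    ContMDiff (𝓡∂ n) 𝓘(ℝ) 1 (gradInner g f h) :=
  contMDiff_gradInner (k := 1) g (by exact_mod_cast hf) (by exact_mod_cast hh)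

theorem contMDiff_multiplier (g : SmoothMetric n M) {w : M → ℝ}
    (hℓ : ContMDiff (𝓡∂ n) 𝓘(ℝ) 2 ℓ) (hs : ContMDiff (𝓡∂ n) 𝓘(ℝ) 1 s)
    (hw : ContMDiff (𝓡∂ n) 𝓘(ℝ) 2 w) :
    ContMDiff (𝓡∂ n) 𝓘(ℝ) 1 (multiplier g ℓ s ρ w) :=
  (contMDiff_gradInner_one g hℓ hw).add (contMDiff_const.mul
    ((hs.sub contMDiff_const).mul (hw.of_le one_le_two)))

theorem contMDiff_auxDensity (g : SmoothMetric n M) {w y : M → ℝ}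
    (hℓ : ContMDiff (𝓡∂ n) 𝓘(ℝ) 2 ℓ) (hs : ContMDiff (𝓡∂ n) 𝓘(ℝ) 1 s)
    (hw : ContMDiff (𝓡∂ n) 𝓘(ℝ) 2 w) (hy : ContMDiff (𝓡∂ n) 𝓘(ℝ) 1 y) :
    ContMDiff (𝓡∂ n) 𝓘(ℝ) 1 (auxDensity g ℓ s ρ τ w y) := by
  have hw1 := hw.of_le one_le_two
  exact (((contMDiff_const.mul (hy.mul hy)).sub
    (contMDiff_const.mul (contMDiff_gradInner_one g hw hw))).add
    (contMDiff_const.mul ((contMDiff_gradInner_one g hℓ hℓ).mul (hw1.mul hw1)))).add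
    (contMDiff_const.mul (hw1.mul (contMDiff_multiplier g hℓ hs hw)))

theorem gradInner_multiplier (g : SmoothMetric n M) {w : M → ℝ}
    (hℓ : ContMDiff (𝓡∂ n) 𝓘(ℝ) 2 ℓ) (hs : ContMDiff (𝓡∂ n) 𝓘(ℝ) 1 s)
    (hw : ContMDiff (𝓡∂ n) 𝓘(ℝ) 2 w) (h : M → ℝ) (x : M) :
    gradInner g (multiplier g ℓ s ρ w) h x = gradInner g (gradInner g ℓ w) h x
      + 1 / 2 * ((s x - ρ) * gradInner g w h x + w x * gradInner g s h x) := by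
  have hw1 := (hw.mdifferentiableAt two_ne_zero : MDifferentiableAt (𝓡∂ n) 𝓘(ℝ) w x)
  have hs1 := (hs.mdifferentiableAt one_ne_zero : MDifferentiableAt (𝓡∂ n) 𝓘(ℝ) s x)
  have hsρ : ContMDiff (𝓡∂ n) 𝓘(ℝ) 1 fun x => s x - ρ := hs.sub contMDiff_const
  have hp : ContMDiff (𝓡∂ n) 𝓘(ℝ) 1 fun x => (s x - ρ) * w x := hsρ.mul (hw.of_le one_le_two)
  have hc : ContMDiff (𝓡∂ n) 𝓘(ℝ) 1 fun x => 1 / 2 * ((s x - ρ) * w x) := contMDiff_const.mul hp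
  have h1 : gradInner g (fun x => s x - ρ) h x = gradInner g s h x := by
    have := gradInner_comp_left g (φ := fun t => t - ρ) h ((hasDerivAt_id (s x)).sub_const ρ) hs1
    simpa using this
  have h2 := gradInner_add_left g h
    ((contMDiff_gradInner_one g hℓ hw).mdifferentiableAt one_ne_zero :
      MDifferentiableAt (𝓡∂ n) 𝓘(ℝ) _ x) (hc.mdifferentiableAt one_ne_zero)
  rw [gradInner_const_mul_left g _ h (hp.mdifferentiableAt one_ne_zero),
    gradInner_mul_left g h (hsρ.mdifferentiableAt one_ne_zero) hw1, h1] at h2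
  exact h2

theorem gradInner_auxDensity (g : SmoothMetric n M) {w y : M → ℝ}
    (hℓ : ContMDiff (𝓡∂ n) 𝓘(ℝ) 2 ℓ) (hs : ContMDiff (𝓡∂ n) 𝓘(ℝ) 1 s)
    (hw : ContMDiff (𝓡∂ n) 𝓘(ℝ) 2 w) (hy : ContMDiff (𝓡∂ n) 𝓘(ℝ) 1 y) (h : M → ℝ) (x : M) :
    gradInner g (auxDensity g ℓ s ρ τ w y) h x
      = y x * gradInner g y h x - 1 / 2 * gradInner g (gradInner g w w) h x
        + 1 / 2 * τ ^ 2 * (2 * gradInner g ℓ ℓ x * (w x * gradInner g w h x)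
          + w x * w x * gradInner g (gradInner g ℓ ℓ) h x)
        + τ * (w x * gradInner g (multiplier g ℓ s ρ w) h x
          + multiplier g ℓ s ρ w x * gradInner g w h x) := by
  have hw1 := hw.of_le one_le_two
  have d : ∀ {f : M → ℝ}, ContMDiff (𝓡∂ n) 𝓘(ℝ) 1 f → MDifferentiableAt (𝓡∂ n) 𝓘(ℝ) f x :=
    fun hf => hf.mdifferentiableAt one_ne_zero
  have c1 : ContMDiff (𝓡∂ n) 𝓘(ℝ) 1 fun x => y x * y x := hy.mul hy
  have c2 := contMDiff_gradInner_one g hw hw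
  have c3 : ContMDiff (𝓡∂ n) 𝓘(ℝ) 1 fun x => w x * w x := hw1.mul hw1
  have c4 : ContMDiff (𝓡∂ n) 𝓘(ℝ) 1 fun x => gradInner g ℓ ℓ x * (w x * w x) :=
    (contMDiff_gradInner_one g hℓ hℓ).mul c3
  have c5 := contMDiff_multiplier (ρ := ρ) g hℓ hs hw
  have c6 : ContMDiff (𝓡∂ n) 𝓘(ℝ) 1 fun x => w x * multiplier g ℓ s ρ w x := hw1.mul c5
  have e1 : ContMDiff (𝓡∂ n) 𝓘(ℝ) 1 fun x => 1 / 2 * (y x * y x) := contMDiff_const.mul c1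
  have e2 : ContMDiff (𝓡∂ n) 𝓘(ℝ) 1 fun x => 1 / 2 * gradInner g w w x := contMDiff_const.mul c2
  have e3 : ContMDiff (𝓡∂ n) 𝓘(ℝ) 1 fun x => 1 / 2 * τ ^ 2 * (gradInner g ℓ ℓ x * (w x * w x)) :=
    contMDiff_const.mul c4
  have e4 : ContMDiff (𝓡∂ n) 𝓘(ℝ) 1 fun x => τ * (w x * multiplier g ℓ s ρ w x) :=
    contMDiff_const.mul c6
  have e5 : ContMDiff (𝓡∂ n) 𝓘(ℝ) 1 fun x => 1 / 2 * (y x * y x) - 1 / 2 * gradInner g w w x :=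
    e1.sub e2
  have e6 : ContMDiff (𝓡∂ n) 𝓘(ℝ) 1 fun x => 1 / 2 * (y x * y x) - 1 / 2 * gradInner g w w x
      + 1 / 2 * τ ^ 2 * (gradInner g ℓ ℓ x * (w x * w x)) := e5.add e3
  refine (gradInner_add_left g h (d e6) (d e4)).trans ?_
  rw [gradInner_add_left g h (d e5) (d e3), gradInner_sub_left g h (d e1) (d e2),
    gradInner_const_mul_left g _ h (d c1), gradInner_const_mul_left g _ h (d c2),
    gradInner_const_mul_left g _ h (d c4), gradInner_const_mul_left g _ h (d c6),
    gradInner_mul_left g h (d hy) (d hy),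
    gradInner_mul_left g h (d (contMDiff_gradInner_one g hℓ hℓ)) (d c3),
    gradInner_mul_left g h (d hw1) (d hw1), gradInner_mul_left g h (d hw1) (d c5)]
  ring

/-- The rule e^{τℓ}∇u = ∇w - τw∇ℓ, paired with an arbitrary gradient: the passage between u and w.
-/
theorem expWeight_mul_gradInner (g : SmoothMetric n M) (τ : ℝ) (f : M → ℝ) {x : M}
    (hℓ : MDifferentiableAt (𝓡∂ n) 𝓘(ℝ) ℓ x) (hu : MDifferentiableAt (𝓡∂ n) 𝓘(ℝ) u x) :
    expWeight τ ℓ x * gradInner g f u x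
      = gradInner g f (weighted τ ℓ u) x - τ * weighted τ ℓ u x * gradInner g f ℓ x := by
  have hW : MDifferentiableAt (𝓡∂ n) 𝓘(ℝ) (expWeight τ ℓ) x := by
    have h : DifferentiableAt ℝ (fun t : ℝ => Real.exp (τ * t)) (ℓ x) := by fun_prop
    exact h.mdifferentiableAt.comp x hℓ
  have h1 : gradInner g (weighted τ ℓ u) f x = expWeight τ ℓ x * gradInner g u f x
      + u x * gradInner g (expWeight τ ℓ) f x := gradInner_mul_left g f hW hu
  rw [gradInner_expWeight g τ f hℓ] at h1
  rw [gradInner_comm g f u, gradInner_comm g f (weighted τ ℓ u), gradInner_comm g f ℓ, h1, weighted]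
  ring

/-- The pointwise multiplier identity. -/
theorem multiplier_identity (g : SmoothMetric n M) {w y : M → ℝ}
    (hℓ : ContMDiff (𝓡∂ n) 𝓘(ℝ) 2 ℓ) (hs : ContMDiff (𝓡∂ n) 𝓘(ℝ) 1 s)
    (hu : ContMDiff (𝓡∂ n) 𝓘(ℝ) 2 u) (hy : ContMDiff (𝓡∂ n) 𝓘(ℝ) 1 y)
    (hwdef : w = weighted τ ℓ u) (x : M) :
    gradInner g (fun z => expWeight τ ℓ z * multiplier g ℓ s ρ w z) u x
        + auxDensity g ℓ s ρ τ w y x * s x + gradInner g (auxDensity g ℓ s ρ τ w y) ℓ x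
        - y x * multiplier g ℓ s ρ y x
      = 1 / 2 * ρ * y x ^ 2 + hessian g ℓ x (gradient g w x) (gradient g w x)
        - 1 / 2 * ρ * gradInner g w w x + 1 / 2 * w x * gradInner g s w x
        + 2 * τ * multiplier g ℓ s ρ w x * (multiplier g ℓ s ρ w x + 1 / 2 * ρ * w x)
        + 1 / 2 * τ ^ 2 * w x ^ 2
          * (2 * hessian g ℓ x (gradient g ℓ x) (gradient g ℓ x) + ρ * gradInner g ℓ ℓ x) := by
  have hW := contMDiff_expWeight τ hℓ
  have hw : ContMDiff (𝓡∂ n) 𝓘(ℝ) 2 w := hwdef ▸ hW.mul hu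
  have hm := contMDiff_multiplier (ρ := ρ) g hℓ hs hw
  have d : ∀ {f : M → ℝ}, ContMDiff (𝓡∂ n) 𝓘(ℝ) 1 f → MDifferentiableAt (𝓡∂ n) 𝓘(ℝ) f x :=
    fun hf => hf.mdifferentiableAt one_ne_zero
  have hℓ1 := d (hℓ.of_le one_le_two)
  have hW1 := d (hW.of_le one_le_two)
  have hGw : ∀ f, expWeight τ ℓ x * gradInner g f u x
      = gradInner g f w x - τ * w x * gradInner g f ℓ x := fun f => by
    rw [hwdef]
    exact expWeight_mul_gradInner g τ f hℓ1 (d (hu.of_le one_le_two))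
  have h1 := gradInner_mul_left g u hW1 (d hm)
  have h2 := hGw ℓ
  rw [hGw, gradInner_expWeight g τ u hℓ1, gradInner_multiplier g hℓ hs hw,
    gradInner_multiplier g hℓ hs hw] at h1
  rw [h1, gradInner_auxDensity g hℓ hs hw hy, gradInner_multiplier g hℓ hs hw,
    hessian_gradient g hℓ hw, hessian_gradient g hℓ hℓ, gradInner_comm g w ℓ,
    gradInner_comm g y ℓ, auxDensity]
  simp only [multiplier]
  -- Differentiating the weight in e^{τℓ}m(w) leaves τ m(w) e^{τℓ}(∇ℓ,∇u), still expressed in u;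
  -- `h2` converts it. All other terms cancel by algebra.
  linear_combination τ * (gradInner g ℓ w x + 1 / 2 * ((s x - ρ) * w x)) * h2

end Multiplier

/-- The quadratic form in the multiplier identity dominates the weighted energy density. -/
theorem multiplier_lower_bound {ρ τ r C y N w K P A S Hw Ha m : ℝ} (hρ : 0 < ρ)
    (hτ : 3 / ρ ≤ τ) (hC : C / (2 * ρ * r ^ 2) ≤ τ) (hr : 0 < r) (hS : ρ ^ 2 + S ≤ C) (hS0 : 0 ≤ S)
    (hN : 0 ≤ N) (hA : r ^ 2 ≤ A) (hP : P ^ 2 ≤ A * N) (hK : K ^ 2 ≤ S * N) (hHw : ρ * N ≤ Hw)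
    (hHa : ρ * A ≤ Ha) :
    1 / (2 * τ) * (y ^ 2 + (N - 2 * τ * w * P + τ ^ 2 * w ^ 2 * A))
      ≤ 1 / 2 * ρ * y ^ 2 + Hw - 1 / 2 * ρ * N + 1 / 2 * w * K + 2 * τ * m * (m + 1 / 2 * ρ * w)
        + 1 / 2 * τ ^ 2 * w ^ 2 * (2 * Ha + ρ * A) := by
  have hτ0 : 0 < τ := lt_of_lt_of_le (by positivity) hτ
  have hρτ : 3 ≤ ρ * τ := by rw [div_le_iff₀ hρ] at hτ; linarith
  have hCτ : ρ ^ 2 + S ≤ τ * (2 * ρ * r ^ 2) := by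
    rw [div_le_iff₀ (by positivity)] at hC; linarith
  have hA0 : 0 ≤ A := (sq_nonneg r).trans hA
  -- Young's inequality. The share ρ/6 is chosen so that ρN - ρN/2 - ρN/6 = ρN/3 remains, which is
  -- at least N/τ because τ ≥ 3/ρ.
  have h1 : -(1 / 2 * w * K) ≤ ρ / 6 * N + 3 / (8 * ρ) * S * w ^ 2 := by
    have h2 : (w * K) ^ 2 ≤ (ρ / 3 * N + 3 / (4 * ρ) * S * w ^ 2) ^ 2 := by
      have h3 : (w * K) ^ 2 ≤ w ^ 2 * (S * N) := by rw [mul_pow]; gcongr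
      have h4 : (ρ / 3 * N + 3 / (4 * ρ) * S * w ^ 2) ^ 2
          = (ρ / 3 * N - 3 / (4 * ρ) * S * w ^ 2) ^ 2 + w ^ 2 * (S * N) := by
        field_simp; ring
      rw [h4]; linarith [sq_nonneg (ρ / 3 * N - 3 / (4 * ρ) * S * w ^ 2)]
    have h5 := abs_le_of_sq_le_sq h2 (by positivity)
    have h6 := (abs_le.1 h5).1
    have h7 : 3 / (8 * ρ) = 1 / 2 * (3 / (4 * ρ)) := by field_simp; ring
    rw [h7]; linarith
  -- Completing the square in m, with minimum at m = -ρw/4.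
  have h2 : -(τ * ρ ^ 2 * w ^ 2 / 8) ≤ 2 * τ * m * (m + 1 / 2 * ρ * w) := by
    linarith [mul_nonneg hτ0.le (sq_nonneg (m + 1 / 4 * ρ * w))]
  have h3 : N - 2 * τ * w * P + τ ^ 2 * w ^ 2 * A ≤ 2 * N + 2 * τ ^ 2 * w ^ 2 * A := by
    have h4 : (2 * τ * w * P) ^ 2 ≤ (N + τ ^ 2 * w ^ 2 * A) ^ 2 := by
      have h5 : (2 * τ * w * P) ^ 2 ≤ 4 * τ ^ 2 * w ^ 2 * (A * N) := by
        have : (2 * τ * w * P) ^ 2 = 4 * τ ^ 2 * w ^ 2 * P ^ 2 := by ring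
        rw [this]; gcongr
      linarith [sq_nonneg (N - τ ^ 2 * w ^ 2 * A)]
    have := (abs_le.1 (abs_le_of_sq_le_sq h4 (by positivity))).1
    linarith
  have h4 : 1 / (2 * τ) * (y ^ 2 + (N - 2 * τ * w * P + τ ^ 2 * w ^ 2 * A))
      ≤ 1 / (2 * τ) * (y ^ 2 + (2 * N + 2 * τ ^ 2 * w ^ 2 * A)) := by gcongr
  have h5 : 1 / (2 * τ) * (y ^ 2 + (2 * N + 2 * τ ^ 2 * w ^ 2 * A))
      = 1 / (2 * τ) * y ^ 2 + 1 / τ * N + τ * w ^ 2 * A := by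
    field_simp; ring
  have h6 : 1 / τ ≤ ρ / 3 := by rw [div_le_div_iff₀ hτ0 (by norm_num)]; linarith
  have h6' : 1 / (2 * τ) ≤ ρ / 2 := by
    rw [div_le_div_iff₀ (by positivity) (by norm_num)]; linarith
  have h7 : 1 / (2 * τ) * y ^ 2 ≤ ρ / 2 * y ^ 2 := by gcongr
  have h8 : 1 / τ * N ≤ ρ / 3 * N := by gcongr
  -- The balance of the coefficients of w². The bound ρτ ≥ 3 gives τA ≤ ρτ²A/3; with the second
  -- condition on τ, the other two terms are at most τ(S + ρ²)/8 ≤ ρτ²A/4. The sum is below the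
  -- available 3ρτ²A/2.
  have h9 : τ * A + 3 / (8 * ρ) * S + τ * ρ ^ 2 / 8 ≤ 3 / 2 * ρ * τ ^ 2 * A := by
    have a1 : 3 * (τ * A) ≤ ρ * τ * (τ * A) := by gcongr
    have a2 : τ * (ρ ^ 2 + S) ≤ τ * (τ * (2 * ρ * A)) := by
      gcongr
      exact hCτ.trans (by gcongr)
    have a3 : 3 / (8 * ρ) * S ≤ τ * S / 8 := by
      have : 3 / (8 * ρ) ≤ τ / 8 := by
        rw [div_le_div_iff₀ (by positivity) (by norm_num)]; linarith
      calc 3 / (8 * ρ) * S ≤ τ / 8 * S := by gcongr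
        _ = _ := by ring
    have a4 : 0 ≤ ρ * τ * (τ * A) := by positivity
    linarith
  have h10 : w ^ 2 * (τ * A + 3 / (8 * ρ) * S + τ * ρ ^ 2 / 8) ≤ w ^ 2 * (3 / 2 * ρ * τ ^ 2 * A) := by
    gcongr
  have h11 : 1 / 2 * τ ^ 2 * w ^ 2 * (2 * (ρ * A) + ρ * A)
      ≤ 1 / 2 * τ ^ 2 * w ^ 2 * (2 * Ha + ρ * A) := by gcongr
  have h12 : 1 / (2 * τ) * (y ^ 2 + (N - 2 * τ * w * P + τ ^ 2 * w ^ 2 * A))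
      ≤ ρ / 2 * y ^ 2 + ρ / 3 * N + τ * w ^ 2 * A := by linarith
  refine h12.trans ?_
  generalize 3 / (8 * ρ) = c at *
  linarith

end

section

/-! ### Smooth approximation -/

/-- Mollification. The radius lies below the moduli of uniform continuity of F and of its
derivative, and below the distance that keeps the support inside O. -/
theorem exists_smooth_approx {E : Type*} [NormedAddCommGroup E] [InnerProductSpace ℝ E]
    [FiniteDimensional ℝ E] [MeasurableSpace E] [BorelSpace E] {F : E → ℝ} {K O : Set E}
    (hF : ContDiff ℝ 1 F) (hK : IsCompact K) (hFK : ∀ y ∉ K, F y = 0) (hO : IsOpen O)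
    (hKO : K ⊆ O) {ε : ℝ} (hε : 0 < ε) :
    ∃ G : E → ℝ, ContDiff ℝ ∞ G ∧ (∀ y ∉ O, G y = 0) ∧
      ∀ y, |G y - F y| ≤ ε ∧ ‖fderiv ℝ G y - fderiv ℝ F y‖ ≤ ε := by
  have hFc : HasCompactSupport F := HasCompactSupport.intro hK hFK
  have hdc : HasCompactSupport (fderiv ℝ F) := hFc.fderiv ℝ
  have hd := hF.continuous_fderiv one_ne_zero
  obtain ⟨δ₁, hδ₁, h₁⟩ := Metric.uniformContinuous_iff.1
    (hFc.uniformContinuous_of_continuous hF.continuous) ε hε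
  obtain ⟨δ₂, hδ₂, h₂⟩ := Metric.uniformContinuous_iff.1
    (hdc.uniformContinuous_of_continuous hd) ε hε
  obtain ⟨δ₃, hδ₃, h₃⟩ := hK.exists_cthickening_subset_open hO hKO
  set δ := min δ₁ (min δ₂ δ₃) with hδ
  have hδ0 : 0 < δ := lt_min hδ₁ (lt_min hδ₂ hδ₃)
  let φ : ContDiffBump (0 : E) := ⟨δ / 2, δ, half_pos hδ0, half_lt_self hδ0⟩
  have hφl : LocallyIntegrable (φ.normed volume) (volume : Measure E) :=
    φ.continuous_normed.locallyIntegrable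
  set G := convolution (φ.normed volume) F (ContinuousLinearMap.lsmul ℝ ℝ) volume with hG
  have hGd : ∀ y, fderiv ℝ G y = convolution (φ.normed volume) (fderiv ℝ F)
      (ContinuousLinearMap.lsmul ℝ ℝ) volume y := by
    intro y
    have h := hFc.hasFDerivAt_convolution_right (ContinuousLinearMap.lsmul ℝ ℝ) hφl hF y
    rw [h.fderiv, convolution_def, convolution_def]
    rfl
  refine ⟨G, φ.hasCompactSupport_normed.contDiff_convolution_left _ φ.contDiff_normed
    hF.continuous.locallyIntegrable, fun y hy => ?_, fun y => ⟨?_, ?_⟩⟩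
  · by_contra hne
    have hs := support_convolution_subset (ContinuousLinearMap.lsmul ℝ ℝ)
      (Function.mem_support.2 hne)
    obtain ⟨a, ha, b, hb, rfl⟩ := hs
    rw [φ.support_normed_eq] at ha
    refine hy (h₃ ?_)
    have hbK : b ∈ K := by
      by_contra h
      exact hb (hFK b h)
    refine Metric.mem_cthickening_of_dist_le (a + b) b δ₃ K hbK ?_
    have ha' : ‖a‖ < δ := by simpa using ha
    rw [dist_eq_norm, add_sub_cancel_right]
    exact ha'.le.trans ((min_le_right _ _).trans (min_le_right _ _))
  · rw [← Real.dist_eq]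
    refine φ.dist_normed_convolution_le hF.continuous.aestronglyMeasurable fun x hx => ?_
    exact (h₁ ((Metric.mem_ball.1 hx).trans_le (min_le_left _ _))).le
  · rw [hGd, ← dist_eq_norm]
    refine φ.dist_normed_convolution_le hd.aestronglyMeasurable fun x hx => ?_
    exact (h₂ ((Metric.mem_ball.1 hx).trans_le ((min_le_right _ _).trans (min_le_left _ _)))).le

/-- `C¹`-approximability by smooth functions supported in the interior. -/
def SmoothlyApproximable (g : SmoothMetric n M) (f : M → ℝ) : Prop :=
  ∀ ε > 0, ∃ ψ : M → ℝ, ContMDiff (𝓡∂ n) 𝓘(ℝ) ∞ ψ ∧ tsupport ψ ⊆ (𝓡∂ n).interior M ∧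
    ∀ x, |ψ x - f x| ≤ ε ∧ gradInner g (fun z => ψ z - f z) (fun z => ψ z - f z) x ≤ ε ^ 2

theorem gradInner_add_self_le (g : SmoothMetric n M) {a b : M → ℝ} {x : M}
    (ha : MDifferentiableAt (𝓡∂ n) 𝓘(ℝ) a x) (hb : MDifferentiableAt (𝓡∂ n) 𝓘(ℝ) b x) :
    gradInner g (fun z => a z + b z) (fun z => a z + b z) x
      ≤ 2 * gradInner g a a x + 2 * gradInner g b b x := by
  have h0 := gradInner_self_nonneg g (fun z => a z - b z) x
  rw [gradInner_sub_left g _ ha hb, gradInner_comm g a, gradInner_comm g b,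
    gradInner_sub_left g _ ha hb, gradInner_sub_left g _ ha hb] at h0
  rw [gradInner_add_left g _ ha hb, gradInner_comm g a, gradInner_comm g b,
    gradInner_add_left g _ ha hb, gradInner_add_left g _ ha hb]
  linarith

theorem SmoothlyApproximable.add {g : SmoothMetric n M} {a b : M → ℝ}
    (ha : SmoothlyApproximable g a) (hb : SmoothlyApproximable g b)
    (ha1 : ContMDiff (𝓡∂ n) 𝓘(ℝ) 1 a) (hb1 : ContMDiff (𝓡∂ n) 𝓘(ℝ) 1 b) :
    SmoothlyApproximable g (fun x => a x + b x) := by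
  intro ε hε
  obtain ⟨ψ₁, h₁, s₁, e₁⟩ := ha (ε / 2) (half_pos hε)
  obtain ⟨ψ₂, h₂, s₂, e₂⟩ := hb (ε / 2) (half_pos hε)
  refine ⟨fun x => ψ₁ x + ψ₂ x, h₁.add h₂,
    (tsupport_add ψ₁ ψ₂).trans (union_subset s₁ s₂), fun x => ⟨?_, ?_⟩⟩
  · have h3 := (e₁ x).1
    have h4 := (e₂ x).1
    calc |ψ₁ x + ψ₂ x - (a x + b x)| = |(ψ₁ x - a x) + (ψ₂ x - b x)| := by congr 1; ring
      _ ≤ |ψ₁ x - a x| + |ψ₂ x - b x| := abs_add_le _ _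
      _ ≤ ε := by linarith
  · have hd : ∀ {ψ a : M → ℝ}, ContMDiff (𝓡∂ n) 𝓘(ℝ) ∞ ψ → ContMDiff (𝓡∂ n) 𝓘(ℝ) 1 a →
        MDifferentiableAt (𝓡∂ n) 𝓘(ℝ) (fun x => ψ x - a x) x := fun hψ ha =>
      ((hψ.of_le (by exact_mod_cast le_top)).sub ha).mdifferentiableAt one_ne_zero
    have h := gradInner_add_self_le g (hd h₁ ha1) (hd h₂ hb1)
    have h3 := (e₁ x).2
    have h4 := (e₂ x).2
    have h5 : (fun z => ψ₁ z - a z + (ψ₂ z - b z)) = fun z => ψ₁ z + ψ₂ z - (a z + b z) := by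
      ext z; ring
    rw [h5] at h
    linarith

theorem SmoothlyApproximable.sum {ι : Type*} {g : SmoothMetric n M} (s : Finset ι) {f : ι → M → ℝ}
    (h : ∀ i, SmoothlyApproximable g (f i)) (hf : ∀ i, ContMDiff (𝓡∂ n) 𝓘(ℝ) 1 (f i)) :
    SmoothlyApproximable g (fun x => ∑ i ∈ s, f i x) := by
  classical
  induction s using Finset.induction_on with
  | empty =>
    intro ε hε
    refine ⟨fun _ => 0, contMDiff_const, ?_, fun x => ⟨by simpa using hε.le, ?_⟩⟩
    · have : tsupport (fun _ : M => (0 : ℝ)) = ∅ := tsupport_eq_empty_iff.2 rfl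
      rw [this]; exact empty_subset _
    · have h0 : gradInner g (fun _ : M => (0 : ℝ)) (fun _ => 0) x = 0 := by
        rw [gradInner_eq_mvfderiv]
        exact DFunLike.congr_fun (mvfderiv_const (0 : ℝ)) _
      simp only [Finset.sum_empty, sub_zero, h0]
      positivity
  | insert i s hi ih =>
    simp only [Finset.sum_insert hi]
    exact (h i).add ih (hf i) (contMDiff_finsetSum fun i _ => hf i)

omit [IsManifold (𝓡∂ n) ∞ M] in
theorem partialDeriv_eq_fderiv {p : M} {F : 𝔼 → ℝ} {y : 𝔼}
    (hy : y ∈ interior (extChartAt (𝓡∂ n) p).target) (i : Fin n) :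
    partialDeriv i F y = fderiv ℝ F y (EuclideanSpace.single i 1) := by
  rw [partialDeriv_eq_target (interior_subset hy),
    fderivWithin_of_mem_nhds (mem_interior_iff_mem_nhds.1 hy)]

/-- On a compact part of a chart the Riemannian norm of a gradient is controlled by the Euclidean
one, so Euclidean C¹ approximation suffices. -/
theorem exists_gradInner_le (g : SmoothMetric n M) {p : M} {K : Set 𝔼} (hK : IsCompact K)
    (hKt : K ⊆ interior (extChartAt (𝓡∂ n) p).target) :
    ∃ C : ℝ, 0 ≤ C ∧ ∀ (f : M → ℝ), ContMDiff (𝓡∂ n) 𝓘(ℝ) 1 f → ∀ y ∈ K,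
      chartRep p (gradInner g f f) y ≤ C * ‖fderiv ℝ (chartRep p f) y‖ ^ 2 := by
  have hc : ContinuousOn (fun y => ∑ i, ∑ j, |(metricMatrix g p y)⁻¹ i j|) K := by
    refine continuousOn_finsetSum _ fun i _ => continuousOn_finsetSum _ fun j _ => ?_
    exact ((contDiffOn_metricMatrix_inv g p i j).continuousOn.mono
      (hKt.trans interior_subset)).abs
  obtain ⟨C, hC⟩ := hK.bddAbove_image hc
  refine ⟨max C 0, le_max_right _ _, fun f hf y hy => ?_⟩
  have hy' := hKt hy
  rw [gradInner_eq_sum g (interior_subset hy') (hf.mdifferentiableAt one_ne_zero)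
    (hf.mdifferentiableAt one_ne_zero)]
  have hp : ∀ i, |partialDeriv i (chartRep p f) y| ≤ ‖fderiv ℝ (chartRep p f) y‖ := by
    intro i
    rw [partialDeriv_eq_fderiv hy', ← Real.norm_eq_abs]
    refine (ContinuousLinearMap.le_opNorm _ _).trans ?_
    simp
  calc ∑ i, ∑ j, (metricMatrix g p y)⁻¹ i j * partialDeriv i (chartRep p f) y
          * partialDeriv j (chartRep p f) y
      ≤ ∑ i, ∑ j, |(metricMatrix g p y)⁻¹ i j| * ‖fderiv ℝ (chartRep p f) y‖ ^ 2 := by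
        refine Finset.sum_le_sum fun i _ => Finset.sum_le_sum fun j _ => ?_
        refine (le_abs_self _).trans ?_
        rw [abs_mul, abs_mul, sq, mul_assoc]
        gcongr
        · exact hp i
        · exact hp j
    _ = (∑ i, ∑ j, |(metricMatrix g p y)⁻¹ i j|) * ‖fderiv ℝ (chartRep p f) y‖ ^ 2 := by
        simp only [Finset.sum_mul]
    _ ≤ _ := by
        gcongr
        exact (hC (mem_image_of_mem _ hy)).trans (le_max_left _ _)

omit [IsManifold (𝓡∂ n) ∞ M] in
theorem mem_interior_target_iff_source {p x : M} (hx : x ∈ (extChartAt (𝓡∂ n) p).source)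
    [IsManifold (𝓡∂ n) ∞ M] :
    extChartAt (𝓡∂ n) p x ∈ interior (extChartAt (𝓡∂ n) p).target ↔ x ∈ (𝓡∂ n).interior M := by
  have hy := (extChartAt (𝓡∂ n) p).map_source hx
  rw [mem_interior_target_iff hy, ← (𝓡∂ n).compl_boundary, mem_compl_iff, mem_boundary_iff hx]
  exact ⟨fun h => h.ne', fun h => lt_of_le_of_ne (nonneg_of_mem_target hy) (Ne.symm h)⟩

theorem smoothlyApproximable_of_chart [CompactSpace M] [T2Space M] (g : SmoothMetric n M) {p : M}
    {f : M → ℝ} (hf : ContMDiff (𝓡∂ n) 𝓘(ℝ) 1 f)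
    (hfp : tsupport f ⊆ (extChartAt (𝓡∂ n) p).source) (hfi : tsupport f ⊆ (𝓡∂ n).interior M) :
    SmoothlyApproximable g f := by
  intro ε hε
  set t := (extChartAt (𝓡∂ n) p).target with ht
  set K : Set 𝔼 := extChartAt (𝓡∂ n) p '' tsupport f with hKdef
  have hK : IsCompact K := (isClosed_tsupport f).isCompact.image_of_continuousOn
    ((continuousOn_extChartAt p).mono hfp)
  have hKt : K ⊆ interior t := by
    rintro _ ⟨x, hx, rfl⟩
    exact (mem_interior_target_iff_source (hfp hx)).2 (hfi hx)
  have hfK : ∀ y ∈ t, y ∉ K → chartRep p f y = 0 := fun y hy hyK =>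
    image_eq_zero_of_notMem_tsupport (f := f) fun h => hyK ⟨_, h, (extChartAt (𝓡∂ n) p).right_inv hy⟩
  -- The compact K' leaves room for the support to grow under mollification while staying in the
  -- interior of the target.
  obtain ⟨K', hK', hKK', hK't⟩ := exists_compact_between hK isOpen_interior hKt
  obtain ⟨C, hC0, hC⟩ := exists_gradInner_le g hK' hK't
  set F : 𝔼 → ℝ := t.indicator (chartRep p f) with hF
  have hFK : ∀ y ∉ K, F y = 0 := fun y hy => by
    by_cases hyt : y ∈ t
    · rw [hF, indicator_of_mem hyt, hfK y hyt hy]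
    · exact indicator_of_notMem hyt _
  have hFt : ∀ y ∈ interior t, F =ᶠ[nhds y] chartRep p f := fun y hy => by
    filter_upwards [mem_interior_iff_mem_nhds.1 hy] with z hz using indicator_of_mem hz _
  have hF1 : ContDiff ℝ 1 F := by
    rw [contDiff_iff_contDiffAt]
    intro y
    by_cases hy : y ∈ K
    · exact ((contDiffOn_chartRep (k := 1) p hf).contDiffAt
        (mem_interior_iff_mem_nhds.1 (hKt hy))).congr_of_eventuallyEq (hFt y (hKt hy))
    · refine (contDiffAt_const (c := (0 : ℝ))).congr_of_eventuallyEq ?_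
      filter_upwards [hK.isClosed.isOpen_compl.mem_nhds hy] with z hz using hFK z hz
  have hε' : 0 < ε / (C + 1) := by positivity
  -- With this tolerance δ one has Cδ² ≤ Cε²/(C+1) ≤ ε², as the gradient estimate requires.
  obtain ⟨G, hG, hGO, hGF⟩ := exists_smooth_approx hF1 hK hFK isOpen_interior hKK' (ε := min ε (ε / (C + 1)))
    (lt_min hε hε')
  have hG0 : ∀ y ∈ t, y ∉ K' → G y = 0 := fun y _ hy => hGO y fun h => hy (interior_subset h)
  have hK't' := hK't.trans interior_subset
  have hψ : ContMDiff (𝓡∂ n) 𝓘(ℝ) ∞ (pullback p G) :=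
    contMDiff_pullback (k := ⊤) hK' hK't' hG0 hG.contDiffOn
  have hψ1 : ContMDiff (𝓡∂ n) 𝓘(ℝ) 1 (pullback p G) := hψ.of_le (by exact_mod_cast le_top)
  have hsupp := tsupport_pullback_subset (p := p) hK' hK't' hG0
  have hfc : ∀ x, f x = pullback p F x := fun x => by
    by_cases hx : x ∈ (extChartAt (𝓡∂ n) p).source
    · rw [pullback_of_mem _ hx, hF, indicator_of_mem ((extChartAt (𝓡∂ n) p).map_source hx),
        chartRep, (extChartAt (𝓡∂ n) p).left_inv hx]
    · rw [pullback_of_notMem _ hx, image_eq_zero_of_notMem_tsupport fun h => hx (hfp h)]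
  refine ⟨pullback p G, hψ, fun x hx => ?_, fun x => ⟨?_, ?_⟩⟩
  · obtain ⟨y, hy, rfl⟩ := hsupp hx
    rw [← mem_interior_target_iff_source ((extChartAt (𝓡∂ n) p).map_target (hK't' hy)),
      (extChartAt (𝓡∂ n) p).right_inv (hK't' hy)]
    exact hK't hy
  · rw [hfc]
    by_cases hx : x ∈ (extChartAt (𝓡∂ n) p).source
    · rw [pullback_of_mem _ hx, pullback_of_mem _ hx]
      exact (hGF _).1.trans (min_le_left _ _)
    · rw [pullback_of_notMem _ hx, pullback_of_notMem _ hx, sub_zero, abs_zero]; exact hε.le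
  · set d : M → ℝ := fun z => pullback p G z - f z with hd
    have hd1 : ContMDiff (𝓡∂ n) 𝓘(ℝ) 1 d := hψ1.sub hf
    by_cases hx : x ∈ tsupport d
    · have hx' : x ∈ (extChartAt (𝓡∂ n) p).symm '' K' := by
        have h1 : tsupport d ⊆ tsupport (pullback p G) ∪ tsupport f := tsupport_sub _ _
        rcases h1 hx with h | h
        · exact hsupp h
        · exact ⟨_, interior_subset (hKK' (mem_image_of_mem _ h)),
            (extChartAt (𝓡∂ n) p).left_inv (hfp h)⟩
      obtain ⟨y, hy, rfl⟩ := hx'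
      have hdF : chartRep p d =ᶠ[nhds y] fun z => G z - F z := by
        filter_upwards [mem_interior_iff_mem_nhds.1 (hK't hy)] with z hz
        have h1 := chartRep_pullback G hz
        have h2 : F z = chartRep p f z := indicator_of_mem hz _
        rw [h2, ← h1]
        rfl
      refine (hC d hd1 y hy).trans ?_
      rw [hdF.fderiv_eq, fderiv_fun_sub (hG.differentiable (by simp) y)
        (hF1.differentiable one_ne_zero y)]
      have h3 := (hGF y).2
      have h4 : ‖fderiv ℝ G y - fderiv ℝ F y‖ ^ 2 ≤ min ε (ε / (C + 1)) * min ε (ε / (C + 1)) := by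
        rw [sq]; gcongr
      calc C * ‖fderiv ℝ G y - fderiv ℝ F y‖ ^ 2 ≤ C * (ε * (ε / (C + 1))) := by
            gcongr
            refine h4.trans (mul_le_mul (min_le_left _ _) (min_le_right _ _) (by positivity) hε.le)
        _ = ε ^ 2 * (C / (C + 1)) := by ring
        _ ≤ ε ^ 2 * 1 := by
            gcongr
            rw [div_le_one (by positivity)]; linarith
        _ = ε ^ 2 := mul_one _
    · rw [gradInner_eq_zero_of_notMem_tsupport g _ hx]; positivity

theorem smoothlyApproximable [CompactSpace M] [T2Space M] (g : SmoothMetric n M)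
    {f : M → ℝ} (hf : ContMDiff (𝓡∂ n) 𝓘(ℝ) 1 f) (hfi : tsupport f ⊆ (𝓡∂ n).interior M) :
    SmoothlyApproximable g f := by
  obtain ⟨s, χ, hχ, hs, -, h1⟩ := exists_partitionOfUnity n M
  have hf1 : ∀ p, ContMDiff (𝓡∂ n) 𝓘(ℝ) 1 fun x => χ p x * f x := fun p =>
    ((hχ p).of_le (by exact_mod_cast le_top)).mul hf
  have hsum : f = fun x => ∑ p ∈ s, χ p x * f x := by
    ext x
    simp only [← Finset.sum_mul, h1, one_mul]
  rw [hsum]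
  refine SmoothlyApproximable.sum s (fun p => smoothlyApproximable_of_chart g (hf1 p) (p := p)
    ?_ ?_) hf1
  · exact (closure_mono fun x (hx : χ p x * f x ≠ 0) => left_ne_zero_of_mul hx).trans (hs p)
  · exact (closure_mono fun x (hx : χ p x * f x ≠ 0) => right_ne_zero_of_mul hx).trans hfi

end

section

/-! ### Friedrichs' inequality for functions which vanish on the boundary -/

/-- The derivative of the truncation function. -/
def truncDeriv (ε σ : ℝ) : ℝ := max 0 ((σ ^ 2 - ε ^ 2) / (σ ^ 2 + ε ^ 2))

/-- A `C¹` truncation of the identity which vanishes near zero. -/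
def trunc (ε s : ℝ) : ℝ := ∫ σ in (0 : ℝ)..s, truncDeriv ε σ

theorem continuous_truncDeriv {ε : ℝ} (hε : 0 < ε) : Continuous (truncDeriv ε) := by
  refine continuous_const.max (Continuous.div (by fun_prop) (by fun_prop) fun σ => ?_)
  positivity

theorem hasDerivAt_trunc {ε : ℝ} (hε : 0 < ε) (s : ℝ) : HasDerivAt (trunc ε) (truncDeriv ε s) s :=
  intervalIntegral.integral_hasDerivAt_right
    ((continuous_truncDeriv hε).intervalIntegrable _ _)
    ((continuous_truncDeriv hε).stronglyMeasurableAtFilter _ _)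
    (continuous_truncDeriv hε).continuousAt

theorem contDiff_trunc {ε : ℝ} (hε : 0 < ε) : ContDiff ℝ 1 (trunc ε) := by
  rw [contDiff_one_iff_deriv]
  refine ⟨fun s => (hasDerivAt_trunc hε s).differentiableAt, ?_⟩
  have : deriv (trunc ε) = truncDeriv ε := funext fun s => (hasDerivAt_trunc hε s).deriv
  rw [this]; exact continuous_truncDeriv hε

theorem truncDeriv_nonneg (ε σ : ℝ) : 0 ≤ truncDeriv ε σ := le_max_left _ _

theorem truncDeriv_le_one {ε : ℝ} (hε : 0 < ε) (σ : ℝ) : truncDeriv ε σ ≤ 1 := by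
  refine max_le zero_le_one ((div_le_one (by positivity)).2 ?_)
  nlinarith [sq_nonneg ε]

theorem trunc_zero (ε : ℝ) : trunc ε 0 = 0 := intervalIntegral.integral_same

theorem trunc_eq_zero {ε s : ℝ} (hs : |s| ≤ ε) : trunc ε s = 0 := by
  refine intervalIntegral.integral_zero_ae (Filter.Eventually.of_forall fun σ hσ => ?_)
  have h1 : |σ| ≤ |s| := by
    rcases le_total 0 s with h | h
    · rw [uIoc_of_le h] at hσ
      rw [abs_of_nonneg hσ.1.le, abs_of_nonneg h]; exact hσ.2
    · rw [uIoc_of_ge h] at hσ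
      rw [abs_of_nonpos hσ.2, abs_of_nonpos h]; linarith [hσ.1]
  have h2 : σ ^ 2 ≤ ε ^ 2 := sq_le_sq' (by linarith [neg_abs_le σ]) (by linarith [le_abs_self σ])
  exact max_eq_left (div_nonpos_of_nonpos_of_nonneg (by linarith) (by positivity))

theorem abs_le_abs_trunc_add {ε : ℝ} (hε : 0 < ε) (s : ℝ) :
    |s| ≤ |trunc ε s| + Real.pi * ε := by
  -- The derivative of the truncation falls short of 1 by at most 2ε²/(s²+ε²), the derivative of 2ε
  -- arctan(s/ε). The accumulated defect is therefore at most πε.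
  set f : ℝ → ℝ := fun s => trunc ε s - s + 2 * ε * Real.arctan (s / ε) with hf
  have hd : ∀ s, HasDerivAt f (truncDeriv ε s - 1
      + 2 * ε * (1 / (1 + (s / ε) ^ 2) * (1 / ε))) s := fun s =>
    ((hasDerivAt_trunc hε s).sub (hasDerivAt_id s)).add
      ((((hasDerivAt_id s).div_const ε).arctan).const_mul (2 * ε))
  have hmono : Monotone f := by
    refine monotone_of_hasDerivAt_nonneg hd fun s => ?_
    have h1 : (s ^ 2 - ε ^ 2) / (s ^ 2 + ε ^ 2) ≤ truncDeriv ε s := le_max_right _ _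
    have h2 : 2 * ε * (1 / (1 + (s / ε) ^ 2) * (1 / ε)) = 2 * ε ^ 2 / (s ^ 2 + ε ^ 2) := by
      have : s ^ 2 + ε ^ 2 ≠ 0 := by positivity
      have : ε ^ 2 + s ^ 2 ≠ 0 := by positivity
      field_simp
      ring
    have h3 : (s ^ 2 - ε ^ 2) / (s ^ 2 + ε ^ 2) - 1 + 2 * ε ^ 2 / (s ^ 2 + ε ^ 2) = 0 := by
      have : s ^ 2 + ε ^ 2 ≠ 0 := by positivity
      field_simp
      ring
    simp only [Pi.zero_apply]
    rw [h2]; linarith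
  have hf0 : f 0 = 0 := by simp [hf, trunc_zero]
  have ha1 := Real.arctan_lt_pi_div_two (s / ε)
  have ha2 := Real.neg_pi_div_two_lt_arctan (s / ε)
  rcases le_total 0 s with h | h
  · have h1 := hmono h
    rw [hf0] at h1
    simp only [hf] at h1
    rw [abs_of_nonneg h]
    nlinarith [le_abs_self (trunc ε s)]
  · have h1 := hmono h
    rw [hf0] at h1
    simp only [hf] at h1
    rw [abs_of_nonpos h]
    nlinarith [neg_abs_le (trunc ε s)]

theorem sq_le_trunc_sq_add {ε : ℝ} (hε : 0 < ε) (s : ℝ) :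
    s ^ 2 ≤ trunc ε s ^ 2 + 2 * (Real.pi * ε) * |s| := by
  have h := abs_le_abs_trunc_add hε s
  have hp : 0 < Real.pi * ε := mul_pos Real.pi_pos hε
  rw [← sq_abs s, ← sq_abs (trunc ε s)]
  rcases le_total |s| (Real.pi * ε) with h1 | h1
  · nlinarith [abs_nonneg s, sq_nonneg |trunc ε s|]
  · nlinarith [abs_nonneg s, abs_nonneg (trunc ε s)]

/-- Restricting to ε ≤ 1 allows errors of order ε² to be counted as multiples of ε. -/
theorem le_of_forall_le_add_mul {a b c : ℝ} (h : ∀ ε, 0 < ε → ε ≤ 1 → a ≤ b + c * ε) : a ≤ b := by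
  by_contra! hab
  have hc : 0 < |c| + 1 := by positivity
  set ε := min 1 ((a - b) / (2 * (|c| + 1))) with hε
  have hε0 : 0 < ε := lt_min one_pos (div_pos (by linarith) (by positivity))
  have h1 := h ε hε0 (min_le_left _ _)
  have h2 : ε ≤ (a - b) / (2 * (|c| + 1)) := min_le_right _ _
  rw [le_div_iff₀ (by positivity)] at h2
  nlinarith [le_abs_self c]

variable [MeasurableSpace M] [BorelSpace M] [CompactSpace M] [T2Space M]

omit [T2Space M] in
theorem integral_weightedVolume_mono (g : SmoothMetric n M) {μ : M → ℝ} (hμ : Continuous μ)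
    {F G : M → ℝ} (hF : Continuous F) (hG : Continuous G) (h : ∀ x, F x ≤ G x) :
    ∫ x, F x ∂(weightedVolume g μ) ≤ ∫ x, G x ∂(weightedVolume g μ) :=
  integral_mono (integrable_weightedVolume g hμ hF) (integrable_weightedVolume g hμ hG) h

omit [T2Space M] in
theorem integral_weightedVolume_add_const (g : SmoothMetric n M) {μ : M → ℝ} (hμ : Continuous μ)
    {F : M → ℝ} (hF : Continuous F) (c : ℝ) :
    ∫ x, (F x + c) ∂(weightedVolume g μ)
      = ∫ x, F x ∂(weightedVolume g μ) + c * (weightedVolume g μ).real univ := by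
  have := isFiniteMeasure_weightedVolume g hμ
  rw [integral_add (integrable_weightedVolume g hμ hF) (integrable_const _), integral_const,
    smul_eq_mul, mul_comm c]

theorem friedrichs_of_tsupport {g : SmoothMetric n M} {μ : M → ℝ} (hμ : Continuous μ) {C : ℝ}
    (hC : 0 ≤ C) (hF : FriedrichsConst g μ C) {f : M → ℝ} (hf : ContMDiff (𝓡∂ n) 𝓘(ℝ) 1 f)
    (hfi : tsupport f ⊆ (𝓡∂ n).interior M) :
    ∫ x, f x ^ 2 ∂(weightedVolume g μ) ≤ C * ∫ x, gradInner g f f x ∂(weightedVolume g μ) := by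
  obtain ⟨L, hL⟩ := isCompact_univ.bddAbove_image (f := fun x => |f x|)
    hf.continuous.abs.continuousOn
  obtain ⟨D, hD⟩ := isCompact_univ.bddAbove_image (f := gradInner g f f)
    (continuous_gradInner g hf hf).continuousOn
  have hL' : ∀ x, |f x| ≤ L := fun x => hL (mem_image_of_mem _ (mem_univ x))
  have hD' : ∀ x, gradInner g f f x ≤ D := fun x => hD (mem_image_of_mem _ (mem_univ x))
  set V := (weightedVolume g μ).real univ with hV
  -- Replacing f² by the square of its approximation costs 2Lε pointwise, and replacing |∇ψ|² by
  -- |∇f|² costs (D+2)ε; both are integrated over total mass V.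
  refine le_of_forall_le_add_mul (c := (2 * L + C * (D + 2)) * V) fun ε hε hε1 => ?_
  obtain ⟨ψ, hψ, hs, he⟩ := smoothlyApproximable g hf hfi ε hε
  have hψ1 : ContMDiff (𝓡∂ n) 𝓘(ℝ) 1 ψ := hψ.of_le (by exact_mod_cast le_top)
  have h1 := hF ψ hψ (HasCompactSupport.of_compactSpace ψ) hs
  simp only [gnorm_gradient_sq] at h1
  have h2 : ∀ x, f x ^ 2 ≤ ψ x ^ 2 + 2 * L * ε := fun x => by
    have h3 := abs_le.1 (he x).1
    have h4 := abs_le.1 (hL' x)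
    nlinarith [abs_nonneg (f x), hL' x, sq_nonneg (ψ x - f x),
      mul_le_mul (hL' x) (he x).1 (abs_nonneg _) ((abs_nonneg _).trans (hL' x)),
      neg_abs_le (f x * (ψ x - f x)), abs_mul (f x) (ψ x - f x)]
  have h3 : ∀ x, gradInner g ψ ψ x ≤ gradInner g f f x + (D + 2) * ε := fun x => by
    have hd : ContMDiff (𝓡∂ n) 𝓘(ℝ) 1 fun z => ψ z - f z := hψ1.sub hf
    have ha : MDifferentiableAt (𝓡∂ n) 𝓘(ℝ) f x := hf.mdifferentiableAt one_ne_zero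
    have hb : MDifferentiableAt (𝓡∂ n) 𝓘(ℝ) (fun z => ψ z - f z) x :=
      hd.mdifferentiableAt one_ne_zero
    have h4 : ψ = fun z => f z + (ψ z - f z) := by ext z; ring
    have h5 : gradInner g ψ ψ x = gradInner g f f x + 2 * gradInner g f (fun z => ψ z - f z) x
        + gradInner g (fun z => ψ z - f z) (fun z => ψ z - f z) x := by
      conv_lhs => rw [h4]
      rw [gradInner_add_left g _ ha hb, gradInner_comm g f, gradInner_comm g (fun z => ψ z - f z),
        gradInner_add_left g _ ha hb, gradInner_add_left g _ ha hb,
        gradInner_comm g (fun z => ψ z - f z) f]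
      ring
    have h6 := gradInner_sq_le g f (fun z => ψ z - f z) x
    have h7 := (he x).2
    have h0 := gradInner_self_nonneg g f x
    -- Cauchy–Schwarz bounds the cross term by 2N^{1/2}ε with N = |∇f|², and 2N^{1/2} ≤ N + 1.
    have h8 : 2 * gradInner g f (fun z => ψ z - f z) x ≤ (gradInner g f f x + 1) * ε := by
      have h9 : (2 * gradInner g f (fun z => ψ z - f z) x) ^ 2
          ≤ ((gradInner g f f x + 1) * ε) ^ 2 := by
        have h10 : gradInner g f f x * gradInner g (fun z => ψ z - f z) (fun z => ψ z - f z) x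
          ≤ gradInner g f f x * ε ^ 2 := by gcongr
        nlinarith [mul_nonneg (sq_nonneg (gradInner g f f x - 1)) (sq_nonneg ε)]
      exact (abs_le.1 (abs_le_of_sq_le_sq h9 (by positivity))).2
    have h11 := hD' x
    rw [h5]
    nlinarith
  have hfc := hf.continuous
  have hgc := continuous_gradInner g hf hf
  calc ∫ x, f x ^ 2 ∂(weightedVolume g μ)
      ≤ ∫ x, (ψ x ^ 2 + 2 * L * ε) ∂(weightedVolume g μ) :=
        integral_weightedVolume_mono g hμ (hfc.pow 2)
          ((hψ.continuous.pow 2).add continuous_const) h2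
    _ = ∫ x, ψ x ^ 2 ∂(weightedVolume g μ) + 2 * L * ε * V :=
        integral_weightedVolume_add_const g hμ (hψ.continuous.pow 2) _
    _ ≤ C * ∫ x, gradInner g ψ ψ x ∂(weightedVolume g μ) + 2 * L * ε * V := by gcongr
    _ ≤ C * ∫ x, (gradInner g f f x + (D + 2) * ε) ∂(weightedVolume g μ) + 2 * L * ε * V := by
        gcongr ?_ + _
        refine mul_le_mul_of_nonneg_left ?_ hC
        exact integral_weightedVolume_mono g hμ (continuous_gradInner g hψ1 hψ1)
          (hgc.add continuous_const) h3
    _ = _ := by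
        rw [integral_weightedVolume_add_const g hμ hgc]
        ring

/-- Friedrichs' inequality for `C¹` functions which vanish on the boundary. -/
theorem friedrichs_of_boundary {g : SmoothMetric n M} {μ : M → ℝ} (hμ : Continuous μ) {C : ℝ}
    (hC : 0 ≤ C) (hF : FriedrichsConst g μ C) {u : M → ℝ} (hu : ContMDiff (𝓡∂ n) 𝓘(ℝ) 1 u)
    (h0 : ∀ x ∈ (𝓡∂ n).boundary M, u x = 0) :
    ∫ x, u x ^ 2 ∂(weightedVolume g μ) ≤ C * ∫ x, gradInner g u u x ∂(weightedVolume g μ) := by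
  obtain ⟨L, hL⟩ := isCompact_univ.bddAbove_image (f := fun x => |u x|)
    hu.continuous.abs.continuousOn
  have hL' : ∀ x, |u x| ≤ L := fun x => hL (mem_image_of_mem _ (mem_univ x))
  set V := (weightedVolume g μ).real univ with hV
  refine le_of_forall_le_add_mul (c := 2 * Real.pi * L * V) fun ε hε _ => ?_
  have hφ : ContMDiff (𝓡∂ n) 𝓘(ℝ) 1 fun x => trunc ε (u x) := (contDiff_trunc hε).contMDiff.comp hu
  -- The truncation vanishes where |u| ≤ ε, so its support lies in the closed set {|u| ≥ ε}, which
  -- misses the boundary.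
  have hsupp : tsupport (fun x => trunc ε (u x)) ⊆ (𝓡∂ n).interior M := by
    have h1 : tsupport (fun x => trunc ε (u x)) ⊆ {x | ε ≤ |u x|} := by
      refine closure_minimal (fun x hx => ?_) (isClosed_le continuous_const hu.continuous.abs)
      by_contra h
      exact hx (trunc_eq_zero (not_le.1 h).le)
    intro x hx
    rw [← (𝓡∂ n).compl_boundary]
    intro hb
    have h2 : ε ≤ |u x| := h1 hx
    rw [h0 x hb, abs_zero] at h2
    linarith
  have h1 := friedrichs_of_tsupport hμ hC hF hφ hsupp
  calc ∫ x, u x ^ 2 ∂(weightedVolume g μ)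
      ≤ ∫ x, (trunc ε (u x) ^ 2 + 2 * (Real.pi * ε) * L) ∂(weightedVolume g μ) := by
        refine integral_weightedVolume_mono g hμ (hu.continuous.pow 2)
          ((hφ.continuous.pow 2).add continuous_const) fun x => ?_
        refine (sq_le_trunc_sq_add hε (u x)).trans ?_
        have := Real.pi_pos
        gcongr
        exact hL' x
    _ = ∫ x, trunc ε (u x) ^ 2 ∂(weightedVolume g μ) + 2 * (Real.pi * ε) * L * V :=
        integral_weightedVolume_add_const g hμ (hφ.continuous.pow 2) _
    _ ≤ C * ∫ x, gradInner g (fun x => trunc ε (u x)) (fun x => trunc ε (u x)) x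
          ∂(weightedVolume g μ) + 2 * (Real.pi * ε) * L * V := by gcongr
    _ ≤ C * ∫ x, gradInner g u u x ∂(weightedVolume g μ) + 2 * (Real.pi * ε) * L * V := by
        gcongr ?_ + _
        refine mul_le_mul_of_nonneg_left ?_ hC
        refine integral_weightedVolume_mono g hμ (continuous_gradInner g hφ hφ)
          (continuous_gradInner g hu hu) fun x => ?_
        have hux : MDifferentiableAt (𝓡∂ n) 𝓘(ℝ) u x := hu.mdifferentiableAt one_ne_zero
        rw [gradInner_comp_left g _ (hasDerivAt_trunc hε _) hux, gradInner_comm g u,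
          gradInner_comp_left g _ (hasDerivAt_trunc hε _) hux, ← mul_assoc]
        refine mul_le_of_le_one_left (gradInner_self_nonneg g u x) ?_
        -- The truncation has slope in [0,1], so it does not increase the Dirichlet integral.
        exact mul_le_one₀ (truncDeriv_le_one hε _) (truncDeriv_nonneg _ _) (truncDeriv_le_one hε _)
    _ = _ := by ring

end

section

/-! ### Time-dependent functions -/

/-- The representation of a time-dependent function in the chart at `p`. -/
def timeRep (p : M) (f : ℝ → M → ℝ) (q : ℝ × 𝔼) : ℝ := chartRep p (f q.1) q.2

/-- The domain of the representation in the chart at `p` of a function on `[0, T] × M`. -/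
def timeTarget (T : ℝ) (p : M) : Set (ℝ × 𝔼) := Icc 0 T ×ˢ (extChartAt (𝓡∂ n) p).target

/-- Functions of class `C^k` on `[0, T] × M`. -/
def TimeSmooth (n : ℕ) [NeZero n] {M : Type*} [TopologicalSpace M]
    [ChartedSpace (EuclideanHalfSpace n) M] (k : WithTop ℕ∞) (T : ℝ) (f : ℝ → M → ℝ) : Prop :=
  ∀ p : M, ContDiffOn ℝ k (timeRep (n := n) p f) (timeTarget (n := n) T p)

/-- The time derivative of a function on `[0, T] × M`. -/
def timeDeriv (T : ℝ) (f : ℝ → M → ℝ) (t : ℝ) (x : M) : ℝ :=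
  derivWithin (fun s => f s x) (Icc 0 T) t

theorem timeSmooth_of_contMDiffOn {T : ℝ} {f : ℝ → M → ℝ} {k : ℕ∞}
    (hf : ContMDiffOn (𝓘(ℝ).prod (𝓡∂ n)) 𝓘(ℝ) k (fun q : ℝ × M => f q.1 q.2)
      (Icc 0 T ×ˢ univ)) : TimeSmooth n k T f := by
  intro p
  rw [← contMDiffOn_iff_contDiffOn]
  have h1 : ContMDiffOn 𝓘(ℝ, ℝ × 𝔼) 𝓘(ℝ) k (fun q : ℝ × 𝔼 => q.1) (timeTarget T p) :=
    contDiff_fst.contMDiff.contMDiffOn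
  have h2 : ContMDiffOn 𝓘(ℝ, ℝ × 𝔼) 𝓘(ℝ, 𝔼) k (fun q : ℝ × 𝔼 => q.2) (timeTarget T p) :=
    contDiff_snd.contMDiff.contMDiffOn
  have h3 : ContMDiffOn 𝓘(ℝ, 𝔼) (𝓡∂ n) k (extChartAt (𝓡∂ n) p).symm
      (extChartAt (𝓡∂ n) p).target :=
    (contMDiffOn_extChartAt_symm (n := ∞) p).of_le (by exact_mod_cast le_top)
  have h4 := h1.prodMk (h3.comp h2 fun q hq => hq.2)
  exact hf.comp h4 fun q hq => ⟨hq.1, mem_univ _⟩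

section Basic

variable {T : ℝ} {f h : ℝ → M → ℝ} {k m : WithTop ℕ∞}

omit [IsManifold (𝓡∂ n) ∞ M]

theorem TimeSmooth.of_le (hf : TimeSmooth n k T f) (hmk : m ≤ k) : TimeSmooth n m T f :=
  fun p => (hf p).of_le hmk

theorem TimeSmooth.add (hf : TimeSmooth n k T f) (hh : TimeSmooth n k T h) :
    TimeSmooth n k T fun t x => f t x + h t x := fun p => (hf p).add (hh p)

theorem TimeSmooth.mul (hf : TimeSmooth n k T f) (hh : TimeSmooth n k T h) :
    TimeSmooth n k T fun t x => f t x * h t x := fun p => (hf p).mul (hh p)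

theorem uniqueDiffOn_timeTarget (hT : 0 < T) (p : M) :
    UniqueDiffOn ℝ (timeTarget (n := n) T p) :=
  (uniqueDiffOn_Icc hT).prod (uniqueDiffOn_extChartAt_target p)

theorem timeRep_timeDeriv (hT : 0 < T) (hf : TimeSmooth n k T f) (hk : k ≠ 0) {p : M} {t : ℝ} {y : 𝔼}
    (ht : t ∈ Icc 0 T) (hy : y ∈ (extChartAt (𝓡∂ n) p).target) :
    HasDerivWithinAt (fun s => timeRep p f (s, y))
        (fderivWithin ℝ (timeRep p f) (timeTarget T p) (t, y) (1, 0)) (Icc 0 T) t ∧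
      timeRep p (timeDeriv T f) (t, y)
        = fderivWithin ℝ (timeRep p f) (timeTarget T p) (t, y) (1, 0) := by
  have h1 := ((hf p).differentiableOn hk (t, y) ⟨ht, hy⟩).hasFDerivWithinAt
  have h2 : HasDerivWithinAt (fun s : ℝ => (s, y)) ((1 : ℝ), (0 : 𝔼)) (Icc 0 T) t :=
    (hasDerivWithinAt_id t _).prodMk (hasDerivWithinAt_const t _ y)
  have hm : MapsTo (fun s : ℝ => (s, y)) (Icc 0 T) (timeTarget T p) := fun s hs => ⟨hs, hy⟩
  have h3 := h1.comp_hasDerivWithinAt t h2 hm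
  exact ⟨h3, h3.derivWithin (uniqueDiffOn_Icc hT t ht)⟩

theorem TimeSmooth.timeDeriv (hT : 0 < T) (hf : TimeSmooth n k T f) (hmk : m + 1 ≤ k) :
    TimeSmooth n m T (timeDeriv T f) := by
  intro p
  have hk : k ≠ 0 := by rintro rfl; simp at hmk
  have h1 := ((hf p).fderivWithin (uniqueDiffOn_timeTarget hT p) hmk).clm_apply
    (contDiffOn_const (c := ((1 : ℝ), (0 : 𝔼))))
  exact h1.congr fun q hq => (timeRep_timeDeriv hT hf hk hq.1 hq.2).2

theorem TimeSmooth.hasDerivWithinAt (hT : 0 < T) (hf : TimeSmooth n k T f) (hk : k ≠ 0) {t : ℝ}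
    (ht : t ∈ Icc 0 T) (x : M) :
    HasDerivWithinAt (fun s => f s x) (WeightedWave.timeDeriv T f t x) (Icc 0 T) t := by
  have hy := mem_extChartAt_target (I := 𝓡∂ n) x
  have h := (timeRep_timeDeriv hT hf hk ht hy).1.differentiableWithinAt
  simp only [timeRep, chartRep, extChartAt_to_inv] at h
  exact h.hasDerivWithinAt

theorem TimeSmooth.hasDerivAt (hT : 0 < T) (hf : TimeSmooth n k T f) (hk : k ≠ 0) {t : ℝ}
    (ht : t ∈ Ioo 0 T) (x : M) :
    HasDerivAt (fun s => f s x) (WeightedWave.timeDeriv T f t x) t :=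
  (hf.hasDerivWithinAt hT hk (Ioo_subset_Icc_self ht) x).hasDerivAt (Icc_mem_nhds ht.1 ht.2)

theorem timeRep_partialDeriv (hf : TimeSmooth n k T f) (hk : k ≠ 0) {p : M} {t : ℝ} {y : 𝔼}
    (ht : t ∈ Icc 0 T) (hy : y ∈ (extChartAt (𝓡∂ n) p).target) (i : Fin n) :
    partialDeriv i (chartRep p (f t)) y
      = fderivWithin ℝ (timeRep p f) (timeTarget T p) (t, y) (0, EuclideanSpace.single i 1) := by
  have h1 := ((hf p).differentiableOn hk (t, y) ⟨ht, hy⟩).hasFDerivWithinAt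
  have h2 : HasFDerivWithinAt (fun z : 𝔼 => (t, z)) (ContinuousLinearMap.inr ℝ ℝ 𝔼)
      (extChartAt (𝓡∂ n) p).target y :=
    (hasFDerivAt_prodMk_right t y).hasFDerivWithinAt
  have h3 := h1.comp y h2 fun s hs => ⟨ht, hs⟩
  rw [partialDeriv_eq_target hy]
  exact DFunLike.congr_fun (h3.fderivWithin (uniqueDiffOn_extChartAt_target (I := 𝓡∂ n) p y hy)) _

theorem TimeSmooth.partialDeriv (hT : 0 < T) (hf : TimeSmooth n k T f) (hmk : m + 1 ≤ k) (p : M)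
    (i : Fin n) : ContDiffOn ℝ m
      (fun q : ℝ × 𝔼 => WeightedWave.partialDeriv i (chartRep p (f q.1)) q.2)
      (timeTarget T p) := by
  have hk : k ≠ 0 := by rintro rfl; simp at hmk
  have h1 := ((hf p).fderivWithin (uniqueDiffOn_timeTarget hT p) hmk).clm_apply
    (contDiffOn_const (c := ((0 : ℝ), (EuclideanSpace.single i 1 : 𝔼))))
  exact h1.congr fun q hq => timeRep_partialDeriv hf hk hq.1 hq.2 i

/-- Time and space derivatives commute for C² functions, including the endpoints of the interval and
the boundary of M, because these points lie in the closure of the interior. -/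
theorem TimeSmooth.hasDerivWithinAt_partialDeriv (hT : 0 < T) (hf : TimeSmooth n 2 T f) {p : M}
    {t : ℝ} {y : 𝔼} (ht : t ∈ Icc 0 T) (hy : y ∈ (extChartAt (𝓡∂ n) p).target) (i : Fin n) :
    HasDerivWithinAt (fun s => WeightedWave.partialDeriv i (chartRep p (f s)) y)
      (WeightedWave.partialDeriv i (chartRep p (WeightedWave.timeDeriv T f t)) y) (Icc 0 T) t := by
  set S := timeTarget (n := n) T p with hS
  have hu := uniqueDiffOn_timeTarget (n := n) hT p
  have hq : (t, y) ∈ S := ⟨ht, hy⟩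
  have hd : DifferentiableWithinAt ℝ (fderivWithin ℝ (timeRep p f) S) S (t, y) :=
    ((hf p).fderivWithin hu (m := 1) (by norm_num)).differentiableOn one_ne_zero _ hq
  have h2 : HasDerivWithinAt (fun s : ℝ => (s, y)) ((1 : ℝ), (0 : 𝔼)) (Icc 0 T) t :=
    (hasDerivWithinAt_id t _).prodMk (hasDerivWithinAt_const t _ y)
  have hm : MapsTo (fun s : ℝ => (s, y)) (Icc 0 T) S := fun s hs => ⟨hs, hy⟩
  have h3 := hd.hasFDerivWithinAt.comp_hasDerivWithinAt t h2 hm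
  have h3' : HasDerivWithinAt (fun s => fderivWithin ℝ (timeRep p f) S (s, y)
      (0, EuclideanSpace.single i 1)) (fderivWithin ℝ (fderivWithin ℝ (timeRep p f) S) S (t, y)
      (1, 0) (0, EuclideanSpace.single i 1)) (Icc 0 T) t :=
    (ContinuousLinearMap.apply ℝ ℝ ((0 : ℝ), (EuclideanSpace.single i 1 : 𝔼))).hasFDerivAt
      |>.comp_hasDerivWithinAt t h3
  have h4 : WeightedWave.partialDeriv i (chartRep p (WeightedWave.timeDeriv T f t)) y
      = fderivWithin ℝ (fderivWithin ℝ (timeRep p f) S) S (t, y) (0, EuclideanSpace.single i 1)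
        (1, 0) := by
    have h5 := (hd.hasFDerivWithinAt.clm_apply
      (hasFDerivWithinAt_const ((1 : ℝ), (0 : 𝔼)) (t, y) S)).fderivWithin (hu _ hq)
    have h6 : EqOn (timeRep p (WeightedWave.timeDeriv T f))
        (fun q => fderivWithin ℝ (timeRep p f) S q (1, 0)) S := fun q hq =>
      (timeRep_timeDeriv hT hf two_ne_zero hq.1 hq.2).2
    rw [timeRep_partialDeriv (hf.timeDeriv hT (m := 1) (by norm_num)) one_ne_zero ht hy, ← hS,
      fderivWithin_congr h6 (h6 hq)]
    refine (DFunLike.congr_fun h5 _).trans ?_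
    simp
  have hcl : (t, y) ∈ closure (interior S) := by
    rw [hS, timeTarget, interior_prod_eq, closure_prod_eq, interior_Icc, closure_Ioo hT.ne]
    exact ⟨ht, extChartAt_target_subset_closure_interior hy⟩
  rw [h4, ((hf p) _ hq).isSymmSndFDerivWithinAt (by simp) hu hcl hq]
  exact h3'.congr (fun s hs => timeRep_partialDeriv hf two_ne_zero hs hy i)
    (timeRep_partialDeriv hf two_ne_zero ht hy i)

theorem TimeSmooth.continuousOn {f : ℝ → M → ℝ} (hf : TimeSmooth n k T f) :
    ContinuousOn (fun q : ℝ × M => f q.1 q.2) (Icc 0 T ×ˢ univ) := by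
  rintro ⟨t, x⟩ ⟨ht, -⟩
  have hx := mem_extChartAt_source (I := 𝓡∂ n) x
  have h1 := (hf x).continuousOn (t, extChartAt (𝓡∂ n) x x) ⟨ht, mem_extChartAt_target x⟩
  have hU : Icc 0 T ×ˢ (extChartAt (𝓡∂ n) x).source ∈ nhdsWithin (t, x) (Icc 0 T ×ˢ univ) := by
    rw [nhdsWithin_prod_eq, nhdsWithin_univ]
    exact Filter.prod_mem_prod self_mem_nhdsWithin (extChartAt_source_mem_nhds x)
  have h2 : ContinuousWithinAt (fun q : ℝ × M => (q.1, extChartAt (𝓡∂ n) x q.2))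
      (Icc 0 T ×ˢ (extChartAt (𝓡∂ n) x).source) (t, x) := by
    refine ContinuousOn.continuousWithinAt ?_ ⟨ht, hx⟩
    exact continuousOn_fst.prodMk ((continuousOn_extChartAt x).comp continuousOn_snd
      fun q hq => hq.2)
  have h3 : ContinuousWithinAt (timeRep x f ∘ fun q : ℝ × M => (q.1, extChartAt (𝓡∂ n) x q.2))
      (Icc 0 T ×ˢ (extChartAt (𝓡∂ n) x).source) (t, x) :=
    ContinuousWithinAt.comp h1 h2 fun q hq => ⟨hq.1, (extChartAt (𝓡∂ n) x).map_source hq.2⟩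
  refine (h3.congr (fun q hq => ?_) ?_).mono_of_mem_nhdsWithin hU
  · exact congrArg (f q.1) ((extChartAt (𝓡∂ n) x).left_inv hq.2).symm
  · exact congrArg (f t) ((extChartAt (𝓡∂ n) x).left_inv hx).symm

end Basic

section GradInner

variable {T : ℝ} {f h : ℝ → M → ℝ}

theorem timeSmooth_const {k : ℕ∞} {h : M → ℝ} (hh : ContMDiff (𝓡∂ n) 𝓘(ℝ) k h) :
    TimeSmooth n k T fun _ => h := fun p =>
  (contDiffOn_chartRep p hh).comp contDiffOn_snd fun _ hq => hq.2

theorem TimeSmooth.contMDiff {k : ℕ∞} (hf : TimeSmooth n k T f) {t : ℝ} (ht : t ∈ Icc 0 T) :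
    ContMDiff (𝓡∂ n) 𝓘(ℝ) k (f t) :=
  contMDiff_of_chartRep fun p =>
    (hf p).comp (contDiff_prodMk_right t).contDiffOn fun _ hy => ⟨ht, hy⟩

theorem TimeSmooth.gradInner (g : SmoothMetric n M) (hT : 0 < T) {k : ℕ∞}
    (hf : TimeSmooth n (k + 1 : ℕ∞) T f) (hh : TimeSmooth n (k + 1 : ℕ∞) T h) :
    TimeSmooth n k T fun t => gradInner g (f t) (h t) := by
  intro p
  refine ContDiffOn.congr (f := fun q : ℝ × 𝔼 => ∑ i, ∑ j, (metricMatrix g p q.2)⁻¹ i j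
    * WeightedWave.partialDeriv i (chartRep p (f q.1)) q.2
    * WeightedWave.partialDeriv j (chartRep p (h q.1)) q.2) ?_ fun q hq => ?_
  · refine ContDiffOn.sum fun i _ => ContDiffOn.sum fun j _ => ContDiffOn.mul (ContDiffOn.mul ?_ ?_) ?_
    · exact ((contDiffOn_metricMatrix_inv g p i j).of_le (by exact_mod_cast le_top)).comp
        contDiffOn_snd fun _ hq => hq.2
    · exact hf.partialDeriv hT (by norm_cast) p i
    · exact hh.partialDeriv hT (by norm_cast) p j
  · exact gradInner_eq_sum g hq.2 ((hf.contMDiff hq.1).mdifferentiableAt (by simp))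
      ((hh.contMDiff hq.1).mdifferentiableAt (by simp))

/-- In a fixed chart at a fixed point the metric coefficients do not depend on time, so only the two
partial derivatives are differentiated. -/
theorem TimeSmooth.hasDerivWithinAt_gradInner (g : SmoothMetric n M) (hT : 0 < T)
    (hf : TimeSmooth n 2 T f) (hh : TimeSmooth n 2 T h) {t : ℝ} (ht : t ∈ Icc 0 T) (x : M) :
    HasDerivWithinAt (fun s => WeightedWave.gradInner g (f s) (h s) x)
      (WeightedWave.gradInner g (WeightedWave.timeDeriv T f t) (h t) x
        + WeightedWave.gradInner g (f t) (WeightedWave.timeDeriv T h t) x) (Icc 0 T) t := by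
  have hx := mem_extChartAt_source (I := 𝓡∂ n) x
  have hy := mem_extChartAt_target (I := 𝓡∂ n) x
  set y := extChartAt (𝓡∂ n) x x with hydef
  have key : ∀ {a b : M → ℝ}, ContMDiff (𝓡∂ n) 𝓘(ℝ) 1 a → ContMDiff (𝓡∂ n) 𝓘(ℝ) 1 b →
      WeightedWave.gradInner g a b x = ∑ i, ∑ j, (metricMatrix g x y)⁻¹ i j
        * WeightedWave.partialDeriv i (chartRep x a) y
        * WeightedWave.partialDeriv j (chartRep x b) y := by
    intro a b ha hb
    rw [← gradInner_eq_sum g hy (ha.mdifferentiableAt one_ne_zero)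
      (hb.mdifferentiableAt one_ne_zero), chartRep, hydef, (extChartAt (𝓡∂ n) x).left_inv hx]
  have hf1 : TimeSmooth n (1 : ℕ∞) T f := hf.of_le one_le_two
  have hh1 : TimeSmooth n (1 : ℕ∞) T h := hh.of_le one_le_two
  have hf' : TimeSmooth n (1 : ℕ∞) T (WeightedWave.timeDeriv T f) := hf.timeDeriv hT (by norm_num)
  have hh' : TimeSmooth n (1 : ℕ∞) T (WeightedWave.timeDeriv T h) := hh.timeDeriv hT (by norm_num)
  rw [key (hf'.contMDiff ht) (hh1.contMDiff ht), key (hf1.contMDiff ht) (hh'.contMDiff ht),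
    ← Finset.sum_add_distrib]
  refine HasDerivWithinAt.congr ?_ (fun s hs => key (hf1.contMDiff hs) (hh1.contMDiff hs))
    (key (hf1.contMDiff ht) (hh1.contMDiff ht))
  simp_rw [← Finset.sum_add_distrib]
  refine HasDerivWithinAt.fun_sum fun i _ => HasDerivWithinAt.fun_sum fun j _ => ?_
  exact ((hf.hasDerivWithinAt_partialDeriv hT ht hy i).const_mul _).mul
    (hh.hasDerivWithinAt_partialDeriv hT ht hy j)

end GradInner

/-! ### Differentiation under the integral -/

variable [MeasurableSpace M] [BorelSpace M] [CompactSpace M]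

omit [IsManifold (𝓡∂ n) ∞ M] [MeasurableSpace M] [BorelSpace M] in
theorem TimeSmooth.exists_bound {k : WithTop ℕ∞} {T : ℝ} {f : ℝ → M → ℝ} (hf : TimeSmooth n k T f) :
    ∃ C, ∀ t ∈ Icc 0 T, ∀ x, ‖f t x‖ ≤ C := by
  obtain ⟨C, hC⟩ := (isCompact_Icc.prod isCompact_univ).exists_bound_of_continuousOn
    hf.continuousOn
  exact ⟨C, fun t ht x => hC (t, x) ⟨ht, mem_univ _⟩⟩

omit [IsManifold (𝓡∂ n) ∞ M] [MeasurableSpace M] [BorelSpace M] [CompactSpace M] in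
theorem TimeSmooth.continuous {k : WithTop ℕ∞} {T : ℝ} {f : ℝ → M → ℝ} (hf : TimeSmooth n k T f)
    {t : ℝ} (ht : t ∈ Icc 0 T) : Continuous (f t) := by
  rw [← continuousOn_univ]
  exact hf.continuousOn.comp (Continuous.prodMk_right t).continuousOn fun _ _ => ⟨ht, mem_univ _⟩

omit [IsManifold (𝓡∂ n) ∞ M] in
theorem TimeSmooth.continuousOn_integral {k : WithTop ℕ∞} {T : ℝ} {f : ℝ → M → ℝ}
    (hf : TimeSmooth n k T f) (ν : Measure M) [IsFiniteMeasure ν] :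
    ContinuousOn (fun t => ∫ x, f t x ∂ν) (Icc 0 T) := by
  obtain ⟨C, hC⟩ := hf.exists_bound
  intro t ht
  refine continuousWithinAt_of_dominated (bound := fun _ => C) ?_ ?_ (integrable_const C) ?_
  · filter_upwards [self_mem_nhdsWithin] with s hs
    exact (hf.continuous hs).aestronglyMeasurable
  · filter_upwards [self_mem_nhdsWithin] with s hs
    exact Filter.Eventually.of_forall fun x => hC s hs x
  · refine Filter.Eventually.of_forall fun x => ?_
    have h := hf.continuousOn (t, x) ⟨ht, mem_univ _⟩
    exact ContinuousWithinAt.comp (f := fun s : ℝ => (s, x)) (t := Icc 0 T ×ˢ univ) h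
      (Continuous.prodMk_left x : Continuous fun s : ℝ => (s, x)).continuousWithinAt fun s hs => ⟨hs, mem_univ _⟩

omit [IsManifold (𝓡∂ n) ∞ M] in
-- The derivative is bounded on the compact [0,T] × M, so a constant dominates it.
theorem TimeSmooth.hasDerivAt_integral {k m : WithTop ℕ∞} {T : ℝ} {f f' : ℝ → M → ℝ}
    (hf : TimeSmooth n k T f) (hf' : TimeSmooth n m T f')
    (hd : ∀ t ∈ Ioo 0 T, ∀ x, HasDerivAt (fun s => f s x) (f' t x) t)
    (ν : Measure M) [IsFiniteMeasure ν] {t : ℝ} (ht : t ∈ Ioo 0 T) :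
    HasDerivAt (fun s => ∫ x, f s x ∂ν) (∫ x, f' t x ∂ν) t := by
  obtain ⟨C, hC⟩ := hf'.exists_bound
  have ht' := Ioo_subset_Icc_self ht
  refine (hasDerivAt_integral_of_dominated_loc_of_deriv_le (bound := fun _ => C)
    (Ioo_mem_nhds ht.1 ht.2) ?_ ?_ ?_ ?_ (integrable_const C) ?_).2
  · filter_upwards [Ioo_mem_nhds ht.1 ht.2] with s hs
    exact (hf.continuous (Ioo_subset_Icc_self hs)).aestronglyMeasurable
  · exact (hf.continuous ht').integrable_of_hasCompactSupport (HasCompactSupport.of_compactSpace _)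
  · exact (hf'.continuous ht').aestronglyMeasurable
  · exact Filter.Eventually.of_forall fun x s hs => hC s (Ioo_subset_Icc_self hs) x
  · exact Filter.Eventually.of_forall fun x s hs => hd s hs x

end

section

/-! ### The multiplier inequality at a fixed time -/

section Pointwise

variable {ℓ s u v : M → ℝ} {ρ τ : ℝ}

/-- Returning from w to u isolates the factor e^{2τℓ}, the only place where the extrema of ℓ enter.
-/
theorem expWeight_mul_multiplier (g : SmoothMetric n M) {x : M}
    (hℓ : MDifferentiableAt (𝓡∂ n) 𝓘(ℝ) ℓ x) (hu : MDifferentiableAt (𝓡∂ n) 𝓘(ℝ) u x) (b : ℝ) :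
    expWeight τ ℓ x * b * multiplier g ℓ s ρ (weighted τ ℓ u) x
      = expWeight τ ℓ x ^ 2 * (b * gradInner g ℓ u x
        + (τ * gradInner g ℓ ℓ x + 1 / 2 * (s x - ρ)) * (u x * b)) := by
  have h := expWeight_mul_gradInner g τ ℓ hℓ hu
  have hw : weighted τ ℓ u x = expWeight τ ℓ x * u x := rfl
  rw [hw] at h
  rw [multiplier, hw]
  linear_combination (-(expWeight τ ℓ x * b)) * h

/-- On the boundary every term with an undifferentiated w or y vanishes, and ∇u is normal. The
multiplier contributes e^{2τℓ}(∂_ν u)²∂_ν ℓ, and -|∇w|²/2 in `auxDensity` removes half of it. -/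
theorem boundary_flux_eq (g : SmoothMetric n M) (hℓ : ContMDiff (𝓡∂ n) 𝓘(ℝ) 1 ℓ)
    (hu : ContMDiff (𝓡∂ n) 𝓘(ℝ) 1 u) (h0 : ∀ x ∈ (𝓡∂ n).boundary M, u x = 0) {x : M}
    (hx : x ∈ (𝓡∂ n).boundary M) (hv : v x = 0) :
    expWeight τ ℓ x * multiplier g ℓ s ρ (weighted τ ℓ u) x * normalDeriv g u x
        + auxDensity g ℓ s ρ τ (weighted τ ℓ u) (weighted τ ℓ v) x * normalDeriv g ℓ x
      = 1 / 2 * expWeight τ ℓ x ^ 2 * normalDeriv g u x ^ 2 * normalDeriv g ℓ x := by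
  have hℓx : MDifferentiableAt (𝓡∂ n) 𝓘(ℝ) ℓ x := hℓ.mdifferentiableAt one_ne_zero
  have hux : MDifferentiableAt (𝓡∂ n) 𝓘(ℝ) u x := hu.mdifferentiableAt one_ne_zero
  have hw : weighted τ ℓ u x = 0 := by rw [weighted, h0 x hx, mul_zero]
  have hy : weighted τ ℓ v x = 0 := by rw [weighted, hv, mul_zero]
  have h1 := expWeight_mul_gradInner g τ ℓ hℓx hux
  have h2 := expWeight_mul_gradInner g τ (weighted τ ℓ u) hℓx hux
  have h3 := expWeight_mul_gradInner g τ u hℓx hux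
  rw [hw, gradInner_comm g ℓ u, gradInner_of_zero_boundary g hu h0 _ hx] at h1
  rw [hw, gradInner_comm g _ u] at h2
  rw [hw, gradInner_of_zero_boundary g hu h0 _ hx] at h3
  simp only [multiplier, auxDensity, hw, hy]
  rw [show gradInner g ℓ (weighted τ ℓ u) x
    = expWeight τ ℓ x * (normalDeriv g u x * normalDeriv g ℓ x) by linarith,
    show gradInner g (weighted τ ℓ u) (weighted τ ℓ u) x
    = expWeight τ ℓ x * (expWeight τ ℓ x * (normalDeriv g u x * normalDeriv g u x)) by
      rw [h3]; linarith]
  ring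

/-- The weighted energy density is dominated by the volume terms of the multiplier identity. -/
theorem energyDensity_le_multiplier_identity (g : SmoothMetric n M)
    (hℓ : ContMDiff (𝓡∂ n) 𝓘(ℝ) 2 ℓ) (hs : ContMDiff (𝓡∂ n) 𝓘(ℝ) 1 s)
    (hu : ContMDiff (𝓡∂ n) 𝓘(ℝ) 2 u) (hv : ContMDiff (𝓡∂ n) 𝓘(ℝ) 1 v) {r C : ℝ} (hρ : 0 < ρ)
    (hr : 0 < r) (hτ : 3 / ρ ≤ τ) (hC : C / (2 * ρ * r ^ 2) ≤ τ) {x : M}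
    (hconv : ∀ X : TangentSpace (𝓡∂ n) x, ρ * gnorm g x X ^ 2 ≤ hessian g ℓ x X X)
    (hgrad : r ≤ gnorm g x (gradient g ℓ x)) (hS : ρ ^ 2 + gradInner g s s x ≤ C) :
    1 / (2 * τ) * (expWeight τ ℓ x ^ 2 * (v x ^ 2 + gradInner g u u x))
      ≤ gradInner g (fun z => expWeight τ ℓ z * multiplier g ℓ s ρ (weighted τ ℓ u) z) u x
        + auxDensity g ℓ s ρ τ (weighted τ ℓ u) (weighted τ ℓ v) x * s x
        + gradInner g (auxDensity g ℓ s ρ τ (weighted τ ℓ u) (weighted τ ℓ v)) ℓ x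
        - weighted τ ℓ v x * multiplier g ℓ s ρ (weighted τ ℓ v) x := by
  have hℓ1 := hℓ.of_le one_le_two
  have hu1 := hu.of_le one_le_two
  have hℓx : MDifferentiableAt (𝓡∂ n) 𝓘(ℝ) ℓ x := hℓ1.mdifferentiableAt one_ne_zero
  have hux : MDifferentiableAt (𝓡∂ n) 𝓘(ℝ) u x := hu1.mdifferentiableAt one_ne_zero
  have hy : ContMDiff (𝓡∂ n) 𝓘(ℝ) 1 (weighted τ ℓ v) := (contMDiff_expWeight τ hℓ1).mul hv
  rw [multiplier_identity g hℓ hs hu hy rfl x]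
  have hA : r ^ 2 ≤ gradInner g ℓ ℓ x := by
    rw [← gnorm_gradient_sq]; gcongr
  have hH1 := hconv (gradient g (weighted τ ℓ u) x)
  have hH2 := hconv (gradient g ℓ x)
  rw [gnorm_gradient_sq] at hH1 hH2
  refine le_trans (le_of_eq ?_) (multiplier_lower_bound hρ hτ hC hr hS
    (gradInner_self_nonneg g s x) (gradInner_self_nonneg g (weighted τ ℓ u) x) hA
    (gradInner_sq_le g ℓ (weighted τ ℓ u) x) (gradInner_sq_le g s (weighted τ ℓ u) x) hH1 hH2)
  have h1 := expWeight_mul_gradInner g τ ℓ hℓx hux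
  have h2 := expWeight_mul_gradInner g τ (weighted τ ℓ u) hℓx hux
  have h3 := expWeight_mul_gradInner g τ u hℓx hux
  rw [gradInner_comm g _ u, gradInner_comm g _ ℓ] at h2
  rw [gradInner_comm g u ℓ] at h3
  have hyx : weighted τ ℓ v x = expWeight τ ℓ x * v x := rfl
  -- This is |∇w - τw∇ℓ|² expanded, the form in which `multiplier_lower_bound` expects the energy
  -- density.
  have h4 : expWeight τ ℓ x ^ 2 * gradInner g u u x
      = gradInner g (weighted τ ℓ u) (weighted τ ℓ u) x
        - 2 * τ * weighted τ ℓ u x * gradInner g ℓ (weighted τ ℓ u) x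
        + τ ^ 2 * weighted τ ℓ u x ^ 2 * gradInner g ℓ ℓ x := by
    linear_combination expWeight τ ℓ x * h3 + h2 - τ * weighted τ ℓ u x * h1
  rw [hyx, ← h4]
  ring

end Pointwise

section Integrated

variable [MeasurableSpace M] [BorelSpace M] [CompactSpace M] [T2Space M]
  {μ ℓ u v : M → ℝ} {ρ τ : ℝ}

/-- The differential inequality at a fixed time. For a solution, with v its velocity, the left side
is the derivative of the quantity that is later integrated over [0,T]. -/
theorem integral_multiplier_le (g : SmoothMetric n M)
    (hμ : ContMDiff (𝓡∂ n) 𝓘(ℝ) ∞ μ) (hμpos : ∀ x, 0 < μ x) (hℓ : ContMDiff (𝓡∂ n) 𝓘(ℝ) 3 ℓ)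
    (hu : ContMDiff (𝓡∂ n) 𝓘(ℝ) 2 u) (hv : ContMDiff (𝓡∂ n) 𝓘(ℝ) 1 v)
    (hu0 : ∀ x ∈ (𝓡∂ n).boundary M, u x = 0) (hv0 : ∀ x ∈ (𝓡∂ n).boundary M, v x = 0)
    {r C : ℝ} (hρ : 0 < ρ) (hr : 0 < r) (hτ : 3 / ρ ≤ τ) (hC : C / (2 * ρ * r ^ 2) ≤ τ)
    (hconv : ∀ (x : M) (X : TangentSpace (𝓡∂ n) x), ρ * gnorm g x X ^ 2 ≤ hessian g ℓ x X X)
    (hgrad : ∀ x : M, r ≤ gnorm g x (gradient g ℓ x))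
    (hS : ∀ x, ρ ^ 2 + gradInner g (weightedLaplacian g μ ℓ) (weightedLaplacian g μ ℓ) x ≤ C)
    {Γ : Set M} (hΓm : MeasurableSet Γ)
    (hΓ : {x | x ∈ (𝓡∂ n).boundary M ∧ 0 < normalDeriv g ℓ x} ⊆ Γ)
    {a b A : ℝ} (ha : ∀ x, a ≤ expWeight τ ℓ x ^ 2) (hb : ∀ x, expWeight τ ℓ x ^ 2 ≤ b)
    (hA : ∀ x, gnorm g x (gradient g ℓ x) ≤ A) (hA0 : 0 ≤ A) (hb0 : 0 ≤ b) :
    ∫ x, (expWeight τ ℓ x * multiplier g ℓ (weightedLaplacian g μ ℓ) ρ (weighted τ ℓ u) x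
          * weightedLaplacian g μ u x
        + weighted τ ℓ v x * multiplier g ℓ (weightedLaplacian g μ ℓ) ρ (weighted τ ℓ v) x)
        ∂(weightedVolume g μ)
      ≤ 1 / 2 * b * A * (∫ x in Γ, normalDeriv g u x ^ 2 * μ x ∂(surfaceMeasure g))
        - 1 / (2 * τ) * (a * ∫ x, (v x ^ 2 + gradInner g u u x) ∂(weightedVolume g μ)) := by
  have hτ0 : 0 < τ := lt_of_lt_of_le (by positivity) hτ
  set s := weightedLaplacian g μ ℓ with hsdef
  have hℓ2 : ContMDiff (𝓡∂ n) 𝓘(ℝ) 2 ℓ := hℓ.of_le (by norm_num)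
  have hℓ1 := hℓ2.of_le one_le_two
  have hu1 := hu.of_le one_le_two
  have hs : ContMDiff (𝓡∂ n) 𝓘(ℝ) 1 s := by
    have := contMDiff_weightedLaplacian (k := 1) g hμ hμpos (h := ℓ)
      (hℓ.of_le (by norm_cast))
    exact_mod_cast this
  have hΔ : Continuous (weightedLaplacian g μ u) :=
    (contMDiff_weightedLaplacian (k := 0) g hμ hμpos (h := u) (by exact_mod_cast hu)).continuous
  set w := weighted τ ℓ u with hw
  set y := weighted τ ℓ v with hydef
  have hwC : ContMDiff (𝓡∂ n) 𝓘(ℝ) 2 w := (contMDiff_expWeight τ hℓ2).mul hu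
  have hyC : ContMDiff (𝓡∂ n) 𝓘(ℝ) 1 y := (contMDiff_expWeight τ hℓ1).mul hv
  set f₁ := fun x => expWeight τ ℓ x * multiplier g ℓ s ρ w x with hf₁
  set f₂ := auxDensity g ℓ s ρ τ w y with hf₂
  have hf₁C : ContMDiff (𝓡∂ n) 𝓘(ℝ) 1 f₁ :=
    (contMDiff_expWeight τ hℓ1).mul (contMDiff_multiplier g hℓ2 hs hwC)
  have hf₂C : ContMDiff (𝓡∂ n) 𝓘(ℝ) 1 f₂ := contMDiff_auxDensity g hℓ2 hs hwC hyC
  have hmy : Continuous fun x => multiplier g ℓ s ρ y x :=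
    (continuous_gradInner g hℓ1 hyC).add (continuous_const.mul
      ((hs.continuous.sub continuous_const).mul hyC.continuous))
  have hc1 : Continuous (gradInner g f₁ u) := continuous_gradInner g hf₁C hu1
  have hc2 : Continuous (gradInner g f₂ ℓ) := continuous_gradInner g hf₂C hℓ1
  have hG₁ := integral_mul_weightedLaplacian_add g hμ hμpos hf₁C hu
  have hG₂ := integral_mul_weightedLaplacian_add g hμ hμpos hf₂C hℓ2
  have hcu := continuousOn_normalDeriv g hu1
  have hcℓ := continuousOn_normalDeriv g hℓ1
  have hμc := hμ.continuous
  have hf₁c := hf₁C.continuous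
  have hf₂c := hf₂C.continuous
  have hyc := hyC.continuous
  have hsc : Continuous (weightedLaplacian g μ ℓ) := hs.continuous
  set L : M → ℝ := fun x => gradInner g f₁ u x + f₂ x * s x + gradInner g f₂ ℓ x
    - y x * multiplier g ℓ s ρ y x with hL
  have hLc : Continuous L := (((hc1.add (hf₂c.mul hsc)).add hc2).sub (hyc.mul hmy))
  -- The two Green formulas are added. The second has total contribution zero and serves only to
  -- remove the higher derivatives of u from the volume term.
  have hsum : ∫ x, (f₁ x * weightedLaplacian g μ u x + y x * multiplier g ℓ s ρ y x)
        ∂(weightedVolume g μ)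
      = ∫ x, (f₁ x * normalDeriv g u x * μ x + f₂ x * normalDeriv g ℓ x * μ x) ∂(surfaceMeasure g)
        - ∫ x, L x ∂(weightedVolume g μ) := by
    have i₁ : Integrable (fun x => f₁ x * normalDeriv g u x * μ x) (surfaceMeasure g) :=
      integrable_surfaceMeasure g ((hf₁c.continuousOn.mul hcu).mul hμc.continuousOn)
    have i₂ : Integrable (fun x => f₂ x * normalDeriv g ℓ x * μ x) (surfaceMeasure g) :=
      integrable_surfaceMeasure g ((hf₂c.continuousOn.mul hcℓ).mul hμc.continuousOn)
    rw [integral_add i₁ i₂, ← hG₁, ← hG₂, ← integral_add (integrable_weightedVolume g hμc (by fun_prop))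
      (integrable_weightedVolume g hμc (by fun_prop)),
      ← integral_sub (integrable_weightedVolume g hμc (by fun_prop))
      (integrable_weightedVolume g hμc hLc)]
    refine integral_congr_ae (Filter.Eventually.of_forall fun x => ?_)
    simp only [hL]
    ring
  have hbd : ∫ x, (f₁ x * normalDeriv g u x * μ x + f₂ x * normalDeriv g ℓ x * μ x)
        ∂(surfaceMeasure g)
      ≤ 1 / 2 * b * A * (∫ x in Γ, normalDeriv g u x ^ 2 * μ x ∂(surfaceMeasure g)) := by
    have hi : Integrable (fun x => 1 / 2 * b * A * (normalDeriv g u x ^ 2 * μ x))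
        (surfaceMeasure g) := integrable_surfaceMeasure g
      (continuousOn_const.mul ((hcu.pow 2).mul hμc.continuousOn))
    rw [← integral_const_mul, ← integral_indicator hΓm]
    refine integral_mono_ae (integrable_surfaceMeasure g
      (((hf₁c.continuousOn.mul hcu).mul hμc.continuousOn).add
        ((hf₂c.continuousOn.mul hcℓ).mul hμc.continuousOn))) (hi.indicator hΓm) ?_
    filter_upwards [ae_surfaceMeasure_mem_boundary g] with x hx
    have hflux : f₁ x * normalDeriv g u x + f₂ x * normalDeriv g ℓ x
        = 1 / 2 * expWeight τ ℓ x ^ 2 * normalDeriv g u x ^ 2 * normalDeriv g ℓ x :=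
      boundary_flux_eq g hℓ1 hu1 hu0 hx (hv0 x hx)
    rw [show f₁ x * normalDeriv g u x * μ x + f₂ x * normalDeriv g ℓ x * μ x
      = (f₁ x * normalDeriv g u x + f₂ x * normalDeriv g ℓ x) * μ x by ring, hflux]
    have hμx := (hμpos x).le
    -- Where ∂_ν ℓ ≤ 0 the flux has the favourable sign and is dropped; the other boundary points
    -- belong to Γ, and there ∂_ν ℓ ≤ |∇ℓ| ≤ A.
    rcases le_or_gt (normalDeriv g ℓ x) 0 with hneg | hpos
    · refine le_trans ?_ (indicator_nonneg (fun z _ => ?_) x)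
      · exact mul_nonpos_of_nonpos_of_nonneg
          (mul_nonpos_of_nonneg_of_nonpos (by positivity) hneg) hμx
      · have := (hμpos z).le
        positivity
    · rw [indicator_of_mem (hΓ ⟨hx, hpos⟩)]
      have h1 : normalDeriv g ℓ x ≤ A := by
        have h2 := normalDeriv_sq_le g ℓ x
        rw [← gnorm_gradient_sq] at h2
        exact ((abs_le_of_sq_le_sq h2 (gnorm_nonneg g x _)) |> le_of_abs_le).trans (hA x)
      have h2 := hb x
      calc 1 / 2 * expWeight τ ℓ x ^ 2 * normalDeriv g u x ^ 2 * normalDeriv g ℓ x * μ x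
          ≤ 1 / 2 * b * normalDeriv g u x ^ 2 * A * μ x := by gcongr
        _ = _ := by ring
  have hlow : 1 / (2 * τ) * (a * ∫ x, (v x ^ 2 + gradInner g u u x) ∂(weightedVolume g μ))
      ≤ ∫ x, L x ∂(weightedVolume g μ) := by
    have hvc := hv.continuous
    have hNc := continuous_gradInner g hu1 hu1
    rw [← integral_const_mul, ← integral_const_mul]
    refine integral_weightedVolume_mono g hμc (by fun_prop) hLc fun x => ?_
    refine le_trans ?_ (energyDensity_le_multiplier_identity g hℓ2 hs hu hv hρ hr hτ hC
      (hconv x) (hgrad x) (hS x))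
    have h1 := ha x
    have h2 := gradInner_self_nonneg g u x
    gcongr
  linarith

/-- Controls the endpoint terms of the time integration. Young's inequality leaves u² besides the
energy density, and Friedrichs' inequality replaces ∫u² by the gradient. -/
theorem abs_integral_multiplier_le {g : SmoothMetric n M}
    (hμ : Continuous μ) (hℓ : ContMDiff (𝓡∂ n) 𝓘(ℝ) 1 ℓ)
    (hu : ContMDiff (𝓡∂ n) 𝓘(ℝ) 1 u) (hv : Continuous v)
    (hu0 : ∀ x ∈ (𝓡∂ n).boundary M, u x = 0) (hτ : 0 ≤ τ)
    {CF b A A₂ S : ℝ} (hCF : 1 ≤ CF) (hF : FriedrichsConst g μ CF)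
    (hb : ∀ x, expWeight τ ℓ x ^ 2 ≤ b) (hA : ∀ x, gnorm g x (gradient g ℓ x) ≤ A)
    (hA₂ : ∀ x, gradInner g ℓ ℓ x ≤ A₂) (hS : ∀ x, |weightedLaplacian g μ ℓ x - ρ| ≤ S)
    (hA0 : 0 ≤ A) (hA₂0 : 0 ≤ A₂) (hS0 : 0 ≤ S) (hb0 : 0 ≤ b) :
    |∫ x, expWeight τ ℓ x * v x
        * multiplier g ℓ (weightedLaplacian g μ ℓ) ρ (weighted τ ℓ u) x ∂(weightedVolume g μ)|
      ≤ 1 / 2 * b * (CF * A₂ * τ + (A + CF * S / 2))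
        * ∫ x, (v x ^ 2 + gradInner g u u x) ∂(weightedVolume g μ) := by
  set s := weightedLaplacian g μ ℓ with hsdef
  have huc := hu.continuous
  have hNc := continuous_gradInner g hu hu
  have hN0 : 0 ≤ ∫ x, gradInner g u u x ∂(weightedVolume g μ) :=
    integral_nonneg fun x => gradInner_self_nonneg g u x
  have hv20 : 0 ≤ ∫ x, v x ^ 2 ∂(weightedVolume g μ) := integral_nonneg fun x => sq_nonneg _
  have hFr := friedrichs_of_boundary hμ (zero_le_one.trans hCF) hF hu hu0
  -- K bounds the coefficient τ|∇ℓ|² + (s-ρ)/2, and A + CF·K is the constant C₃τ + C₄.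
  set K := A₂ * τ + S / 2 with hK
  have hK0 : 0 ≤ K := by positivity
  have hpt : ∀ x, |expWeight τ ℓ x * v x * multiplier g ℓ s ρ (weighted τ ℓ u) x|
      ≤ 1 / 2 * b * (A * (v x ^ 2 + gradInner g u u x) + K * (u x ^ 2 + v x ^ 2)) := by
    intro x
    rw [expWeight_mul_multiplier g (hℓ.mdifferentiableAt one_ne_zero)
      (hu.mdifferentiableAt one_ne_zero), abs_mul, abs_of_nonneg (sq_nonneg _)]
    have hN := gradInner_self_nonneg g u x
    have hPP : |v x * gradInner g ℓ u x| ≤ A * ((v x ^ 2 + gradInner g u u x) / 2) := by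
      refine abs_le_of_sq_le_sq ?_ (by positivity)
      have h1 := gradInner_sq_le g ℓ u x
      have h2 : gradInner g ℓ ℓ x ≤ A ^ 2 := by
        rw [← gnorm_gradient_sq]
        exact pow_le_pow_left₀ (gnorm_nonneg g x _) (hA x) 2
      calc (v x * gradInner g ℓ u x) ^ 2 = v x ^ 2 * gradInner g ℓ u x ^ 2 := by ring
        _ ≤ v x ^ 2 * (gradInner g ℓ ℓ x * gradInner g u u x) := by gcongr
        _ ≤ v x ^ 2 * (A ^ 2 * gradInner g u u x) := by gcongr
        _ = A ^ 2 * (v x ^ 2 * gradInner g u u x) := by ring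
        _ ≤ A ^ 2 * ((v x ^ 2 + gradInner g u u x) / 2) ^ 2 := by
            gcongr
            linarith [sq_nonneg (v x ^ 2 - gradInner g u u x)]
        _ = _ := by ring
    have h3 : |τ * gradInner g ℓ ℓ x + 1 / 2 * (s x - ρ)| ≤ K := by
      have h4 := abs_le.1 (hS x)
      have h5 : τ * gradInner g ℓ ℓ x ≤ τ * A₂ := by gcongr; exact hA₂ x
      have h6 := mul_nonneg hτ (gradInner_self_nonneg g ℓ x)
      rw [abs_le]
      constructor <;> nlinarith [mul_nonneg hA₂0 hτ]
    have h4 : |u x * v x| ≤ (u x ^ 2 + v x ^ 2) / 2 := by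
      rw [abs_le]
      constructor <;> linarith [sq_nonneg (u x - v x), sq_nonneg (u x + v x)]
    have h5 : |v x * gradInner g ℓ u x
          + (τ * gradInner g ℓ ℓ x + 1 / 2 * (s x - ρ)) * (u x * v x)|
        ≤ A * ((v x ^ 2 + gradInner g u u x) / 2) + K * ((u x ^ 2 + v x ^ 2) / 2) := by
      refine (abs_add_le _ _).trans (add_le_add hPP ?_)
      rw [abs_mul]
      gcongr
    calc _ ≤ b * (A * ((v x ^ 2 + gradInner g u u x) / 2) + K * ((u x ^ 2 + v x ^ 2) / 2)) := by
            gcongr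
            exact hb x
      _ = _ := by ring
  have hi : ∀ {F : M → ℝ}, Continuous F → Integrable F (weightedVolume g μ) :=
    fun hF => integrable_weightedVolume g hμ hF
  have hv2c : Continuous fun x => v x ^ 2 := by fun_prop
  have hu2c : Continuous fun x => u x ^ 2 := by fun_prop
  refine (abs_integral_le_integral_abs).trans ((integral_mono_of_nonneg
    (Filter.Eventually.of_forall fun x => abs_nonneg _) (hi (by fun_prop))
    (Filter.Eventually.of_forall hpt)).trans ?_)
  rw [integral_const_mul, integral_add (hi (by fun_prop)) (hi (by fun_prop)), integral_const_mul,
    integral_const_mul, integral_add (hi hv2c) (hi hNc), integral_add (hi hu2c) (hi hv2c)]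
  -- Here CF ≥ 1 lets ∫v² carry the same factor that Friedrichs' inequality gives to the gradient.
  have h1 : (∫ x, u x ^ 2 ∂(weightedVolume g μ)) + ∫ x, v x ^ 2 ∂(weightedVolume g μ)
      ≤ CF * ((∫ x, v x ^ 2 ∂(weightedVolume g μ)) + ∫ x, gradInner g u u x ∂(weightedVolume g μ)) := by
    have := mul_le_mul_of_nonneg_right hCF hv20
    linarith
  calc _ ≤ 1 / 2 * b * (A * ((∫ x, v x ^ 2 ∂(weightedVolume g μ))
          + ∫ x, gradInner g u u x ∂(weightedVolume g μ))
        + K * (CF * ((∫ x, v x ^ 2 ∂(weightedVolume g μ))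
          + ∫ x, gradInner g u u x ∂(weightedVolume g μ)))) := by gcongr
    _ = _ := by rw [hK]; ring

end Integrated

end

section

/-! ### Solutions -/

section Solution

variable {g : SmoothMetric n M} {μ : M → ℝ} {T : ℝ} {u : ℝ → M → ℝ}

theorem IsSolution.timeSmooth (hu : IsSolution g μ T u) : TimeSmooth n 2 T u :=
  timeSmooth_of_contMDiffOn (k := 2) hu.regular

theorem IsSolution.timeSmooth_timeDeriv (hu : IsSolution g μ T u) (hT : 0 < T) :
    TimeSmooth n 1 T (timeDeriv T u) := hu.timeSmooth.timeDeriv hT (by norm_num)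

theorem IsSolution.timeSmooth_timeDeriv_timeDeriv (hu : IsSolution g μ T u) (hT : 0 < T) :
    TimeSmooth n 0 T (timeDeriv T (timeDeriv T u)) :=
  (hu.timeSmooth_timeDeriv hT).timeDeriv hT (by norm_num)

theorem IsSolution.timeDeriv_timeDeriv (hu : IsSolution g μ T u) {t : ℝ} (ht : t ∈ Ioo 0 T)
    (x : M) : timeDeriv T (timeDeriv T u) t x = weightedLaplacian g μ (u t) x := by
  have h := sub_eq_zero.1 (hu.wave t ht x)
  rw [iteratedDerivWithin_succ] at h
  rw [← h]
  simp only [iteratedDerivWithin_one]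
  rfl

/-- The Dirichlet condition is imposed for 0 < t < T and passes to the endpoints by continuity. -/
theorem IsSolution.eq_zero_of_mem_boundary (hu : IsSolution g μ T u) (hT : 0 < T) {t : ℝ}
    (ht : t ∈ Icc 0 T) {x : M} (hx : x ∈ (𝓡∂ n).boundary M) : u t x = 0 := by
  have hc : ContinuousOn (fun s => u s x) (Icc 0 T) := fun s hs =>
    (hu.timeSmooth.hasDerivWithinAt hT two_ne_zero hs x).continuousWithinAt
  rw [← closure_Ioo hT.ne] at hc ht
  have h : EqOn (fun s => u s x) (fun _ => 0) (closure (Ioo 0 T)) :=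
    EqOn.of_subset_closure (fun s hs => hu.dirichlet s hs x hx) hc continuousOn_const
      subset_closure subset_rfl
  exact h ht

theorem IsSolution.timeDeriv_eq_zero_of_mem_boundary (hu : IsSolution g μ T u) (hT : 0 < T)
    {t : ℝ} (ht : t ∈ Icc 0 T) {x : M} (hx : x ∈ (𝓡∂ n).boundary M) : timeDeriv T u t x = 0 := by
  have h : EqOn (fun s => u s x) (fun _ => 0) (Icc 0 T) :=
    fun s hs => hu.eq_zero_of_mem_boundary hT hs hx
  rw [timeDeriv, derivWithin_congr h (h ht)]
  simp

variable [MeasurableSpace M]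

theorem energy_eq (g : SmoothMetric n M) (μ : M → ℝ) (T : ℝ) (u : ℝ → M → ℝ) (t : ℝ) :
    energy g μ T u t
      = ∫ x, (timeDeriv T u t x ^ 2 + gradInner g (u t) (u t) x) ∂(weightedVolume g μ) := by
  simp only [energy, gnorm_gradient_sq, timeDeriv]

variable [BorelSpace M] [CompactSpace M]

/-- Multiplying the equation by the velocity, Green's formula makes half the derivative of the
energy a boundary integral containing ∂_t u, which vanishes there. -/
theorem IsSolution.energy_eq_energy_zero [T2Space M] (hμ : ContMDiff (𝓡∂ n) 𝓘(ℝ) ∞ μ)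
    (hμpos : ∀ x, 0 < μ x) (hu : IsSolution g μ T u) (hT : 0 < T) {t : ℝ} (ht : t ∈ Icc 0 T) :
    energy g μ T u t = energy g μ T u 0 := by
  have := isFiniteMeasure_weightedVolume g hμ.continuous
  have hv := hu.timeSmooth_timeDeriv hT
  have hv0 : TimeSmooth n (0 : ℕ∞) T (timeDeriv T u) := hv.of_le zero_le_one
  have hz := hu.timeSmooth_timeDeriv_timeDeriv hT
  have hu1 : TimeSmooth n (0 + 1 : ℕ∞) T u := hu.timeSmooth.of_le (by norm_num)
  have hv1 : TimeSmooth n (0 + 1 : ℕ∞) T (timeDeriv T u) := by simpa using hv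
  have hE : TimeSmooth n (0 : ℕ∞) T fun t x =>
      timeDeriv T u t x * timeDeriv T u t x + gradInner g (u t) (u t) x :=
    (hv0.mul hv0).add (hu1.gradInner g hT hu1)
  have hP : TimeSmooth n (0 : ℕ∞) T fun t => gradInner g (timeDeriv T u t) (u t) :=
    hv1.gradInner g hT hu1
  have hz0 : TimeSmooth n (0 : ℕ∞) T (timeDeriv T (timeDeriv T u)) := by simpa using hz
  have hQ : TimeSmooth n (0 : ℕ∞) T fun t x =>
      timeDeriv T u t x * timeDeriv T (timeDeriv T u) t x + gradInner g (timeDeriv T u t) (u t) x :=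
    (hv0.mul hz0).add hP
  have hE' := hQ.add hQ
  have hd : ∀ t ∈ Ioo 0 T, HasDerivAt (energy g μ T u) 0 t := by
    intro t ht
    have ht' := Ioo_subset_Icc_self ht
    have h1 := hE.hasDerivAt_integral hE' (fun s hs x => by
      have e1 := hv.hasDerivAt hT one_ne_zero hs x
      have e2 := (hu.timeSmooth.hasDerivWithinAt_gradInner g hT hu.timeSmooth
        (Ioo_subset_Icc_self hs) x).hasDerivAt (Icc_mem_nhds hs.1 hs.2)
      refine ((e1.mul e1).add e2).congr_deriv ?_
      rw [gradInner_comm g (u s)]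
      ring) (weightedVolume g μ) ht
    have h2 : ∫ x, (timeDeriv T u t x * timeDeriv T (timeDeriv T u) t x
        + gradInner g (timeDeriv T u t) (u t) x) ∂(weightedVolume g μ) = 0 := by
      simp only [hu.timeDeriv_timeDeriv ht]
      rw [integral_mul_weightedLaplacian_add g hμ hμpos (hv.contMDiff (k := 1) ht')
        (hu.timeSmooth.contMDiff (k := 2) ht')]
      refine integral_eq_zero_of_ae ?_
      filter_upwards [ae_surfaceMeasure_mem_boundary g] with x hx
      rw [hu.timeDeriv_eq_zero_of_mem_boundary hT ht' hx]
      simp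
    have hi := integrable_weightedVolume g hμ.continuous (hQ.continuous ht')
    rw [integral_add hi hi, h2, add_zero] at h1
    refine h1.congr_of_eventuallyEq (Filter.Eventually.of_forall fun s => ?_)
    simp only [energy_eq, sq]
  have hc : ContinuousOn (energy g μ T u) (Icc 0 T) :=
    (hE.continuousOn_integral (weightedVolume g μ)).congr fun s _ => by simp only [energy_eq, sq]
  rcases ht.1.eq_or_lt with h0 | h0
  · rw [← h0]
  -- The wave equation, hence the vanishing of the derivative, is known at interior times only.
  -- Continuity on the closed interval and the mean value theorem reach the endpoints.
  · obtain ⟨c, hc1, hc2⟩ := exists_hasDerivAt_eq_slope (energy g μ T u) (fun _ => 0) h0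
      (hc.mono (Icc_subset_Icc_right ht.2)) fun s hs => hd s ⟨hs.1, hs.2.trans_le ht.2⟩
    rw [eq_comm, div_eq_zero_iff] at hc2
    rcases hc2 with h | h <;> linarith

/-- The derivative of the integral of the velocity against the multiplier. -/
theorem IsSolution.hasDerivAt_integral_multiplier (hμ : Continuous μ) (hu : IsSolution g μ T u)
    (hT : 0 < T) {ℓ s : M → ℝ} {ρ τ : ℝ} (hℓ : ContMDiff (𝓡∂ n) 𝓘(ℝ) 2 ℓ)
    (hs : ContMDiff (𝓡∂ n) 𝓘(ℝ) 1 s) :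
    ContinuousOn (fun t => ∫ x, expWeight τ ℓ x * timeDeriv T u t x
      * multiplier g ℓ s ρ (weighted τ ℓ (u t)) x ∂(weightedVolume g μ)) (Icc 0 T) ∧
    ∀ t ∈ Ioo 0 T, HasDerivAt (fun t => ∫ x, expWeight τ ℓ x * timeDeriv T u t x
        * multiplier g ℓ s ρ (weighted τ ℓ (u t)) x ∂(weightedVolume g μ))
      (∫ x, (expWeight τ ℓ x * multiplier g ℓ s ρ (weighted τ ℓ (u t)) x
          * weightedLaplacian g μ (u t) x
        + weighted τ ℓ (timeDeriv T u t) x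
          * multiplier g ℓ s ρ (weighted τ ℓ (timeDeriv T u t)) x) ∂(weightedVolume g μ)) t := by
  have := isFiniteMeasure_weightedVolume g hμ
  have hW2 : TimeSmooth n (2 : ℕ∞) T fun _ => expWeight τ ℓ :=
    timeSmooth_const (contMDiff_expWeight τ hℓ)
  have hℓ2 : TimeSmooth n (2 : ℕ∞) T fun _ => ℓ := timeSmooth_const hℓ
  have hs0 : TimeSmooth n (0 : ℕ∞) T fun _ x => 1 / 2 * (s x - ρ) :=
    timeSmooth_const (k := 0) ((contMDiff_const.mul (hs.sub contMDiff_const)).of_le zero_le_one)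
  have hW0 : TimeSmooth n (0 : ℕ∞) T fun _ => expWeight τ ℓ := hW2.of_le (by norm_num)
  have hW1 : TimeSmooth n (1 : ℕ∞) T fun _ => expWeight τ ℓ := hW2.of_le (by norm_num)
  have hv := hu.timeSmooth_timeDeriv hT
  have hv0 : TimeSmooth n (0 : ℕ∞) T (timeDeriv T u) := hv.of_le zero_le_one
  have hz0 : TimeSmooth n (0 : ℕ∞) T (timeDeriv T (timeDeriv T u)) := by
    simpa using hu.timeSmooth_timeDeriv_timeDeriv hT
  have hw : TimeSmooth n 2 T fun t => weighted τ ℓ (u t) := hW2.mul hu.timeSmooth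
  have hy : TimeSmooth n 1 T fun t => weighted τ ℓ (timeDeriv T u t) := hW1.mul hv
  have hm : ∀ {f : ℝ → M → ℝ}, TimeSmooth n 1 T f →
      TimeSmooth n (0 : ℕ∞) T fun t => multiplier g ℓ s ρ (f t) := by
    intro f hf
    have h1 : TimeSmooth n (0 + 1 : ℕ∞) T f := by simpa using hf
    have h2 : TimeSmooth n (0 + 1 : ℕ∞) T fun _ => ℓ := hℓ2.of_le (by norm_num)
    have h3 : TimeSmooth n (0 : ℕ∞) T f := hf.of_le zero_le_one
    have h4 := (h2.gradInner g hT h1).add (hs0.mul h3)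
    have h5 : (fun t => multiplier g ℓ s ρ (f t))
        = fun t x => gradInner g ℓ (f t) x + 1 / 2 * (s x - ρ) * f t x := by
      funext t x
      simp only [multiplier, mul_assoc]
    rw [h5]
    exact h4
  have hmw := hm (hw.of_le one_le_two)
  have hmy := hm hy
  have hy0 : TimeSmooth n (0 : ℕ∞) T fun t => weighted τ ℓ (timeDeriv T u t) :=
    hy.of_le zero_le_one
  have hF := (hW0.mul hv0).mul hmw
  have hF' := ((hW0.mul hmw).mul hz0).add (hy0.mul hmy)
  have hwt : ∀ t ∈ Icc 0 T, ∀ x, HasDerivWithinAt (fun r => weighted τ ℓ (u r) x)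
      (weighted τ ℓ (timeDeriv T u t) x) (Icc 0 T) t := fun t ht x =>
    (hu.timeSmooth.hasDerivWithinAt hT two_ne_zero ht x).const_mul _
  refine ⟨hF.continuousOn_integral _, fun t ht => ?_⟩
  have h := hF.hasDerivAt_integral hF' (fun t ht x => ?_) (weightedVolume g μ) ht
  · simpa only [hu.timeDeriv_timeDeriv ht] using h
  · have ht' := Ioo_subset_Icc_self ht
    -- Neither the weight nor ℓ depends on time, so differentiating the multiplier in time just
    -- replaces u by its velocity.
    have e1 : timeDeriv T (fun r => weighted τ ℓ (u r)) t = weighted τ ℓ (timeDeriv T u t) :=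
      funext fun x => (hwt t ht' x).derivWithin (uniqueDiffOn_Icc hT t ht')
    have e2 : timeDeriv T (fun _ => ℓ) t = fun _ => 0 := funext fun x => by simp [timeDeriv]
    have e3 : gradInner g (fun _ => 0) (weighted τ ℓ (u t)) x = 0 := by
      have := gradInner_const_mul_left g 0 (weighted τ ℓ (u t))
        (hℓ.mdifferentiableAt two_ne_zero : MDifferentiableAt (𝓡∂ n) 𝓘(ℝ) ℓ x)
      simpa using this
    have d1 := hℓ2.hasDerivWithinAt_gradInner g hT hw ht' x
    rw [e1, e2, e3, zero_add] at d1
    have d2 := d1.add (((hwt t ht' x).const_mul (s x - ρ)).const_mul (1 / 2))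
    have d3 : HasDerivAt (fun r => multiplier g ℓ s ρ (weighted τ ℓ (u r)) x)
        (multiplier g ℓ s ρ (weighted τ ℓ (timeDeriv T u t)) x) t :=
      d2.hasDerivAt (Icc_mem_nhds ht.1 ht.2)
    have d4 := ((hv.hasDerivAt hT one_ne_zero ht x).const_mul (expWeight τ ℓ x)).mul d3
    refine d4.congr_deriv ?_
    simp only [weighted]
    ring

/-- On the Dirichlet boundary the observed quantity depends continuously on time. -/
theorem IsSolution.continuousOn_integral_normalDeriv (hμ : ContMDiff (𝓡∂ n) 𝓘(ℝ) ∞ μ)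
    (hu : IsSolution g μ T u) (hT : 0 < T) (Γ : Set M) :
    ContinuousOn (fun t => ∫ x in Γ, normalDeriv g (u t) x ^ 2 * μ x ∂(surfaceMeasure g))
      (Icc 0 T) := by
  have := isFiniteMeasure_surfaceMeasure g
  have hu1 : TimeSmooth n (0 + 1 : ℕ∞) T u := hu.timeSmooth.of_le (by norm_num)
  have hF : TimeSmooth n (0 : ℕ∞) T fun t x => gradInner g (u t) (u t) x * μ x :=
    (hu1.gradInner g hT hu1).mul (timeSmooth_const (k := 0) (hμ.of_le (by simp)))
  -- On the boundary (∂_ν u)² = |∇u|², and the latter is jointly continuous on [0,T] × M, whereas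
  -- the normal derivative is controlled only on the boundary.
  refine (hF.continuousOn_integral ((surfaceMeasure g).restrict Γ)).congr fun t ht => ?_
  refine integral_congr_ae (ae_restrict_of_ae ?_)
  filter_upwards [ae_surfaceMeasure_mem_boundary g] with x hx
  have h1 : ContMDiff (𝓡∂ n) 𝓘(ℝ) 1 (u t) := by simpa using hu1.contMDiff ht
  rw [gradInner_of_zero_boundary g h1 (fun x hx => hu.eq_zero_of_mem_boundary hT ht hx) _ hx, sq]

end Solution

end

section

/-! ### The observability inequality -/

section Suprema

variable [CompactSpace M]

omit [ChartedSpace (EuclideanHalfSpace n) M] [IsManifold (𝓡∂ n) ∞ M] [NeZero n] in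
theorem le_iSup_of_continuous {f : M → ℝ} (hf : Continuous f) (x : M) : f x ≤ ⨆ y, f y :=
  le_ciSup (by simpa [image_univ] using isCompact_univ.bddAbove_image hf.continuousOn) x

omit [ChartedSpace (EuclideanHalfSpace n) M] [IsManifold (𝓡∂ n) ∞ M] [NeZero n] in
theorem iInf_le_of_continuous {f : M → ℝ} (hf : Continuous f) (x : M) : ⨅ y, f y ≤ f x :=
  ciInf_le (by simpa [image_univ] using isCompact_univ.bddBelow_image hf.continuousOn) x

omit [IsManifold (𝓡∂ n) ∞ M] [ChartedSpace (EuclideanHalfSpace n) M] [NeZero n] in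
theorem expWeight_sq_le {τ : ℝ} (hτ : 0 ≤ τ) {ℓ : M → ℝ} (hℓ : Continuous ℓ) (x : M) :
    expWeight τ ℓ x ^ 2 ≤ Real.exp (constB ℓ * τ) := by
  rw [expWeight, ← Real.exp_nat_mul, Real.exp_le_exp, constB]
  have := mul_le_mul_of_nonneg_left (le_iSup_of_continuous hℓ x) hτ
  push_cast
  linarith

omit [IsManifold (𝓡∂ n) ∞ M] [ChartedSpace (EuclideanHalfSpace n) M] [NeZero n] in
theorem exp_le_expWeight_sq {τ : ℝ} (hτ : 0 ≤ τ) {ℓ : M → ℝ} (hℓ : Continuous ℓ) (x : M) :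
    Real.exp (constβ ℓ * τ) ≤ expWeight τ ℓ x ^ 2 := by
  rw [expWeight, ← Real.exp_nat_mul, Real.exp_le_exp, constβ]
  have := mul_le_mul_of_nonneg_left (iInf_le_of_continuous hℓ x) hτ
  push_cast
  linarith

omit [CompactSpace M] in
theorem continuous_gnorm_gradient (g : SmoothMetric n M) {f : M → ℝ}
    (hf : ContMDiff (𝓡∂ n) 𝓘(ℝ) 1 f) : Continuous fun x => gnorm g x (gradient g f x) :=
  (continuous_gradInner g hf hf).sqrt

end Suprema

variable [MeasurableSpace M] [BorelSpace M] [CompactSpace M] [T2Space M]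
  {g : SmoothMetric n M} {μ ℓ : M → ℝ} {T ρ r CF : ℝ} {u : ℝ → M → ℝ}

/-- The integrated multiplier inequality on the time interval `[0, T]`. -/
theorem IsSolution.energy_le_observation
    (hμ : ContMDiff (𝓡∂ n) 𝓘(ℝ) ∞ μ) (hμpos : ∀ x, 0 < μ x) (hℓ : ContMDiff (𝓡∂ n) 𝓘(ℝ) 3 ℓ)
    (hρ : 0 < ρ) (hr : 0 < r)
    (hconv : ∀ (x : M) (X : TangentSpace (𝓡∂ n) x), ρ * gnorm g x X ^ 2 ≤ hessian g ℓ x X X)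
    (hgrad : ∀ x : M, r ≤ gnorm g x (gradient g ℓ x))
    {Γ : Set M} (hΓm : MeasurableSet Γ)
    (hΓ : {x | x ∈ (𝓡∂ n).boundary M ∧ 0 < normalDeriv g ℓ x} ⊆ Γ)
    (hCF : 1 ≤ CF) (hF : FriedrichsConst g μ CF) (hT : 0 < T) (hu : IsSolution g μ T u) :
    T * (1 / (2 * constτ g μ ℓ ρ r) * (Real.exp (constβ ℓ * constτ g μ ℓ ρ r) * energy g μ T u 0))
      ≤ 1 / 2 * Real.exp (constB ℓ * constτ g μ ℓ ρ r) * (⨆ x : M, gnorm g x (gradient g ℓ x))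
          * (∫ t in (0 : ℝ)..T, ∫ x in Γ, normalDeriv g (u t) x ^ 2 * μ x ∂(surfaceMeasure g))
        + Real.exp (constB ℓ * constτ g μ ℓ ρ r)
          * (const₃ g ℓ CF * constτ g μ ℓ ρ r + const₄ g μ ℓ ρ CF) * energy g μ T u 0 := by
  have hτ : 3 / ρ ≤ constτ g μ ℓ ρ r := le_max_left _ _
  have hC : const₁ g μ ℓ ρ / (2 * ρ * r ^ 2) ≤ constτ g μ ℓ ρ r := le_max_right _ _
  set τ := constτ g μ ℓ ρ r
  have hτ0 : 0 < τ := lt_of_lt_of_le (by positivity) hτ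
  have hℓ2 : ContMDiff (𝓡∂ n) 𝓘(ℝ) 2 ℓ := hℓ.of_le (by norm_num)
  have hℓ1 := hℓ2.of_le one_le_two
  have hs : ContMDiff (𝓡∂ n) 𝓘(ℝ) 1 (weightedLaplacian g μ ℓ) := by
    have := contMDiff_weightedLaplacian (k := 1) g hμ hμpos (h := ℓ)
      (hℓ.of_le (by norm_cast))
    exact_mod_cast this
  have hS : ∀ x, ρ ^ 2 + gradInner g (weightedLaplacian g μ ℓ) (weightedLaplacian g μ ℓ) x
      ≤ const₁ g μ ℓ ρ := fun x => by
    rw [← gnorm_gradient_sq]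
    exact add_le_add_right (le_iSup_of_continuous ((continuous_gnorm_gradient g hs).pow 2) x) _
  have hA := le_iSup_of_continuous (continuous_gnorm_gradient g hℓ1)
  have hA₂ : ∀ x, gradInner g ℓ ℓ x ≤ ⨆ x : M, gnorm g x (gradient g ℓ x) ^ 2 := fun x => by
    rw [← gnorm_gradient_sq]
    exact le_iSup_of_continuous ((continuous_gnorm_gradient g hℓ1).pow 2) x
  have hSρ := le_iSup_of_continuous ((hs.continuous.sub (continuous_const (y := ρ))).abs)
  have hA0 : 0 ≤ ⨆ x : M, gnorm g x (gradient g ℓ x) :=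
    Real.iSup_nonneg fun x => gnorm_nonneg g x _
  have hb := expWeight_sq_le hτ0.le hℓ.continuous
  have ha := exp_le_expWeight_sq hτ0.le hℓ.continuous
  have hu2 : ∀ t ∈ Icc 0 T, ContMDiff (𝓡∂ n) 𝓘(ℝ) 2 (u t) :=
    fun t ht => hu.timeSmooth.contMDiff (k := 2) ht
  have hv1 : ∀ t ∈ Icc 0 T, ContMDiff (𝓡∂ n) 𝓘(ℝ) 1 (timeDeriv T u t) :=
    fun t ht => (hu.timeSmooth_timeDeriv hT).contMDiff (k := 1) ht
  have hu0 := fun t (ht : t ∈ Icc 0 T) x hx => hu.eq_zero_of_mem_boundary hT ht (x := x) hx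
  have hv0 := fun t (ht : t ∈ Icc 0 T) x hx =>
    hu.timeDeriv_eq_zero_of_mem_boundary hT ht (x := x) hx
  have hE := fun t (ht : t ∈ Icc 0 T) => hu.energy_eq_energy_zero hμ hμpos hT ht
  simp only [energy_eq g μ T u] at hE
  rw [energy_eq]
  set E := ∫ x, (timeDeriv T u 0 x ^ 2 + gradInner g (u 0) (u 0) x) ∂(weightedVolume g μ)
  set b := Real.exp (constB ℓ * τ)
  set a := Real.exp (constβ ℓ * τ)
  set A := ⨆ x : M, gnorm g x (gradient g ℓ x)
  obtain ⟨hFc, hFd⟩ := hu.hasDerivAt_integral_multiplier hμ.continuous hT (ρ := ρ) (τ := τ) hℓ2 hs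
  set F : ℝ → ℝ := fun t => ∫ x, expWeight τ ℓ x * timeDeriv T u t x
    * multiplier g ℓ (weightedLaplacian g μ ℓ) ρ (weighted τ ℓ (u t)) x ∂(weightedVolume g μ)
  have hFb : ∀ t ∈ Icc 0 T, |F t| ≤ 1 / 2 * b * (const₃ g ℓ CF * τ + const₄ g μ ℓ ρ CF) * E := by
    intro t ht
    rw [← hE t ht]
    exact abs_integral_multiplier_le hμ.continuous hℓ1 ((hu2 t ht).of_le one_le_two)
      (hv1 t ht).continuous (hu0 t ht) hτ0.le hCF hF hb hA hA₂ hSρ hA0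
      (Real.iSup_nonneg fun x => sq_nonneg _) (Real.iSup_nonneg fun x => abs_nonneg _)
      (Real.exp_pos _).le
  set γ : ℝ → ℝ := fun t => ∫ x in Γ, normalDeriv g (u t) x ^ 2 * μ x ∂(surfaceMeasure g)
  have hγ : ContinuousOn γ (Icc 0 T) := hu.continuousOn_integral_normalDeriv hμ hT Γ
  have hφ : ContinuousOn (fun t => 1 / 2 * b * A * γ t - 1 / (2 * τ) * (a * E)) (Icc 0 T) :=
    (continuousOn_const.mul hγ).sub continuousOn_const
  -- The one-sided form of the fundamental theorem needs F differentiable only on the open interval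
  -- and its derivative only bounded above by an integrable function.
  have hle := intervalIntegral.sub_le_integral_of_hasDeriv_right_of_le hT.le hFc
    (fun t ht => (hFd t ht).hasDerivWithinAt) (hφ.integrableOn_compact isCompact_Icc)
    (fun t ht => by
      have ht' := Ioo_subset_Icc_self ht
      have h := integral_multiplier_le g hμ hμpos hℓ (hu2 t ht') (hv1 t ht') (hu0 t ht')
        (hv0 t ht') hρ hr hτ hC hconv hgrad hS hΓm hΓ ha hb hA hA0 (Real.exp_pos _).le
      rwa [hE t ht'] at h)
  rw [intervalIntegral.integral_sub
      ((hγ.intervalIntegrable_of_Icc hT.le).const_mul _) intervalIntegrable_const,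
    intervalIntegral.integral_const_mul, intervalIntegral.integral_const, sub_zero,
    smul_eq_mul] at hle
  -- Each endpoint contributes half of e^{Bτ}(C₃τ + C₄)E; together they give the last term of the
  -- inequality.
  have h0 := abs_le.1 (hFb 0 ⟨le_rfl, hT.le⟩)
  have h1 := abs_le.1 (hFb T ⟨hT.le, le_rfl⟩)
  linarith

end

end WeightedWave

end

/-! ### Absorption of the endpoint terms -/

theorem mainTheorem5 {n : ℕ} [NeZero n] {M : Type*} [TopologicalSpace M] [T2Space M]
    [CompactSpace M] [ChartedSpace (EuclideanHalfSpace n) M] [IsManifold (𝓡∂ n) ∞ M]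
    [MeasurableSpace M] [BorelSpace M]
    (g : WeightedWave.SmoothMetric n M)
    (μ : M → ℝ) (hμ : ContMDiff (𝓡∂ n) 𝓘(ℝ) ∞ μ) (hμpos : ∀ x, 0 < μ x)
    (ℓ : M → ℝ) (hℓ : ContMDiff (𝓡∂ n) 𝓘(ℝ) 3 ℓ)
    (ρ r : ℝ) (hρ : 0 < ρ) (hr : 0 < r)
    (hconv : ∀ (x : M) (X : TangentSpace (𝓡∂ n) x),
      ρ * WeightedWave.gnorm g x X ^ 2 ≤ WeightedWave.hessian g ℓ x X X)
    (hgrad : ∀ x : M, r ≤ WeightedWave.gnorm g x (WeightedWave.gradient g ℓ x))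
    (Γ : Set M) (hΓmeas : MeasurableSet Γ) (hΓbdry : Γ ⊆ (𝓡∂ n).boundary M)
    (hΓ : {x | x ∈ (𝓡∂ n).boundary M ∧
      0 < g.inner x (WeightedWave.gradient g ℓ x) (WeightedWave.unitNormal g x)} ⊆ Γ)
    (CF : ℝ) (hCF : 1 ≤ CF) (hFriedrichs : WeightedWave.FriedrichsConst g μ CF)
    (T : ℝ) (hT : WeightedWave.timeBound g μ ℓ ρ r CF < T)
    (u : ℝ → M → ℝ) (hu : WeightedWave.IsSolution g μ T u) :
    WeightedWave.energy g μ T u 0 ≤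
      WeightedWave.obsConst g μ ℓ ρ r CF T *
        ∫ t in (0 : ℝ)..T, ∫ x in Γ, WeightedWave.normalDeriv g (u t) x ^ 2 * μ x
          ∂(WeightedWave.surfaceMeasure g) := by
  have hτ0 : 0 < WeightedWave.constτ g μ ℓ ρ r :=
    lt_of_lt_of_le (by positivity) (le_max_left _ _)
  -- Real suprema of empty or unbounded families are 0 by convention, so nonnegativity requires
  -- neither a point of M nor compactness.
  have hA0 : 0 ≤ ⨆ x : M, WeightedWave.gnorm g x (WeightedWave.gradient g ℓ x) :=
    Real.iSup_nonneg fun x => WeightedWave.gnorm_nonneg g x _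
  have hCF0 : 0 ≤ CF := zero_le_one.trans hCF
  have h₃ : 0 ≤ WeightedWave.const₃ g ℓ CF :=
    mul_nonneg hCF0 (Real.iSup_nonneg fun x => sq_nonneg _)
  have h₄ : 0 ≤ WeightedWave.const₄ g μ ℓ ρ CF := by
    have : 0 ≤ ⨆ x : M, |WeightedWave.weightedLaplacian g μ ℓ x - ρ| :=
      Real.iSup_nonneg fun x => abs_nonneg _
    unfold WeightedWave.const₄
    positivity
  -- The positivity of T is a consequence: the lower bound for the observation time is nonnegative.
  have hT0 : 0 < T := lt_of_le_of_lt (by unfold WeightedWave.timeBound; positivity) hT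
  have hmain := hu.energy_le_observation hμ hμpos hℓ hρ hr hconv hgrad hΓmeas hΓ hCF hFriedrichs
    hT0
  have hI : 0 ≤ ∫ t in (0 : ℝ)..T, ∫ x in Γ, WeightedWave.normalDeriv g (u t) x ^ 2 * μ x
      ∂(WeightedWave.surfaceMeasure g) :=
    intervalIntegral.integral_nonneg hT0.le fun t _ => MeasureTheory.integral_nonneg fun x =>
      mul_nonneg (sq_nonneg _) (hμpos x).le
  rw [WeightedWave.obsConst, div_mul_eq_mul_div, le_div_iff₀ (sub_pos.2 hT),
    WeightedWave.timeBound, WeightedWave.const₂]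
  set τ := WeightedWave.constτ g μ ℓ ρ r
  set E := WeightedWave.energy g μ T u 0
  set I := ∫ t in (0 : ℝ)..T, ∫ x in Γ, WeightedWave.normalDeriv g (u t) x ^ 2 * μ x
    ∂(WeightedWave.surfaceMeasure g)
  set A := ⨆ x : M, WeightedWave.gnorm g x (WeightedWave.gradient g ℓ x)
  set K := WeightedWave.const₃ g ℓ CF * τ + WeightedWave.const₄ g μ ℓ ρ CF
  set a := Real.exp (WeightedWave.constβ ℓ * τ)
  set X := Real.exp ((WeightedWave.constB ℓ - WeightedWave.constβ ℓ) * τ)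
  have ha : 0 < a := Real.exp_pos _
  have hX : 0 < X := Real.exp_pos _
  -- Dividing by e^{βτ} then leaves only the exponential of the oscillation (B-β)τ.
  have hb : Real.exp (WeightedWave.constB ℓ * τ) = a * X := by
    rw [← Real.exp_add]; congr 1; ring
  rw [hb] at hmain
  have h1 : T * E ≤ X * τ * A * I + 2 * K * X * τ * E := by
    refine le_of_mul_le_mul_left ?_ ha
    have h2 := mul_le_mul_of_nonneg_left hmain (by positivity : 0 ≤ 2 * τ)
    have h3 : 2 * τ * (T * (1 / (2 * τ) * (a * E))) = a * (T * E) := by field_simp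
    rw [h3] at h2
    linarith
  -- The argument yields the observation with factor A = max|∇ℓ|, while `const₂` is 3A;
  -- nonnegativity of this term covers the difference.
  have h2 : 0 ≤ X * τ * A * I := by positivity
  linarith
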